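/- **Model.** Let $U_1,U_2,\dots$ and $V_1,V_2,\dots$ be two independent i.i.d. sequences of nonnegative random variables with $\mathbb E[U_n]=\mathbb E[V_n]=1$, where the law of $V_n$ has a bounded density. A single-server FIFO queue with service rate $\mu$ and service fee $p$ has interarrival times $U_n/\lambda(p)$ and service times $V_n/\mu$. Let $\mathcal B=[\underline\mu,\bar\mu]\times[\underline p,\bar p]$ be the feasible set of $\vartheta=(\mu,p)$, let $\mathbb E[Q_\infty(\mu,p)]$ be the steady-state mean number of customers in the system (long-run time average), and let $$f(\mu,p)=h_0\,\mathbb E[Q_\infty(\mu,p)]+c(\mu)-p\lambda(p).$$ **Algorithm (SAMCMC).** Start from $x_1=(w_1,y_1)=(0,0)$ and $\vartheta_1=(\mu_1,p_1)\in\mathcal B$. For $t\ge1$ set $$w_{t+1}=\Bigl(w_t-\tfrac{U_t}{\lambda(p_t)}+\tfrac{V_t}{\mu_t}\Bigr)_+,\qquad y_{t+1}=\Bigl(y_t+\tfrac{U_t}{\lambda(p_t)}\Bigr)\mathbf 1(w_{t+1}>0),\qquad \vartheta_{t+1}=\Pi_{\mathcal B}\bigl(\vartheta_t-\eta_tH(\vartheta_t,x_t)\bigr),$$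 where $\Pi_{\mathcal B}$ is the Euclidean projection onto $\mathcal B$, $x=(w,y)$, and, in the coordinates $(\mu,p)$, $$H(\vartheta,x)=\Bigl(c'(\mu)-h_0\tfrac{\lambda(p)}{\mu}\bigl(w+y+\tfrac1\mu\bigr),\ -\lambda(p)-p\lambda'(p)+h_0\lambda'(p)\bigl(w+y+\tfrac1\mu\bigr)\Bigr).$$ **Assumptions.** 1. $\lambda$ is positive, non-increasing and continuously differentiable with Lipschitz derivative on $[\underline p,\bar p]$; $c$ is non-decreasing and continuously differentiable on $[\underline\mu,\bar\mu]$; and $\lambda(\underline p)<\underline\mu$. 2. For some $\varepsilon>0$, $\mathbb E[e^{\varepsilon V_n}]<\infty$ and $\mathbb E[e^{\varepsilon U_n}]<\infty$. There are $0<\tau<\varepsilon/(2\bar\mu)$, $0<a<(\underline\mu-\lambda(\underline p))/(\underline\mu+\lambda(\underline p))$ and $b>0$ such that $\phi_U(-\tau/(1-a))<-\tau-b/2$ and $\phi_V(\tau/(1+a))<\tau-b/2$, where $\phi_U,\phi_V$ are the cumulant generating functions of $U_n$ and $V_n$. 3. $f$ has a minimizer $\theta^*$ over $\mathcal B$ in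 the interior of $\mathcal B$, and there are constants $C_\Theta>0$, $0<K_0\le1$ and $K_1>K_0$ such that for all $\vartheta\in\mathcal B$: $\|\vartheta\|\le C_\Theta$, $\langle\vartheta-\theta^*,\nabla f(\vartheta)\rangle\ge K_0\|\vartheta-\theta^*\|^2$ and $\|\nabla f(\vartheta)\|\le K_1\|\vartheta-\theta^*\|$. 4. The step sizes $(\eta_t)_{t\ge1}$ are non-increasing with $0<\eta_t<\min\{2/K_0,\ K_0/(\varkappa+3K_0)\}$ for $t\ge1$ and $|1/\eta_t-1/\eta_{t-1}|\le\varkappa$ for $t\ge2$, where $0<\varkappa\le K_0/2$. Let $\kappa>0$ be a constant. **Theorem 1.** Suppose Assumptions 1–3 hold, and write $\Delta_t=\mathbb E\|\vartheta_t-\theta^*\|^2$. Then there are positive constants $\overline\Delta$ and $C_\star$, depending only on the problem, such that for all $\varkappa$, $\kappa$, $(\eta_t)$ as in Assumption 4, all $\vartheta_1\in\mathcal B$ and all $t\ge1$, $$\Delta_{t+1}\le\prod_{s=2}^t(1-K_0\eta_s)\,\Delta_1+\eta_t\bigl[(1+8\kappa)\overline\Delta+18\kappa C_\star\bigr].$$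 Moreover, for step sizes $\eta_t=\gamma/t$ with $\gamma\ge 2/K_0$ there is a constant $C$, depending only on the problem and $\gamma$, such that $\Delta_t\le C/t$ for all $t\ge1$ and all $\vartheta_1\in\mathcal B$. -/

import Mathlib

open MeasureTheory ProbabilityTheory Filter Topology
open scoped NNReal ENNReal

noncomputable section

namespace GIGI1

/-- A control parameter `ϑ = (μ, p)`, with the Euclidean norm: `ϑ 0` is the service rate `μ` and
`ϑ 1` is the service fee `p`. -/
abbrev Param : Type := EuclideanSpace ℝ (Fin 2)

/-- The data of the pricing / capacity problem: the endpoints of the feasible intervals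
`[μlo, μhi]` and `[plo, phi]`, the holding cost `h0`, the demand rate `lam` and the
staffing cost `cost`. -/
structure Problem where
  μlo : ℝ
  μhi : ℝ
  plo : ℝ
  phi : ℝ
  h0 : ℝ
  lam : ℝ → ℝ
  cost : ℝ → ℝ

namespace Problem

/-- The feasible set `[μlo, μhi] × [plo, phi]`. -/
def box (M : Problem) : Set Param :=
  {ϑ | ϑ 0 ∈ Set.Icc M.μlo M.μhi ∧ ϑ 1 ∈ Set.Icc M.plo M.phi}

/-- The derivative of the demand rate on the price interval (one-sided at the endpoints). -/
def lam' (M : Problem) (p : ℝ) : ℝ := derivWithin M.lam (Set.Icc M.plo M.phi) p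

/-- The derivative of the staffing cost on the interval of service rates. -/
def cost' (M : Problem) (m : ℝ) : ℝ := derivWithin M.cost (Set.Icc M.μlo M.μhi) m

/-- The Euclidean projection onto the feasible box. -/
def proj (M : Problem) (z : Param) : Param :=
  !₂[max M.μlo (min M.μhi (z 0)), max M.plo (min M.phi (z 1))]

theorem proj_mem (M : Problem) (hμ : M.μlo ≤ M.μhi) (hp : M.plo ≤ M.phi) (z : Param) :
    M.proj z ∈ M.box := by
  simp [proj, box, hμ, hp]

/-- `proj` is the nearest-point map of the box. -/
theorem dist_proj_le (M : Problem) (z : Param) {q : Param} (hq : q ∈ M.box) :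
    dist z (M.proj z) ≤ dist z q := by
  obtain ⟨⟨h1, h2⟩, h3, h4⟩ := hq
  have key : ∀ a b x y : ℝ, a ≤ y → y ≤ b →
      dist x (max a (min b x)) ^ 2 ≤ dist x y ^ 2 := by
    intro a b x y hay hyb
    apply pow_le_pow_left₀ dist_nonneg
    rw [Real.dist_eq, Real.dist_eq]
    rcases le_total b x with hbx | hbx
    · rw [min_eq_left hbx, max_eq_right (hay.trans hyb), abs_of_nonneg (by linarith),
        abs_of_nonneg (by linarith)]
      linarith
    · rw [min_eq_right hbx]
      rcases le_total a x with hax | hax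
      · rw [max_eq_right hax]; simp
      · rw [max_eq_left hax, abs_of_nonpos (by linarith), abs_of_nonpos (by linarith)]
        linarith
  rw [EuclideanSpace.dist_eq, EuclideanSpace.dist_eq]
  apply Real.sqrt_le_sqrt
  simp only [Fin.sum_univ_two]
  have e0 : M.proj z 0 = max M.μlo (min M.μhi (z 0)) := by simp [proj]
  have e1 : M.proj z 1 = max M.plo (min M.phi (z 1)) := by simp [proj]
  rw [e0, e1]
  exact add_le_add (key _ _ _ _ h1 h2) (key _ _ _ _ h3 h4)

end Problem

/-! ### The queue under a fixed parameter -/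

section Queue

variable {Ω : Type*} [MeasurableSpace Ω] (M : Problem) (P : Measure Ω) (U V : ℕ → Ω → ℝ)

/-- Waiting time (before service) of customer `n` when the parameter is held fixed at `ϑ`;
customer `0` finds an empty system. -/
def waiting (ϑ : Param) : ℕ → Ω → ℝ
  | 0, _ => 0
  | n + 1, ω => max (waiting ϑ n ω - U n ω / M.lam (ϑ 1) + V n ω / ϑ 0) 0

/-- Arrival time of customer `n`; customer `0` arrives at time `0`. -/
def arrival (ϑ : Param) (n : ℕ) (ω : Ω) : ℝ :=
  ∑ k ∈ Finset.range n, U k ω / M.lam (ϑ 1)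

/-- Departure time of customer `n`. -/
def departure (ϑ : Param) (n : ℕ) (ω : Ω) : ℝ :=
  arrival M U ϑ n ω + waiting M U V ϑ n ω + V n ω / ϑ 0

open Classical in
/-- Queue length at time `t`: the number of customers who have arrived and not yet departed
(waiting or in service). -/
def queueLength (ϑ : Param) (t : ℝ) (ω : Ω) : ℝ≥0∞ :=
  ∑' n : ℕ, if arrival M U ϑ n ω ≤ t ∧ t < departure M U V ϑ n ω then 1 else 0

/-- Average over `[0, T]` of the expected queue length. -/
def avgQueueLength (ϑ : Param) (T : ℝ) : ℝ :=
  (∫⁻ t in Set.Icc 0 T, ∫⁻ ω, queueLength M U V ϑ t ω ∂P).toReal / T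

/-- Steady-state mean queue length `E[Q_∞(μ, p)]`: the limit of the time averages
of the expected queue length. -/
def steadyQueueLength (ϑ : Param) : ℝ :=
  limUnder atTop (avgQueueLength M P U V ϑ)

/-- The cost rate `f(μ, p) = h0 E[Q_∞(μ, p)] + c(μ) - p λ(p)`. -/
def objective (ϑ : Param) : ℝ :=
  M.h0 * steadyQueueLength M P U V ϑ + M.cost (ϑ 0) - ϑ 1 * M.lam (ϑ 1)

/-- The gradient of the cost rate on the feasible box (one-sided on its boundary). -/
def gradObjective (ϑ : Param) : Param :=
  gradientWithin (objective M P U V) M.box ϑ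

end Queue

/-! ### The algorithm -/

/-- The system state `x = (w, y)`: waiting time and observed busy period. -/
abbrev State : Type := ℝ × ℝ

/-- The stochastic gradient `H(ϑ, x)`; coordinate `0` is the derivative in `μ`,
coordinate `1` the derivative in `p`. -/
def gradEst (M : Problem) (ϑ : Param) (x : State) : Param :=
  !₂[M.cost' (ϑ 0) - M.h0 * (M.lam (ϑ 1) / ϑ 0) * (x.1 + x.2 + 1 / ϑ 0),
    - M.lam (ϑ 1) - ϑ 1 * M.lam' (ϑ 1) + M.h0 * M.lam' (ϑ 1) * (x.1 + x.2 + 1 / ϑ 0)]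

/-- One step `x ↦ (w', y')` of waiting time and observed busy period under the parameter `ϑ`,
driven by `u` and `v`. -/
def stateStep (M : Problem) (ϑ : Param) (x : State) (u v : ℝ) : State :=
  let w' := max (x.1 - u / M.lam (ϑ 1) + v / ϑ 0) 0
  (w', if 0 < w' then x.2 + u / M.lam (ϑ 1) else 0)

/-- The iterates `(ϑ_t, x_t)`, `t ≥ 1`, started at `(ϑ₁, (0, 0))`. The time index starts at `1`;
the value at `0` is a placeholder. -/
def samcmc {Ω : Type*} (M : Problem) (U V : ℕ → Ω → ℝ) (η : ℕ → ℝ) (ϑ₁ : Param) :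
    ℕ → Ω → Param × State
  | 0, _ => (ϑ₁, (0, 0))
  | 1, _ => (ϑ₁, (0, 0))
  | t + 2, ω =>
    let s := samcmc M U V η ϑ₁ (t + 1) ω
    (M.proj (s.1 - η (t + 1) • gradEst M s.1 s.2),
      stateStep M s.1 s.2 (U (t + 1) ω) (V (t + 1) ω))

/-- The mean-square error `Δ_t = E ‖ϑ_t - θ‖²`. -/
def msErr {Ω : Type*} [MeasurableSpace Ω] (M : Problem) (P : Measure Ω) (U V : ℕ → Ω → ℝ)
    (η : ℕ → ℝ) (ϑ₁ θ : Param) (t : ℕ) : ℝ :=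
  ∫ ω, ‖(samcmc M U V η ϑ₁ t ω).1 - θ‖ ^ 2 ∂P

/-! ### The assumptions -/

/-- `U` and `V` are independent i.i.d. sequences of nonnegative random variables of mean one, and
the law of the `V n` has a bounded density. -/
structure DrivingSequences {Ω : Type*} [MeasurableSpace Ω] (P : Measure Ω)
    (U V : ℕ → Ω → ℝ) : Prop where
  measurable_U : ∀ n, Measurable (U n)
  measurable_V : ∀ n, Measurable (V n)
  indep : iIndepFun (Sum.elim U V) P
  ident_U : ∀ n, IdentDistrib (U n) (U 0) P P
  ident_V : ∀ n, IdentDistrib (V n) (V 0) P P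
  nonneg_U : ∀ n, ∀ᵐ ω ∂P, 0 ≤ U n ω
  nonneg_V : ∀ n, ∀ᵐ ω ∂P, 0 ≤ V n ω
  integrable_U : Integrable (U 0) P
  integrable_V : Integrable (V 0) P
  mean_U : ∫ ω, U 0 ω ∂P = 1
  mean_V : ∫ ω, V 0 ω ∂P = 1
  bounded_density : ∃ b : ℝ≥0, P.map (V 0) ≤ b • (volume : Measure ℝ)

/-- Demand rate, staffing cost, and uniform stability. -/
structure UniformStability (M : Problem) : Prop where
  lam_pos : ∀ p ∈ Set.Icc M.plo M.phi, 0 < M.lam p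
  lam_smooth : ContDiffOn ℝ 1 M.lam (Set.Icc M.plo M.phi)
  lam'_lipschitz : ∃ L : ℝ≥0, LipschitzOnWith L M.lam' (Set.Icc M.plo M.phi)
  lam_anti : AntitoneOn M.lam (Set.Icc M.plo M.phi)
  cost_smooth : ContDiffOn ℝ 1 M.cost (Set.Icc M.μlo M.μhi)
  cost_mono : MonotoneOn M.cost (Set.Icc M.μlo M.μhi)
  stable : M.lam M.plo < M.μlo

/-- Light-tailed service and inter-arrival times. -/
def LightTails {Ω : Type*} [MeasurableSpace Ω] (M : Problem) (P : Measure Ω)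
    (U V : ℕ → Ω → ℝ) : Prop :=
  ∃ η : ℝ, 0 < η ∧ Integrable (fun ω => Real.exp (η * V 0 ω)) P ∧
    Integrable (fun ω => Real.exp (η * U 0 ω)) P ∧
    ∃ θ a γ : ℝ, 0 < θ ∧ θ < η / (2 * M.μhi) ∧
      0 < a ∧ a < (M.μlo - M.lam M.plo) / (M.μlo + M.lam M.plo) ∧ 0 < γ ∧
      Integrable (fun ω => Real.exp (θ / (1 + a) * V 0 ω)) P ∧
      cgf (U 0) P (-θ / (1 - a)) < -θ - γ / 2 ∧
      cgf (V 0) P (θ / (1 + a)) < θ - γ / 2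

/-- Convexity and smoothness of the cost rate around its minimizer `θ`. -/
structure ConvexSmooth {Ω : Type*} [MeasurableSpace Ω] (M : Problem) (P : Measure Ω)
    (U V : ℕ → Ω → ℝ) (θ : Param) (CΘ K₀ K₁ : ℝ) : Prop where
  CΘ_pos : 0 < CΘ
  K₀_pos : 0 < K₀
  K₀_le_one : K₀ ≤ 1
  K₀_lt_K₁ : K₀ < K₁
  minimizer : IsMinOn (objective M P U V) M.box θ
  inner_point : θ ∈ interior M.box
  bounded : ∀ ϑ ∈ M.box, ‖ϑ‖ ≤ CΘ
  monotone : ∀ ϑ ∈ M.box, K₀ * ‖ϑ - θ‖ ^ 2 ≤ inner ℝ (ϑ - θ) (gradObjective M P U V ϑ)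
  growth : ∀ ϑ ∈ M.box, ‖gradObjective M P U V ϑ‖ ≤ K₁ * ‖ϑ - θ‖

/-- Conditions on the step sizes `η_t`, `t ≥ 1`. -/
structure StepSizes (K₀ ϰ κ : ℝ) (η : ℕ → ℝ) : Prop where
  κ_pos : 0 < κ
  ϰ_pos : 0 < ϰ
  ϰ_le : ϰ ≤ K₀ / 2
  decreasing : ∀ s t, 1 ≤ s → s ≤ t → η t ≤ η s
  pos : ∀ t, 1 ≤ t → 0 < η t
  small : ∀ t, 1 ≤ t → η t < min (2 / K₀) (K₀ / (ϰ + 3 * K₀))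
  slow : ∀ t, 2 ≤ t → |1 / η t - 1 / η (t - 1)| ≤ ϰ

end GIGI1

end

open GIGI1

noncomputable section

namespace GIGI1

/-! ### The waiting-time chain in terms of mean service and inter-arrival times -/

/-! In the variables α = 1/μ and β = 1/λ(p) the state (w, y) follows a Lindley recursion that
returns to the exact point (0, 0) whenever the server empties. Since 1/μlo < 1/λ(plo), the random
walk behind it has negative drift uniformly over the box, so for small θ and σ the function exp(θw +
σy) contracts in mean on every step that does not empty the queue. This gives bounds on excursions
from (0, 0) and on moments, uniform in the parameters even when these change adaptively from step to
step.

The estimator is unbiased in stationarity. On each path w is a maximum of linear functions of (α,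
β), and (w + y)/α and -y/β are the coefficients of the maximizing one, so the stationary mean
waiting time satisfies a subgradient inequality (`statMean_subgradient`). Its subgradients are
Lipschitz in the parameters, hence they are derivatives (`hasFDerivWithinAt_statMean`). Little's law
turns the time-averaged queue length into λ(w̄ + 1/μ), and the chain rule identifies ∇f with H at
the stationary means of w and y (`gradObjective_eq`).

The Markovian noise is H - ∇f = ((w + y) - stationary mean) times a direction depending on the
parameter only. It is removed by a Poisson equation solved by excursions: h = (expected cost until
emptying) - mean × (expected time until emptying). The delicate point is that h is Lipschitz in the
parameter (`poisson_lipschitz`). Two chains driven by the same inputs stay close until one of them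
empties alone, and the bounded density of the service times makes the probability of this
proportional to their distance (`lintegral_mismatch_le`, `occ_lipschitz`).

Expanding the squared distance after a projected step and inserting the Poisson equation gives, with
a bounded sequence G, Δ_{t+1} ≤ (1 - 2K₀η_t)Δ_t + 2η_t(G_{t+1} - G_t) + Cη_t²
(`exists_msErr_recursion`). Half of the contraction pays for the slow variation of η in a summation
by parts, and the other half yields both claimed bounds (`recursion_bound`,
`recursion_bound_harmonic`). -/

/-- One step of waiting time and observed busy period when the mean service time is `q.1` and the
mean inter-arrival time is `q.2`, driven by `z = (u, v)`. -/
def rateStep (q : ℝ × ℝ) (x : State) (z : ℝ × ℝ) : State :=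
  (max (x.1 - z.1 * q.2 + z.2 * q.1) 0,
    if 0 < x.1 - z.1 * q.2 + z.2 * q.1 then x.2 + z.1 * q.2 else 0)

theorem rateStep_fst_pos_iff {q : ℝ × ℝ} {x : State} {z : ℝ × ℝ} :
    0 < (rateStep q x z).1 ↔ 0 < x.1 - z.1 * q.2 + z.2 * q.1 := by
  simp [rateStep]

theorem rateStep_of_pos {q : ℝ × ℝ} {x : State} {z : ℝ × ℝ}
    (h : 0 < x.1 - z.1 * q.2 + z.2 * q.1) :
    rateStep q x z = (x.1 - z.1 * q.2 + z.2 * q.1, x.2 + z.1 * q.2) := by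
  simp [rateStep, h, h.le]

theorem rateStep_of_nonpos {q : ℝ × ℝ} {x : State} {z : ℝ × ℝ}
    (h : x.1 - z.1 * q.2 + z.2 * q.1 ≤ 0) : rateStep q x z = (0, 0) := by
  simp [rateStep, h, not_lt.2 h]

theorem measurable_rateStep :
    Measurable (fun p : ((ℝ × ℝ) × State) × (ℝ × ℝ) => rateStep p.1.1 p.1.2 p.2) := by
  unfold rateStep
  refine Measurable.prodMk (by fun_prop) (Measurable.ite ?_ (by fun_prop) (by fun_prop))
  exact measurableSet_lt (by fun_prop) (by fun_prop)

/-- The `ℓ¹` distance in the plane. -/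
def dist1 (x y : ℝ × ℝ) : ℝ := |x.1 - y.1| + |x.2 - y.2|

theorem dist1_nonneg (x y : ℝ × ℝ) : 0 ≤ dist1 x y := by unfold dist1; positivity

theorem dist1_comm (x y : ℝ × ℝ) : dist1 x y = dist1 y x := by
  unfold dist1; rw [abs_sub_comm x.1, abs_sub_comm x.2]

@[simp] theorem dist1_self (x : ℝ × ℝ) : dist1 x x = 0 := by simp [dist1]

/-- Constants controlling the chain uniformly over a rectangle `[αm, α0] × [β0, β1]` of mean
service and inter-arrival times: exponents `θ`, `σ` of the Lyapunov function, its contraction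
factor `ρ`, two moments `D`, `E`, and a bound `b` on the density of the service times. -/
structure Envelope where
  αm : ℝ
  α0 : ℝ
  β0 : ℝ
  β1 : ℝ
  θ : ℝ
  σ : ℝ
  ρ : ℝ
  D : ℝ
  E : ℝ
  b : ℝ≥0

namespace Envelope

variable (e : Envelope)

/-- The rectangle of admissible mean service and inter-arrival times. -/
def rect : Set (ℝ × ℝ) := Set.Icc e.αm e.α0 ×ˢ Set.Icc e.β0 e.β1

/-- The Lyapunov function. -/
def lyap (k : ℕ) (x : State) : ℝ := Real.exp (k * (e.θ * x.1 + e.σ * x.2))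

/-- Upper bound for the increment of `θ w + σ y` in one step. -/
def incr (z : ℝ × ℝ) : ℝ := e.θ * e.α0 * z.2 - (e.θ * e.β0 - e.σ * e.β1) * z.1

/-- Exponential rate in the inter-arrival time on the event that a service time is small. -/
def rate : ℝ := e.θ * e.α0 * (e.β1 / e.αm) + e.σ * e.β1

/-- Uniform stability of the chain with driving laws `νU`, `νV`. -/
structure Bounds (νU νV : Measure ℝ) : Prop where
  αm_pos : 0 < e.αm
  αm_le : e.αm ≤ e.α0
  β0_pos : 0 < e.β0
  β0_le : e.β0 ≤ e.β1
  θ_pos : 0 < e.θ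
  σ_pos : 0 < e.σ
  ρ_nonneg : 0 ≤ e.ρ
  ρ_lt_one : e.ρ < 1
  D_nonneg : 0 ≤ e.D
  E_nonneg : 0 ≤ e.E
  nonneg_U : ∀ᵐ u ∂νU, 0 ≤ u
  nonneg_V : ∀ᵐ v ∂νV, 0 ≤ v
  drift : ∀ k : ℕ, 1 ≤ k → k ≤ 4 →
    ∫⁻ z, ENNReal.ofReal (Real.exp (k * e.incr z)) ∂(νU.prod νV) ≤ ENNReal.ofReal e.ρ
  drift_mul : ∫⁻ z, ENNReal.ofReal ((z.1 + z.2) * Real.exp (2 * e.incr z)) ∂(νU.prod νV)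
    ≤ ENNReal.ofReal e.D
  window : ∫⁻ u, ENNReal.ofReal ((1 + u) * Real.exp (e.rate * u)) ∂νU ≤ ENNReal.ofReal e.E
  density : νV ≤ e.b • (volume : Measure ℝ)

theorem lyap_pos (k : ℕ) (x : State) : 0 < e.lyap k x := Real.exp_pos _

@[simp] theorem lyap_zero (k : ℕ) : e.lyap k (0, 0) = 1 := by simp [lyap]

theorem measurable_lyap (k : ℕ) : Measurable (e.lyap k) := by unfold lyap; fun_prop

theorem measurable_incr : Measurable e.incr := by unfold incr; fun_prop

end Envelope

/-- Nonnegative states. -/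
def quadrant : Set State := {x | 0 ≤ x.1 ∧ 0 ≤ x.2}

theorem zero_mem_quadrant : ((0, 0) : State) ∈ quadrant := ⟨le_rfl, le_rfl⟩

section Chain

variable {νU νV : Measure ℝ} {e : Envelope}

namespace Envelope.Bounds

theorem one_le_lyap (h : e.Bounds νU νV) (k : ℕ) {x : State} (hx : x ∈ quadrant) :
    1 ≤ e.lyap k x := by
  have := h.θ_pos; have := h.σ_pos; obtain ⟨h1, h2⟩ := hx
  exact Real.one_le_exp (by positivity)

theorem lyap_mono_index (h : e.Bounds νU νV) {j k : ℕ} (hjk : j ≤ k) {x : State}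
    (hx : x ∈ quadrant) : e.lyap j x ≤ e.lyap k x := by
  have := h.θ_pos; have := h.σ_pos; obtain ⟨h1, h2⟩ := hx
  refine Real.exp_le_exp.2 (mul_le_mul_of_nonneg_right (by exact_mod_cast hjk) (by positivity))

/-- Stated for coordinatewise bounds instead of a step of the chain, so that it also applies to the
supremum of two coupled states. -/
theorem lyap_mul_le (h : e.Bounds νU νV) (k : ℕ) {x y : State} {z : ℝ × ℝ}
    (h1 : y.1 ≤ x.1 - z.1 * e.β0 + z.2 * e.α0) (h2 : y.2 ≤ x.2 + z.1 * e.β1) :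
    e.lyap k y ≤ e.lyap k x * Real.exp (k * e.incr z) := by
  rw [Envelope.lyap, Envelope.lyap, ← Real.exp_add, ← mul_add]
  refine Real.exp_le_exp.2 (mul_le_mul_of_nonneg_left ?_ (by positivity))
  have a1 := mul_le_mul_of_nonneg_left h1 h.θ_pos.le
  have a2 := mul_le_mul_of_nonneg_left h2 h.σ_pos.le
  unfold Envelope.incr
  nlinarith

theorem step_bounds {q : ℝ × ℝ} (hq : q ∈ e.rect) {x : State} {z : ℝ × ℝ}
    (hz1 : 0 ≤ z.1) (hz2 : 0 ≤ z.2) :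
    x.1 - z.1 * q.2 + z.2 * q.1 ≤ x.1 - z.1 * e.β0 + z.2 * e.α0 ∧
      x.2 + z.1 * q.2 ≤ x.2 + z.1 * e.β1 := by
  obtain ⟨⟨a1, a2⟩, b1, b2⟩ := hq
  have := mul_le_mul_of_nonneg_left a2 hz2
  have := mul_le_mul_of_nonneg_left b1 hz1
  have := mul_le_mul_of_nonneg_left b2 hz1
  constructor <;> linarith

theorem lyap_step_le (h : e.Bounds νU νV) (k : ℕ) {q : ℝ × ℝ} (hq : q ∈ e.rect) {x : State}
    {z : ℝ × ℝ} (hz1 : 0 ≤ z.1) (hz2 : 0 ≤ z.2) (hpos : 0 < x.1 - z.1 * q.2 + z.2 * q.1) :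
    e.lyap k (rateStep q x z) ≤ e.lyap k x * Real.exp (k * e.incr z) := by
  rw [rateStep_of_pos hpos]
  obtain ⟨a, b⟩ := step_bounds hq (x := x) hz1 hz2
  exact h.lyap_mul_le k a b

theorem rateStep_mem_quadrant (h : e.Bounds νU νV) {q : ℝ × ℝ} (hq : q ∈ e.rect) {x : State}
    (hx : x ∈ quadrant) {z : ℝ × ℝ} (hz1 : 0 ≤ z.1) : rateStep q x z ∈ quadrant := by
  have hq2 : 0 ≤ q.2 := h.β0_pos.le.trans hq.2.1
  obtain ⟨h1, h2⟩ := hx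
  refine ⟨le_max_right _ _, ?_⟩
  simp only [rateStep]
  split_ifs <;> positivity

theorem ae_nonneg [SFinite νU] [SFinite νV] (h : e.Bounds νU νV) :
    ∀ᵐ z ∂(νU.prod νV), 0 ≤ z.1 ∧ 0 ≤ z.2 :=
  (Measure.quasiMeasurePreserving_fst.ae h.nonneg_U).and
    (Measure.quasiMeasurePreserving_snd.ae h.nonneg_V)

end Envelope.Bounds

/-! ### Occupation functionals of an excursion -/

/-- Expected accumulated cost `φ` over the first `n` steps of an excursion away from the empty
state. -/
def occ (ν : Measure (ℝ × ℝ)) (φ : State → ℝ) : ℕ → ℝ × ℝ → State → ℝ≥0∞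
  | 0, _, _ => 0
  | n + 1, q, x => ENNReal.ofReal (φ x) +
      ∫⁻ z, (if 0 < (rateStep q x z).1 then occ ν φ n q (rateStep q x z) else 0) ∂ν

/-- Cost functions of linear growth: Lipschitz and dominated by the Lyapunov function. -/
structure IsCost (e : Envelope) (φ : State → ℝ) (K : ℝ) : Prop where
  measurable : Measurable φ
  nonneg : ∀ x ∈ quadrant, 0 ≤ φ x
  le : ∀ x ∈ quadrant, φ x ≤ K * e.lyap 1 x
  lip : ∀ x ∈ quadrant, ∀ y ∈ quadrant, φ x ≤ φ y + dist1 x y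

theorem measurable_occ_integrand {F : ℝ × ℝ → State → ℝ≥0∞}
    (hF : Measurable fun p : (ℝ × ℝ) × State => F p.1 p.2) :
    Measurable (fun p : ((ℝ × ℝ) × State) × (ℝ × ℝ) =>
      if 0 < (rateStep p.1.1 p.1.2 p.2).1 then F p.1.1 (rateStep p.1.1 p.1.2 p.2) else 0) := by
  refine Measurable.ite ?_ ?_ measurable_const
  · exact measurableSet_lt measurable_const measurable_rateStep.fst
  · exact hF.comp ((measurable_fst.fst).prodMk measurable_rateStep)

theorem measurable_occ (ν : Measure (ℝ × ℝ)) [SFinite ν] {φ : State → ℝ} (hφ : Measurable φ)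
    (n : ℕ) : Measurable (fun p : (ℝ × ℝ) × State => occ ν φ n p.1 p.2) := by
  induction n with
  | zero => exact measurable_const
  | succ n ih =>
    exact (hφ.comp measurable_snd).ennreal_ofReal.add
      (measurable_occ_integrand ih).lintegral_prod_right'

theorem occ_mono (ν : Measure (ℝ × ℝ)) (φ : State → ℝ) (q : ℝ × ℝ) (x : State) :
    Monotone fun n => occ ν φ n q x := by
  refine monotone_nat_of_le_succ fun n => ?_
  induction n generalizing x with
  | zero => exact zero_le
  | succ n ih =>
    simp only [occ]
    gcongr with z
    split_ifs
    · exact ih _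
    · exact le_rfl

/-- A geometric series: on steps that do not empty the queue the Lyapunov function shrinks by ρ in
mean, and K/(1 - ρ) is the fixed point of c ↦ K + ρc. The bound does not depend on n. -/
theorem occ_le (h : e.Bounds νU νV) [SFinite νU] [SFinite νV] {φ : State → ℝ} {K : ℝ}
    (hK : 0 ≤ K) (hφ : IsCost e φ K) {q : ℝ × ℝ} (hq : q ∈ e.rect) (n : ℕ) {x : State}
    (hx : x ∈ quadrant) :
    occ (νU.prod νV) φ n q x ≤ ENNReal.ofReal (K / (1 - e.ρ) * e.lyap 1 x) := by
  have hρ : 0 < 1 - e.ρ := by linarith [h.ρ_lt_one]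
  induction n generalizing x with
  | zero => exact zero_le
  | succ n ih =>
    have hL := e.lyap_pos 1 x
    have hC : 0 ≤ K / (1 - e.ρ) := by positivity
    calc occ (νU.prod νV) φ (n + 1) q x
        ≤ ENNReal.ofReal (K * e.lyap 1 x) + ∫⁻ z, ENNReal.ofReal (K / (1 - e.ρ) * e.lyap 1 x) *
            ENNReal.ofReal (Real.exp ((1 : ℕ) * e.incr z)) ∂(νU.prod νV) := by
          refine add_le_add (ENNReal.ofReal_le_ofReal (hφ.le x hx)) (lintegral_mono_ae ?_)
          filter_upwards [h.ae_nonneg] with z hz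
          split_ifs with hp
          · refine (ih (h.rateStep_mem_quadrant hq hx hz.1)).trans ?_
            rw [← ENNReal.ofReal_mul (by positivity), mul_assoc]
            exact ENNReal.ofReal_le_ofReal (mul_le_mul_of_nonneg_left
              (h.lyap_step_le 1 hq hz.1 hz.2 (rateStep_fst_pos_iff.1 hp)) hC)
          · exact zero_le
      _ ≤ ENNReal.ofReal (K * e.lyap 1 x) +
            ENNReal.ofReal (K / (1 - e.ρ) * e.lyap 1 x) * ENNReal.ofReal e.ρ := by
          rw [lintegral_const_mul' _ _ ENNReal.ofReal_ne_top]
          gcongr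
          exact h.drift 1 le_rfl (by norm_num)
      _ = ENNReal.ofReal (K / (1 - e.ρ) * e.lyap 1 x) := by
          rw [← ENNReal.ofReal_mul (by positivity),
            ← ENNReal.ofReal_add (by positivity) (mul_nonneg (by positivity) h.ρ_nonneg)]
          congr 1
          field_simp
          ring


/-! ### Lipschitz dependence of the occupation functionals on state and parameters -/

namespace Envelope

/-- Lipschitz constant of the endpoint at which the chain empties. -/
def emptyConst (e : Envelope) : ℝ :=
  (1 / e.αm + e.β1 / e.αm ^ 2 + 1 / e.αm ^ 2) * (1 + 1 / e.θ) * e.E * e.b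

/-- Lipschitz constant of the occupation functionals in the state. -/
def lipConst (e : Envelope) (K : ℝ) : ℝ := (1 + K / (1 - e.ρ) * e.emptyConst) / (1 - e.ρ)

/-- Relative weight of the parameter in the Lipschitz bound of the occupation functionals. -/
def paramConst (e : Envelope) : ℝ := (2 * e.D + 1) / (1 - e.ρ)

theorem Bounds.emptyConst_nonneg (h : e.Bounds νU νV) : 0 ≤ e.emptyConst := by
  have := h.αm_pos; have := h.β0_pos.trans_le h.β0_le; have := h.θ_pos; have := h.E_nonneg
  unfold emptyConst; positivity

theorem Bounds.lipConst_pos (h : e.Bounds νU νV) {K : ℝ} (hK : 0 ≤ K) : 0 < e.lipConst K := by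
  have := h.emptyConst_nonneg
  have hρ : 0 < 1 - e.ρ := by linarith [h.ρ_lt_one]
  unfold lipConst; positivity

theorem Bounds.paramConst_pos (h : e.Bounds νU νV) : 0 < e.paramConst := by
  have := h.D_nonneg
  have hρ : 0 < 1 - e.ρ := by linarith [h.ρ_lt_one]
  unfold paramConst; positivity

/-- The linear factor comes from the length of the window of mismatching service times. It is
absorbed by raising the Lyapunov index from 1 to 2. -/
theorem Bounds.one_add_mul_lyap_le (h : e.Bounds νU νV) {x : State} (hx : x ∈ quadrant) :
    (1 + x.1) * e.lyap 1 x ≤ (1 + 1 / e.θ) * e.lyap 2 x := by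
  have hθ := h.θ_pos
  have hσ := h.σ_pos
  obtain ⟨h1, h2⟩ := hx
  have e2 : e.lyap 2 x = e.lyap 1 x * e.lyap 1 x := by
    rw [lyap, lyap, ← Real.exp_add]; push_cast; ring_nf
  have key : 1 + x.1 ≤ (1 + 1 / e.θ) * e.lyap 1 x := by
    have a1 := Real.add_one_le_exp (((1 : ℕ) : ℝ) * (e.θ * x.1 + e.σ * x.2))
    have a2 : (1 + 1 / e.θ) * (1 + e.θ * x.1) ≤ (1 + 1 / e.θ) * e.lyap 1 x := by
      refine mul_le_mul_of_nonneg_left (le_trans ?_ a1) (by positivity)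
      push_cast
      nlinarith [mul_nonneg hσ.le h2]
    refine le_trans ?_ a2
    have : (1 + 1 / e.θ) * (1 + e.θ * x.1) = 1 + x.1 + (1 / e.θ + e.θ * x.1) := by
      field_simp; ring
    rw [this]
    have : 0 ≤ 1 / e.θ + e.θ * x.1 := by positivity
    linarith
  rw [e2, ← mul_assoc]
  exact mul_le_mul_of_nonneg_right key (e.lyap_pos _ _).le

end Envelope

/-- For a fixed inter-arrival input u, the chain from x stays positive exactly for service inputs
above (u β - w)/α, and the chain from x' empties exactly for inputs up to (u β' - w')/α'. The
difference of these endpoints is the length of the window in which only the second chain empties. -/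
theorem window_length_le (h : e.Bounds νU νV) {q q' : ℝ × ℝ} (hq : q ∈ e.rect)
    (hq' : q' ∈ e.rect) {x x' : State} (hx : x ∈ quadrant) {u : ℝ} (hu : 0 ≤ u) :
    (u * q'.2 - x'.1) / q'.1 - (u * q.2 - x.1) / q.1 ≤
      (1 / e.αm + e.β1 / e.αm ^ 2 + 1 / e.αm ^ 2) * (dist1 x x' + dist1 q q') *
        ((1 + u) * (1 + (x ⊔ x').1)) := by
  have ha := h.αm_pos
  obtain ⟨⟨a1, a2⟩, b1, b2⟩ := hq
  obtain ⟨⟨a1', a2'⟩, b1', b2'⟩ := hq'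
  have hb := h.β0_pos
  have hb1 : 0 < e.β1 := hb.trans_le h.β0_le
  have p1 : 0 < q.1 := ha.trans_le a1
  have p1' : 0 < q'.1 := ha.trans_le a1'
  set δ := dist1 q q' with hδ
  set d := dist1 x x' with hd
  have hδ0 : 0 ≤ δ := dist1_nonneg _ _
  have hd0 : 0 ≤ d := dist1_nonneg _ _
  have hα : |q.1 - q'.1| ≤ δ := by
    rw [hδ, dist1]; linarith [abs_nonneg (q.2 - q'.2)]
  have hβ : |q.2 - q'.2| ≤ δ := by
    rw [hδ, dist1]; linarith [abs_nonneg (q.1 - q'.1)]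
  have hw : |x.1 - x'.1| ≤ d := by
    rw [hd, dist1]; linarith [abs_nonneg (x.2 - x'.2)]
  have hm : x.1 ≤ (x ⊔ x').1 := le_max_left _ _
  have hm0 : 0 ≤ (x ⊔ x').1 := hx.1.trans hm
  set W := (x ⊔ x').1
  have i1 : 1 / q'.1 ≤ 1 / e.αm := one_div_le_one_div_of_le ha a1'
  have i2 : 1 / (q.1 * q'.1) ≤ 1 / e.αm ^ 2 := by
    apply one_div_le_one_div_of_le (by positivity)
    nlinarith
  have id : (u * q'.2 - x'.1) / q'.1 - (u * q.2 - x.1) / q.1 =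
      u * ((q'.2 - q.2) * (1 / q'.1) + q.2 * (q.1 - q'.1) * (1 / (q.1 * q'.1))) +
        ((x.1 - x'.1) * (1 / q'.1) + x.1 * (q'.1 - q.1) * (1 / (q.1 * q'.1))) := by
    field_simp; ring
  have j1 : (q'.2 - q.2) * (1 / q'.1) ≤ δ * (1 / e.αm) := by
    refine mul_le_mul ?_ i1 (by positivity) hδ0
    linarith [(abs_le.1 hβ).1]
  have j2 : q.2 * (q.1 - q'.1) * (1 / (q.1 * q'.1)) ≤ e.β1 * δ * (1 / e.αm ^ 2) := by
    refine mul_le_mul ?_ i2 (by positivity) (by positivity)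
    have := (abs_le.1 hα).2
    nlinarith
  have j3 : (x.1 - x'.1) * (1 / q'.1) ≤ d * (1 / e.αm) := by
    refine mul_le_mul ?_ i1 (by positivity) hd0
    linarith [(abs_le.1 hw).2]
  have j4 : x.1 * (q'.1 - q.1) * (1 / (q.1 * q'.1)) ≤ W * δ * (1 / e.αm ^ 2) := by
    refine mul_le_mul ?_ i2 (by positivity) (by positivity)
    have := (abs_le.1 hα).1
    have := hx.1
    nlinarith
  rw [id]
  have k1 : u * ((q'.2 - q.2) * (1 / q'.1) + q.2 * (q.1 - q'.1) * (1 / (q.1 * q'.1))) ≤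
      u * (δ * (1 / e.αm) + e.β1 * δ * (1 / e.αm ^ 2)) :=
    mul_le_mul_of_nonneg_left (add_le_add j1 j2) hu
  refine (add_le_add k1 (add_le_add j3 j4)).trans ?_
  have hA : 0 ≤ 1 / e.αm := by positivity
  have hB : 0 ≤ e.β1 / e.αm ^ 2 := by positivity
  have hC : 0 ≤ 1 / e.αm ^ 2 := by positivity
  have eB : e.β1 * δ * (1 / e.αm ^ 2) = e.β1 / e.αm ^ 2 * δ := by ring
  rw [eB]
  generalize 1 / e.αm = A at *
  generalize e.β1 / e.αm ^ 2 = B at *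
  generalize 1 / e.αm ^ 2 = C at *
  have : (A + B + C) * (d + δ) * ((1 + u) * (1 + W)) -
      (u * (δ * A + B * δ) + (d * A + W * δ * C)) =
      A * d * (u + W + u * W) + A * δ * (1 + W + u * W) + B * d * ((1 + u) * (1 + W)) +
      B * δ * (1 + W + u * W) + C * d * ((1 + u) * (1 + W)) + C * δ * (1 + u + u * W) := by ring
  have : 0 ≤ A * d * (u + W + u * W) + A * δ * (1 + W + u * W) + B * d * ((1 + u) * (1 + W)) +
      B * δ * (1 + W + u * W) + C * d * ((1 + u) * (1 + W)) + C * δ * (1 + u + u * W) := by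
    positivity
  linarith

/-- The event that one of two coupled chains empties while the other does not has a probability
proportional to their distance. -/
theorem lintegral_mismatch_le (h : e.Bounds νU νV) [SFinite νU] [SFinite νV] {K : ℝ} (hK : 0 ≤ K)
    {q q' : ℝ × ℝ} (hq : q ∈ e.rect) (hq' : q' ∈ e.rect) {x x' : State} (hx : x ∈ quadrant)
    (hx' : x' ∈ quadrant) :
    ∫⁻ z, (if 0 < x.1 - z.1 * q.2 + z.2 * q.1 ∧ x'.1 - z.1 * q'.2 + z.2 * q'.1 ≤ 0 then
        ENNReal.ofReal (K * e.lyap 1 (rateStep q x z)) else 0) ∂(νU.prod νV) ≤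
      ENNReal.ofReal (K * e.emptyConst * (dist1 x x' + dist1 q q') * e.lyap 2 (x ⊔ x')) := by
  have ha := h.αm_pos
  have hb1 : 0 < e.β1 := h.β0_pos.trans_le h.β0_le
  have hθ := h.θ_pos
  have hσ := h.σ_pos
  have p1 : 0 < q.1 := ha.trans_le hq.1.1
  have p1' : 0 < q'.1 := ha.trans_le hq'.1.1
  have hsup : x ⊔ x' ∈ quadrant := ⟨hx.1.trans (le_max_left _ _), hx.2.trans (le_max_left _ _)⟩
  set X := x ⊔ x' with hX
  set lo : ℝ → ℝ := fun u => (u * q.2 - x.1) / q.1 with hlo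
  set hi : ℝ → ℝ := fun u => (u * q'.2 - x'.1) / q'.1 with hhi
  set c1 := 1 / e.αm + e.β1 / e.αm ^ 2 + 1 / e.αm ^ 2 with hc1
  have hc1' : 0 ≤ c1 := by positivity
  have hd0 := dist1_nonneg x x'
  have hδ0 := dist1_nonneg q q'
  set G : ℝ × ℝ → ℝ≥0∞ := fun z => ENNReal.ofReal (K * e.lyap 1 X * Real.exp (e.rate * z.1)) *
    {z : ℝ × ℝ | z.2 ∈ Set.Ioc (lo z.1) (hi z.1)}.indicator 1 z with hG
  have hmeas : MeasurableSet {z : ℝ × ℝ | z.2 ∈ Set.Ioc (lo z.1) (hi z.1)} :=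
    (measurableSet_lt (by fun_prop : Measurable fun z : ℝ × ℝ => (z.1 * q.2 - x.1) / q.1)
      measurable_snd).inter
      (measurableSet_le measurable_snd
        (by fun_prop : Measurable fun z : ℝ × ℝ => (z.1 * q'.2 - x'.1) / q'.1))
  have hGm : Measurable G :=
    (by fun_prop : Measurable fun z : ℝ × ℝ =>
      ENNReal.ofReal (K * e.lyap 1 X * Real.exp (e.rate * z.1))).mul
      (measurable_one.indicator hmeas)
  have hGE : ∀ᵐ z ∂(νU.prod νV),
      (if 0 < x.1 - z.1 * q.2 + z.2 * q.1 ∧ x'.1 - z.1 * q'.2 + z.2 * q'.1 ≤ 0 then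
        ENNReal.ofReal (K * e.lyap 1 (rateStep q x z)) else 0) ≤ G z := by
    filter_upwards [h.ae_nonneg] with z hz
    split_ifs with hc
    · obtain ⟨hp, hn⟩ := hc
      have hv1 : lo z.1 < z.2 := by
        rw [hlo]; simp only; rw [div_lt_iff₀ p1]; linarith
      have hv2 : z.2 ≤ hi z.1 := by
        rw [hhi]; simp only; rw [le_div_iff₀ p1']; linarith
      have hmem : z ∈ {z : ℝ × ℝ | z.2 ∈ Set.Ioc (lo z.1) (hi z.1)} := ⟨hv1, hv2⟩
      simp only [hG, Set.indicator_of_mem hmem, Pi.one_apply, mul_one]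
      refine ENNReal.ofReal_le_ofReal ?_
      rw [mul_assoc]
      refine mul_le_mul_of_nonneg_left ?_ hK
      -- Emptying of the second chain caps the service input by a multiple of the inter-arrival
      -- input. The Lyapunov function after the step is then controlled by u alone, which is the
      -- origin of `rate`.
      have hv3 : z.2 ≤ z.1 * e.β1 / e.αm := by
        refine hv2.trans ?_
        simp only [hhi]
        refine div_le_div₀ (mul_nonneg hz.1 hb1.le) ?_ ha hq'.1.1
        have := mul_le_mul_of_nonneg_left hq'.2.2 hz.1
        linarith [hx'.1]
      rw [rateStep_of_pos hp, Envelope.lyap, Envelope.lyap, ← Real.exp_add]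
      refine Real.exp_le_exp.2 ?_
      have s1 : x.1 - z.1 * q.2 + z.2 * q.1 ≤ X.1 + z.1 * e.β1 / e.αm * e.α0 := by
        have t1 : x.1 ≤ X.1 := le_max_left _ _
        have t2 : 0 ≤ z.1 * q.2 := mul_nonneg hz.1 (h.β0_pos.le.trans hq.2.1)
        have t3 : z.2 * q.1 ≤ z.1 * e.β1 / e.αm * e.α0 :=
          mul_le_mul hv3 hq.1.2 p1.le (hz.2.trans hv3)
        linarith
      have s2 : x.2 + z.1 * q.2 ≤ X.2 + z.1 * e.β1 :=
        add_le_add (le_max_left _ _) (mul_le_mul_of_nonneg_left hq.2.2 hz.1)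
      have r1 := mul_le_mul_of_nonneg_left s1 hθ.le
      have r2 := mul_le_mul_of_nonneg_left s2 hσ.le
      have : e.rate * z.1 = e.θ * (z.1 * e.β1 / e.αm * e.α0) + e.σ * (z.1 * e.β1) := by
        unfold Envelope.rate; ring
      rw [this]
      push_cast
      linarith
    · exact zero_le
  have hb : ∀ u, 0 ≤ u → ∫⁻ v, G (u, v) ∂νV ≤
      ENNReal.ofReal (K * e.lyap 1 X * (e.b * (c1 * (dist1 x x' + dist1 q q') * (1 + X.1)))) *
        ENNReal.ofReal ((1 + u) * Real.exp (e.rate * u)) := by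
    intro u hu
    have hind : ∀ v, {z : ℝ × ℝ | z.2 ∈ Set.Ioc (lo z.1) (hi z.1)}.indicator
        (1 : ℝ × ℝ → ℝ≥0∞) (u, v) = (Set.Ioc (lo u) (hi u)).indicator 1 v := fun v => rfl
    simp only [hG, hind]
    rw [lintegral_const_mul' _ _ ENNReal.ofReal_ne_top, lintegral_indicator_one measurableSet_Ioc]
    -- The only place where the bounded density enters: probability of the window ≤ b × length.
    have hV : νV (Set.Ioc (lo u) (hi u)) ≤ ENNReal.ofReal (e.b * (hi u - lo u)) := by
      refine (h.density _).trans ?_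
      rw [Measure.smul_apply, Real.volume_Ioc, ENNReal.ofReal_mul (by positivity),
        ENNReal.ofReal_coe_nnreal]
      rfl
    have hlen := window_length_le (x' := x') h hq hq' hx hu
    refine (mul_le_mul_right (hV.trans (ENNReal.ofReal_le_ofReal
      (mul_le_mul_of_nonneg_left hlen (by positivity)))) _).trans ?_
    have hp1 := e.lyap_pos 1 X
    rw [← ENNReal.ofReal_mul (by positivity), ← ENNReal.ofReal_mul]
    · refine ENNReal.ofReal_le_ofReal (le_of_eq ?_)
      rw [← hX, ← hc1]
      ring
    · have := hsup.1
      positivity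
  calc _ ≤ ∫⁻ z, G z ∂(νU.prod νV) := lintegral_mono_ae hGE
    _ = ∫⁻ u, ∫⁻ v, G (u, v) ∂νV ∂νU := lintegral_prod _ hGm.aemeasurable
    _ ≤ ∫⁻ u, ENNReal.ofReal
          (K * e.lyap 1 X * (e.b * (c1 * (dist1 x x' + dist1 q q') * (1 + X.1)))) *
        ENNReal.ofReal ((1 + u) * Real.exp (e.rate * u)) ∂νU := by
        refine lintegral_mono_ae ?_
        filter_upwards [h.nonneg_U] with u hu using hb u hu
    _ ≤ ENNReal.ofReal
          (K * e.lyap 1 X * (e.b * (c1 * (dist1 x x' + dist1 q q') * (1 + X.1)))) *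
        ENNReal.ofReal e.E := by
        rw [lintegral_const_mul' _ _ ENNReal.ofReal_ne_top]
        exact mul_le_mul_right h.window _
    _ ≤ _ := by
        have hp1 := e.lyap_pos 1 X
        have := hsup.1
        have hE := h.E_nonneg
        rw [← ENNReal.ofReal_mul (by positivity)]
        refine ENNReal.ofReal_le_ofReal ?_
        have key := mul_le_mul_of_nonneg_left (h.one_add_mul_lyap_le hsup)
          (by positivity : 0 ≤ K * e.b * c1 * (dist1 x x' + dist1 q q') * e.E)
        unfold Envelope.emptyConst
        rw [← hc1]
        linarith


/-- While both chains stay positive the step is a translation of the state, so the state distance is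
not amplified; only the parameter difference is added, with weight at most 2(u + v). -/
theorem dist1_rateStep_le {q q' : ℝ × ℝ} {x x' : State} {z : ℝ × ℝ} (hz1 : 0 ≤ z.1)
    (hz2 : 0 ≤ z.2) (hp : 0 < x.1 - z.1 * q.2 + z.2 * q.1)
    (hp' : 0 < x'.1 - z.1 * q'.2 + z.2 * q'.1) :
    dist1 (rateStep q x z) (rateStep q' x' z) ≤
      dist1 x x' + 2 * (z.1 + z.2) * dist1 q q' := by
  rw [rateStep_of_pos hp, rateStep_of_pos hp']
  simp only [dist1]
  have e1 : x.1 - z.1 * q.2 + z.2 * q.1 - (x'.1 - z.1 * q'.2 + z.2 * q'.1) =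
    (x.1 - x'.1) + (z.1 * (q'.2 - q.2) + z.2 * (q.1 - q'.1)) := by ring
  have e2 : x.2 + z.1 * q.2 - (x'.2 + z.1 * q'.2) = (x.2 - x'.2) + z.1 * (q.2 - q'.2) := by ring
  rw [e1, e2]
  have b1 : |z.1 * (q'.2 - q.2)| = z.1 * |q.2 - q'.2| := by
    rw [abs_mul, abs_of_nonneg hz1, abs_sub_comm]
  have b2 : |z.2 * (q.1 - q'.1)| = z.2 * |q.1 - q'.1| := by rw [abs_mul, abs_of_nonneg hz2]
  have b3 : |z.1 * (q.2 - q'.2)| = z.1 * |q.2 - q'.2| := by rw [abs_mul, abs_of_nonneg hz1]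
  have c1 := abs_add_le (x.1 - x'.1) (z.1 * (q'.2 - q.2) + z.2 * (q.1 - q'.1))
  have c2 := abs_add_le (z.1 * (q'.2 - q.2)) (z.2 * (q.1 - q'.1))
  have c3 := abs_add_le (x.2 - x'.2) (z.1 * (q.2 - q'.2))
  have d1 := mul_nonneg hz1 (abs_nonneg (q.1 - q'.1))
  have d2 := mul_nonneg hz2 (abs_nonneg (q.1 - q'.1))
  have d3 := mul_nonneg hz2 (abs_nonneg (q.2 - q'.2))
  nlinarith

/-- Synchronous coupling and induction on n with constants independent of n. If both chains survive,
the induction hypothesis applies and the weight `lyap 2` contracts by ρ. If only the first survives,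
`occ_le` bounds what remains and `lintegral_mismatch_le` supplies the factor proportional to the
distance. One-sided, hence two-sided by symmetry. -/
theorem occ_lipschitz (h : e.Bounds νU νV) [SFinite νU] [SFinite νV] {φ : State → ℝ} {K : ℝ}
    (hK : 0 ≤ K) (hφ : IsCost e φ K) {q q' : ℝ × ℝ} (hq : q ∈ e.rect) (hq' : q' ∈ e.rect) (n : ℕ)
    {x x' : State} (hx : x ∈ quadrant) (hx' : x' ∈ quadrant) :
    occ (νU.prod νV) φ n q x ≤ occ (νU.prod νV) φ n q' x' + ENNReal.ofReal
      (e.lipConst K * (dist1 x x' + e.paramConst * dist1 q q') * e.lyap 2 (x ⊔ x')) := by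
  have hρ : 0 < 1 - e.ρ := by linarith [h.ρ_lt_one]
  have hL := h.lipConst_pos hK
  have hM := h.paramConst_pos
  have hD := h.D_nonneg
  have hEc := h.emptyConst_nonneg
  have hδ := dist1_nonneg q q'
  induction n generalizing x x' with
  | zero => exact zero_le
  | succ n ih =>
    have hd := dist1_nonneg x x'
    have hsup : x ⊔ x' ∈ quadrant := ⟨hx.1.trans (le_max_left _ _), hx.2.trans (le_max_left _ _)⟩
    have hV := e.lyap_pos 2 (x ⊔ x')
    have hV1 := h.one_le_lyap 2 hsup
    set X := x ⊔ x' with hX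
    set L := e.lipConst K with hLdef
    set Mc := e.paramConst with hMdef
    set ν := νU.prod νV with hν
    set d := dist1 x x' with hddef
    set δ := dist1 q q' with hδdef
    set K1 := K / (1 - e.ρ) with hK1
    have hK1' : 0 ≤ K1 := by positivity
    set f1 : ℝ × ℝ → ℝ≥0∞ := fun z =>
      if 0 < (rateStep q' x' z).1 then occ ν φ n q' (rateStep q' x' z) else 0 with hf1
    set f2 : ℝ × ℝ → ℝ≥0∞ := fun z =>
      ENNReal.ofReal (L * (d + Mc * δ) * e.lyap 2 X) *
        ENNReal.ofReal (Real.exp ((2 : ℕ) * e.incr z)) with hf2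
    set f3 : ℝ × ℝ → ℝ≥0∞ := fun z => ENNReal.ofReal (2 * L * δ * e.lyap 2 X) *
        ENNReal.ofReal ((z.1 + z.2) * Real.exp (2 * e.incr z)) with hf3
    set f4 : ℝ × ℝ → ℝ≥0∞ := fun z =>
      if 0 < x.1 - z.1 * q.2 + z.2 * q.1 ∧ x'.1 - z.1 * q'.2 + z.2 * q'.1 ≤ 0 then
        ENNReal.ofReal (K1 * e.lyap 1 (rateStep q x z)) else 0 with hf4
    have hinc := e.measurable_incr
    have hm1 : Measurable f1 := by
      have := measurable_occ_integrand (measurable_occ ν hφ.measurable n)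
      exact this.comp (measurable_const.prodMk measurable_id :
        Measurable fun z : ℝ × ℝ => (((q', x') : (ℝ × ℝ) × State), z))
    have hm2 : Measurable f2 := by fun_prop
    have hm3 : Measurable f3 := by fun_prop
    have hpt : ∀ᵐ z ∂ν, (if 0 < (rateStep q x z).1 then occ ν φ n q (rateStep q x z) else 0) ≤
        f1 z + (f2 z + (f3 z + f4 z)) := by
      filter_upwards [h.ae_nonneg] with z hz
      split_ifs with hp
      · rw [rateStep_fst_pos_iff] at hp
        have hmem := h.rateStep_mem_quadrant hq hx hz.1 (z := z)
        by_cases hp' : 0 < x'.1 - z.1 * q'.2 + z.2 * q'.1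
        · have hmem' := h.rateStep_mem_quadrant hq' hx' hz.1 (z := z)
          refine (ih hmem hmem').trans ?_
          have h1 : f1 z = occ ν φ n q' (rateStep q' x' z) := by
            simp only [hf1]; rw [if_pos (rateStep_fst_pos_iff.2 hp')]
          rw [h1, ← add_assoc (f2 z)]
          refine add_le_add le_rfl (le_trans ?_ le_self_add)
          simp only [hf2, hf3]
          rw [← ENNReal.ofReal_mul (by positivity), ← ENNReal.ofReal_mul (by positivity),
            ← ENNReal.ofReal_add (by positivity)
              (by have := hz.1; have := hz.2; positivity)]
          refine ENNReal.ofReal_le_ofReal ?_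
          have hdist := dist1_rateStep_le hz.1 hz.2 hp hp'
          have hlyap : e.lyap 2 (rateStep q x z ⊔ rateStep q' x' z) ≤
              e.lyap 2 X * Real.exp ((2 : ℕ) * e.incr z) := by
            have l1 : x.1 ≤ X.1 := le_max_left _ _
            have l2 : x'.1 ≤ X.1 := le_max_right _ _
            have l3 : x.2 ≤ X.2 := le_max_left _ _
            have l4 : x'.2 ≤ X.2 := le_max_right _ _
            obtain ⟨a, b⟩ := Envelope.Bounds.step_bounds hq (x := x) hz.1 hz.2
            obtain ⟨a', b'⟩ := Envelope.Bounds.step_bounds hq' (x := x') hz.1 hz.2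
            rw [rateStep_of_pos hp, rateStep_of_pos hp']
            refine h.lyap_mul_le 2 (max_le ?_ ?_) (max_le ?_ ?_) <;> simp only <;> linarith
          have hz12 : 0 ≤ z.1 + z.2 := add_nonneg hz.1 hz.2
          calc L * (dist1 (rateStep q x z) (rateStep q' x' z) + Mc * δ) *
                e.lyap 2 (rateStep q x z ⊔ rateStep q' x' z)
              ≤ L * (d + 2 * (z.1 + z.2) * δ + Mc * δ) *
                (e.lyap 2 X * Real.exp ((2 : ℕ) * e.incr z)) := by
                have := (e.lyap_pos 2 (rateStep q x z ⊔ rateStep q' x' z)).le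
                gcongr
            _ = _ := by push_cast; ring
        · have h4 : f4 z = ENNReal.ofReal (K1 * e.lyap 1 (rateStep q x z)) := by
            simp only [hf4]; rw [if_pos ⟨hp, not_lt.1 hp'⟩]
          refine (occ_le h hK hφ hq n hmem).trans ?_
          rw [h4]
          exact le_add_left (le_add_left le_add_self)
      · exact zero_le
    have hint : ∫⁻ z, (if 0 < (rateStep q x z).1 then occ ν φ n q (rateStep q x z) else 0) ∂ν ≤
        ∫⁻ z, f1 z ∂ν + ENNReal.ofReal ((L * (d + Mc * δ) * e.ρ + 2 * L * δ * e.D +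
          K1 * e.emptyConst * (d + δ)) * e.lyap 2 X) := by
      refine (lintegral_mono_ae hpt).trans ?_
      rw [lintegral_add_left hm1, lintegral_add_left hm2, lintegral_add_left hm3]
      refine add_le_add le_rfl ?_
      have i2 : ∫⁻ z, f2 z ∂ν ≤ ENNReal.ofReal (L * (d + Mc * δ) * e.lyap 2 X * e.ρ) := by
        simp only [hf2]
        rw [lintegral_const_mul' _ _ ENNReal.ofReal_ne_top,
          ENNReal.ofReal_mul (p := L * (d + Mc * δ) * e.lyap 2 X) (by positivity)]
        exact mul_le_mul_right (h.drift 2 (by norm_num) (by norm_num)) _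
      have i3 : ∫⁻ z, f3 z ∂ν ≤ ENNReal.ofReal (2 * L * δ * e.lyap 2 X * e.D) := by
        simp only [hf3]
        rw [lintegral_const_mul' _ _ ENNReal.ofReal_ne_top,
          ENNReal.ofReal_mul (p := 2 * L * δ * e.lyap 2 X) (by positivity)]
        exact mul_le_mul_right h.drift_mul _
      have i4 := lintegral_mismatch_le h hK1' hq hq' hx hx'
      refine (add_le_add i2 (add_le_add i3 i4)).trans ?_
      have hρ0 := h.ρ_nonneg
      rw [← ENNReal.ofReal_add (by positivity) (by positivity),
        ← ENNReal.ofReal_add (by positivity) (by positivity)]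
      exact ENNReal.ofReal_le_ofReal (le_of_eq (by rw [← hX]; ring))
    have hφd : ENNReal.ofReal (φ x) ≤ ENNReal.ofReal (φ x') + ENNReal.ofReal d := by
      rw [← ENNReal.ofReal_add (hφ.nonneg x' hx') hd]
      exact ENNReal.ofReal_le_ofReal (hφ.lip x hx x' hx')
    calc occ ν φ (n + 1) q x
        = ENNReal.ofReal (φ x) + ∫⁻ z, (if 0 < (rateStep q x z).1 then
            occ ν φ n q (rateStep q x z) else 0) ∂ν := rfl
      _ ≤ (ENNReal.ofReal (φ x') + ENNReal.ofReal d) + (∫⁻ z, f1 z ∂ν +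
            ENNReal.ofReal ((L * (d + Mc * δ) * e.ρ + 2 * L * δ * e.D +
            K1 * e.emptyConst * (d + δ)) * e.lyap 2 X)) := add_le_add hφd hint
      _ = (ENNReal.ofReal (φ x') + ∫⁻ z, f1 z ∂ν) + (ENNReal.ofReal d +
            ENNReal.ofReal ((L * (d + Mc * δ) * e.ρ + 2 * L * δ * e.D +
            K1 * e.emptyConst * (d + δ)) * e.lyap 2 X)) := add_add_add_comm _ _ _ _
      _ ≤ occ ν φ (n + 1) q' x' + ENNReal.ofReal (L * (d + Mc * δ) * e.lyap 2 X) := by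
          refine add_le_add le_rfl ?_
          have hρ0 := h.ρ_nonneg
          rw [← ENNReal.ofReal_add hd (by positivity)]
          refine ENNReal.ofReal_le_ofReal ?_
          have hdV : d ≤ d * e.lyap 2 X := le_mul_of_one_le_right hd hV1
          have eL : L * (1 - e.ρ) = 1 + K1 * e.emptyConst := by
            rw [hLdef, Envelope.lipConst, ← hK1]; field_simp
          have eM : Mc * (1 - e.ρ) = 2 * e.D + 1 := by
            rw [hMdef, Envelope.paramConst]; field_simp
          have hL1 : K1 * e.emptyConst ≤ L := by
            have : L * (1 - e.ρ) ≤ L * 1 := mul_le_mul_of_nonneg_left (by linarith) hL.le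
            linarith
          -- This inequality dictates `lipConst` and `paramConst`: L(1 - ρ) = 1 + K₁·`emptyConst`
          -- balances the terms in d, and M(1 - ρ) = 2D + 1 leaves Lδ to absorb the mismatch term in
          -- δ.
          have main : d + (L * (d + Mc * δ) * e.ρ + 2 * L * δ * e.D +
              K1 * e.emptyConst * (d + δ)) ≤ L * (d + Mc * δ) := by
            have t1 : L * (d + Mc * δ) - L * (d + Mc * δ) * e.ρ =
                (L * (1 - e.ρ)) * d + L * (Mc * (1 - e.ρ)) * δ := by ring
            rw [eL, eM] at t1
            nlinarith [mul_le_mul_of_nonneg_right hL1 hδ]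
          nlinarith [mul_le_mul_of_nonneg_right main hV.le]

/-! ### The solution of Poisson's equation -/

/-- Expected accumulated cost `φ` over an excursion away from the empty state. -/
def excursion (ν : Measure (ℝ × ℝ)) (φ : State → ℝ) (q : ℝ × ℝ) (x : State) : ℝ :=
  (⨆ n, occ ν φ n q x).toReal

/-- Stationary mean of the cost `φ`, as cost per excursion over length of an excursion. -/
def statMean (ν : Measure (ℝ × ℝ)) (φ : State → ℝ) (q : ℝ × ℝ) : ℝ :=
  excursion ν φ q (0, 0) / excursion ν (fun _ => 1) q (0, 0)

/-- The solution of Poisson's equation for the cost `φ` that vanishes at the empty state. -/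
def poisson (ν : Measure (ℝ × ℝ)) (φ : State → ℝ) (q : ℝ × ℝ) (x : State) : ℝ :=
  excursion ν φ q x - statMean ν φ q * excursion ν (fun _ => 1) q x

section Excursion

variable {φ : State → ℝ} {K : ℝ}

theorem measurable_excursion (ν : Measure (ℝ × ℝ)) [SFinite ν] (hφ : Measurable φ) :
    Measurable (fun p : (ℝ × ℝ) × State => excursion ν φ p.1 p.2) :=
  (Measurable.iSup fun n => measurable_occ ν hφ n).ennreal_toReal

theorem excursion_nonneg (ν : Measure (ℝ × ℝ)) (q : ℝ × ℝ) (x : State) :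
    0 ≤ excursion ν φ q x := ENNReal.toReal_nonneg

variable [SFinite νU] [SFinite νV]

theorem iSup_occ_le (h : e.Bounds νU νV) (hK : 0 ≤ K) (hφ : IsCost e φ K) {q : ℝ × ℝ}
    (hq : q ∈ e.rect) {x : State} (hx : x ∈ quadrant) :
    ⨆ n, occ (νU.prod νV) φ n q x ≤ ENNReal.ofReal (K / (1 - e.ρ) * e.lyap 1 x) :=
  iSup_le fun n => occ_le h hK hφ hq n hx

theorem excursion_le (h : e.Bounds νU νV) (hK : 0 ≤ K) (hφ : IsCost e φ K) {q : ℝ × ℝ}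
    (hq : q ∈ e.rect) {x : State} (hx : x ∈ quadrant) :
    excursion (νU.prod νV) φ q x ≤ K / (1 - e.ρ) * e.lyap 1 x := by
  have hρ : 0 < 1 - e.ρ := by linarith [h.ρ_lt_one]
  have := e.lyap_pos 1 x
  exact ENNReal.toReal_le_of_le_ofReal (by positivity) (iSup_occ_le h hK hφ hq hx)

theorem ofReal_excursion (h : e.Bounds νU νV) (hK : 0 ≤ K) (hφ : IsCost e φ K) {q : ℝ × ℝ}
    (hq : q ∈ e.rect) {x : State} (hx : x ∈ quadrant) :
    ENNReal.ofReal (excursion (νU.prod νV) φ q x) = ⨆ n, occ (νU.prod νV) φ n q x :=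
  ENNReal.ofReal_toReal
    (ne_top_of_le_ne_top ENNReal.ofReal_ne_top (iSup_occ_le h hK hφ hq hx))

theorem excursion_lipschitz (h : e.Bounds νU νV) (hK : 0 ≤ K) (hφ : IsCost e φ K)
    {q q' : ℝ × ℝ} (hq : q ∈ e.rect) (hq' : q' ∈ e.rect) {x x' : State} (hx : x ∈ quadrant)
    (hx' : x' ∈ quadrant) :
    excursion (νU.prod νV) φ q x ≤ excursion (νU.prod νV) φ q' x' +
      e.lipConst K * (dist1 x x' + e.paramConst * dist1 q q') * e.lyap 2 (x ⊔ x') := by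
  have h1 := (h.lipConst_pos hK).le
  have h2 := h.paramConst_pos.le
  have h3 := dist1_nonneg x x'
  have h4 := dist1_nonneg q q'
  have h5 := (e.lyap_pos 2 (x ⊔ x')).le
  have h6 := excursion_nonneg (φ := φ) (νU.prod νV) q' x'
  refine ENNReal.toReal_le_of_le_ofReal (by positivity) (iSup_le fun n => ?_)
  rw [ENNReal.ofReal_add h6 (by positivity), ofReal_excursion h hK hφ hq' hx']
  refine (occ_lipschitz h hK hφ hq hq' n hx hx').trans ?_
  gcongr
  exact le_iSup (fun n => occ (νU.prod νV) φ n q' x') n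

/-- Monotone convergence in the first-step decomposition of `occ`. -/
theorem iSup_occ_eq (ν : Measure (ℝ × ℝ)) [SFinite ν] (hφ : Measurable φ) (q : ℝ × ℝ)
    (x : State) : ⨆ n, occ ν φ n q x = ENNReal.ofReal (φ x) +
      ∫⁻ z, (if 0 < (rateStep q x z).1 then ⨆ n, occ ν φ n q (rateStep q x z) else 0) ∂ν := by
  have e1 : ∀ z, (if 0 < (rateStep q x z).1 then ⨆ n, occ ν φ n q (rateStep q x z) else 0) =
      ⨆ n, (if 0 < (rateStep q x z).1 then occ ν φ n q (rateStep q x z) else 0) := by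
    intro z; split_ifs <;> simp
  simp only [e1]
  rw [lintegral_iSup, ENNReal.add_iSup]
  · refine le_antisymm (iSup_le fun n => ?_) (iSup_le fun n => ?_)
    · exact (occ_mono ν φ q x (Nat.le_succ n)).trans
        (le_iSup (fun n => ENNReal.ofReal (φ x) + ∫⁻ z, (if 0 < (rateStep q x z).1 then
          occ ν φ n q (rateStep q x z) else 0) ∂ν) n)
    · exact le_iSup (fun n => occ ν φ n q x) (n + 1)
  · intro n
    exact (measurable_occ_integrand (measurable_occ ν hφ n)).comp
      (measurable_const.prodMk measurable_id :
        Measurable fun z : ℝ × ℝ => (((q, x) : (ℝ × ℝ) × State), z))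
  · intro m n hmn z
    simp only
    split_ifs
    · exact occ_mono ν φ q _ hmn
    · exact le_rfl

theorem integrable_step (h : e.Bounds νU νV) [IsProbabilityMeasure νU] [IsProbabilityMeasure νV]
    {F : State → ℝ} (hF : Measurable F) {C : ℝ} (hC : ∀ x ∈ quadrant, |F x| ≤ C * e.lyap 1 x)
    {q : ℝ × ℝ} (hq : q ∈ e.rect) {x : State} (hx : x ∈ quadrant) :
    Integrable (fun z => F (rateStep q x z)) (νU.prod νV) := by
  have hC0 : 0 ≤ C := by
    have := (abs_nonneg _).trans (hC (0, 0) zero_mem_quadrant)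
    simpa using this
  have hmeas : Measurable fun z : ℝ × ℝ => rateStep q x z :=
    measurable_rateStep.comp (measurable_const.prodMk measurable_id :
        Measurable fun z : ℝ × ℝ => (((q, x) : (ℝ × ℝ) × State), z))
  have hint : Integrable (fun z => Real.exp ((1 : ℕ) * e.incr z)) (νU.prod νV) := by
    refine ⟨by have := e.measurable_incr; fun_prop, ?_⟩
    rw [hasFiniteIntegral_iff_ofReal (ae_of_all _ fun z => (Real.exp_pos _).le)]
    exact (h.drift 1 le_rfl (by norm_num)).trans_lt ENNReal.ofReal_lt_top
  refine Integrable.mono' (g := fun z => C + C * e.lyap 1 x * Real.exp ((1 : ℕ) * e.incr z))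
    ((integrable_const _).add (hint.const_mul _)) (hF.comp hmeas).aestronglyMeasurable ?_
  filter_upwards [h.ae_nonneg] with z hz
  have hpos := e.lyap_pos 1 x
  rw [Real.norm_eq_abs]
  refine (hC _ (h.rateStep_mem_quadrant hq hx hz.1)).trans ?_
  by_cases hp : 0 < x.1 - z.1 * q.2 + z.2 * q.1
  · have := mul_le_mul_of_nonneg_left (h.lyap_step_le 1 hq hz.1 hz.2 hp) hC0
    linarith
  · rw [rateStep_of_nonpos (not_lt.1 hp), e.lyap_zero]
    have : 0 ≤ C * e.lyap 1 x * Real.exp ((1 : ℕ) * e.incr z) := by positivity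
    linarith

theorem excursion_eq (h : e.Bounds νU νV) (hK : 0 ≤ K) (hφ : IsCost e φ K) {q : ℝ × ℝ}
    (hq : q ∈ e.rect) {x : State} (hx : x ∈ quadrant) :
    excursion (νU.prod νV) φ q x = φ x + ∫ z, (if 0 < (rateStep q x z).1 then
      excursion (νU.prod νV) φ q (rateStep q x z) else 0) ∂(νU.prod νV) := by
  set ν := νU.prod νV
  have hmeas : Measurable fun z : ℝ × ℝ => (if 0 < (rateStep q x z).1 then
      excursion ν φ q (rateStep q x z) else 0) := by
    have hs : Measurable fun z : ℝ × ℝ => rateStep q x z :=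
      measurable_rateStep.comp (measurable_const.prodMk measurable_id :
        Measurable fun z : ℝ × ℝ => (((q, x) : (ℝ × ℝ) × State), z))
    refine Measurable.ite (measurableSet_lt measurable_const hs.fst) ?_ measurable_const
    exact (measurable_excursion ν hφ.measurable).comp (measurable_const.prodMk hs)
  have e1 : ∫⁻ z, (if 0 < (rateStep q x z).1 then ⨆ n, occ ν φ n q (rateStep q x z) else 0) ∂ν =
      ∫⁻ z, ENNReal.ofReal (if 0 < (rateStep q x z).1 then
        excursion ν φ q (rateStep q x z) else 0) ∂ν := by
    refine lintegral_congr_ae ?_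
    filter_upwards [h.ae_nonneg] with z hz
    split_ifs
    · rw [ofReal_excursion h hK hφ hq (h.rateStep_mem_quadrant hq hx hz.1)]
    · simp
  have hnn : ∀ z, 0 ≤ (if 0 < (rateStep q x z).1 then
        excursion ν φ q (rateStep q x z) else 0) := by
    intro z; split_ifs
    · exact excursion_nonneg _ _ _
    · exact le_rfl
  have key := iSup_occ_eq ν hφ.measurable q x
  have hfin : ⨆ n, occ ν φ n q x ≠ ⊤ :=
    ne_top_of_le_ne_top ENNReal.ofReal_ne_top (iSup_occ_le h hK hφ hq hx)
  rw [integral_eq_lintegral_of_nonneg_ae (ae_of_all _ hnn) hmeas.aestronglyMeasurable, ← e1]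
  unfold excursion
  rw [key, ENNReal.toReal_add ENNReal.ofReal_ne_top, ENNReal.toReal_ofReal (hφ.nonneg x hx)]
  intro htop
  rw [key, htop] at hfin
  simp at hfin

end Excursion


theorem isCost_one (h : e.Bounds νU νV) : IsCost e (fun _ => 1) 1 where
  measurable := measurable_const
  nonneg _ _ := zero_le_one
  le x hx := by simpa using h.one_le_lyap 1 hx
  lip x _ y _ := by simpa using dist1_nonneg x y

theorem isCost_fst (h : e.Bounds νU νV) : IsCost e Prod.fst (1 / e.θ) where
  measurable := measurable_fst
  nonneg x hx := hx.1
  le x hx := by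
    have hθ := h.θ_pos
    have := Real.add_one_le_exp (((1 : ℕ) : ℝ) * (e.θ * x.1 + e.σ * x.2))
    have h2 := mul_nonneg h.σ_pos.le hx.2
    rw [one_div_mul_eq_div, le_div_iff₀ hθ, Envelope.lyap]
    push_cast at *
    linarith
  lip x _ y _ := by
    unfold dist1
    linarith [le_abs_self (x.1 - y.1), abs_nonneg (x.2 - y.2)]

theorem isCost_snd (h : e.Bounds νU νV) : IsCost e Prod.snd (1 / e.σ) where
  measurable := measurable_snd
  nonneg x hx := hx.2
  le x hx := by
    have hσ := h.σ_pos
    have := Real.add_one_le_exp (((1 : ℕ) : ℝ) * (e.θ * x.1 + e.σ * x.2))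
    have h2 := mul_nonneg h.θ_pos.le hx.1
    rw [one_div_mul_eq_div, le_div_iff₀ hσ, Envelope.lyap]
    push_cast at *
    linarith
  lip x _ y _ := by
    unfold dist1
    linarith [le_abs_self (x.2 - y.2), abs_nonneg (x.1 - y.1)]

section Poisson

variable {φ : State → ℝ} {K : ℝ} [IsProbabilityMeasure νU] [IsProbabilityMeasure νV]

theorem abs_excursion_sub_le (h : e.Bounds νU νV) (hK : 0 ≤ K) (hφ : IsCost e φ K)
    {q q' : ℝ × ℝ} (hq : q ∈ e.rect) (hq' : q' ∈ e.rect) {x : State} (hx : x ∈ quadrant) :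
    |excursion (νU.prod νV) φ q x - excursion (νU.prod νV) φ q' x| ≤
      e.lipConst K * e.paramConst * dist1 q q' * e.lyap 2 x := by
  have h1 := excursion_lipschitz h hK hφ hq hq' hx hx
  have h2 := excursion_lipschitz h hK hφ hq' hq hx hx
  rw [dist1_comm q'] at h2
  simp only [dist1_self, zero_add, sup_idem] at h1 h2
  rw [abs_le]
  constructor <;> linarith

theorem one_le_excursion_one (h : e.Bounds νU νV) {q : ℝ × ℝ} (hq : q ∈ e.rect) {x : State}
    (hx : x ∈ quadrant) : 1 ≤ excursion (νU.prod νV) (fun _ => 1) q x := by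
  rw [excursion_eq h zero_le_one (isCost_one h) hq hx]
  refine le_add_of_nonneg_right (integral_nonneg fun z => ?_)
  simp only
  split_ifs
  · exact excursion_nonneg _ _ _
  · exact le_rfl

theorem statMean_nonneg (ν : Measure (ℝ × ℝ)) (q : ℝ × ℝ) : 0 ≤ statMean ν φ q :=
  div_nonneg (excursion_nonneg _ _ _) (excursion_nonneg _ _ _)

theorem statMean_le (h : e.Bounds νU νV) (hK : 0 ≤ K) (hφ : IsCost e φ K) {q : ℝ × ℝ}
    (hq : q ∈ e.rect) : statMean (νU.prod νV) φ q ≤ K / (1 - e.ρ) := by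
  have h1 := excursion_le h hK hφ hq zero_mem_quadrant
  rw [e.lyap_zero, mul_one] at h1
  exact (div_le_self (excursion_nonneg _ _ _)
    (one_le_excursion_one h hq zero_mem_quadrant)).trans h1

/-- A quotient of two Lipschitz functions whose denominator, the mean length of an excursion, is at
least 1 because the initial step is counted. -/
theorem statMean_lipschitz (h : e.Bounds νU νV) (hK : 0 ≤ K) (hφ : IsCost e φ K) :
    ∃ C, 0 ≤ C ∧ ∀ q ∈ e.rect, ∀ q' ∈ e.rect,
      |statMean (νU.prod νV) φ q - statMean (νU.prod νV) φ q'| ≤ C * dist1 q q' := by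
  have hρ : 0 < 1 - e.ρ := by linarith [h.ρ_lt_one]
  have hp := h.paramConst_pos
  have hl := h.lipConst_pos hK
  have hl1 := h.lipConst_pos zero_le_one
  refine ⟨e.lipConst K * e.paramConst + K / (1 - e.ρ) * (e.lipConst 1 * e.paramConst),
    by positivity, fun q hq q' hq' => ?_⟩
  have a1 := abs_excursion_sub_le h hK hφ hq hq' zero_mem_quadrant
  have a2 := abs_excursion_sub_le h zero_le_one (isCost_one h) hq hq' zero_mem_quadrant
  have t1 := one_le_excursion_one h hq zero_mem_quadrant
  have t2 := one_le_excursion_one h hq' zero_mem_quadrant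
  have m1 := statMean_le h hK hφ hq'
  have m2 := statMean_nonneg (φ := φ) (νU.prod νV) q'
  rw [e.lyap_zero, mul_one] at a1 a2
  have id : statMean (νU.prod νV) φ q - statMean (νU.prod νV) φ q' =
      ((excursion (νU.prod νV) φ q (0, 0) - excursion (νU.prod νV) φ q' (0, 0)) -
        statMean (νU.prod νV) φ q' * (excursion (νU.prod νV) (fun _ => 1) q (0, 0) -
          excursion (νU.prod νV) (fun _ => 1) q' (0, 0))) /
        excursion (νU.prod νV) (fun _ => 1) q (0, 0) := by
    have n1 : excursion (νU.prod νV) (fun _ => 1) q (0, 0) ≠ 0 := by positivity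
    have n2 : excursion (νU.prod νV) (fun _ => 1) q' (0, 0) ≠ 0 := by positivity
    unfold statMean
    field_simp
    ring
  rw [id, abs_div, abs_of_pos (zero_lt_one.trans_le t1)]
  refine (div_le_self (abs_nonneg _) t1).trans ((abs_sub _ _).trans ?_)
  rw [abs_mul, abs_of_nonneg m2]
  have := mul_le_mul m1 a2 (abs_nonneg _) (by positivity)
  linarith

theorem measurable_statMean (ν : Measure (ℝ × ℝ)) [SFinite ν] (hφ : Measurable φ) :
    Measurable (statMean ν φ) := by
  have hm : Measurable fun q : ℝ × ℝ => ((q, (0, 0)) : (ℝ × ℝ) × State) := by fun_prop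
  exact ((measurable_excursion ν hφ).comp hm).div
    ((measurable_excursion ν measurable_const).comp hm)

theorem measurable_poisson (ν : Measure (ℝ × ℝ)) [SFinite ν] (hφ : Measurable φ) :
    Measurable (fun p : (ℝ × ℝ) × State => poisson ν φ p.1 p.2) :=
  (measurable_excursion ν hφ).sub (((measurable_statMean ν hφ).comp measurable_fst).mul
    (measurable_excursion ν measurable_const))

theorem poisson_zero (h : e.Bounds νU νV) {q : ℝ × ℝ} (hq : q ∈ e.rect) :
    poisson (νU.prod νV) φ q (0, 0) = 0 := by
  have t1 := one_le_excursion_one h hq zero_mem_quadrant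
  rw [poisson, statMean, div_mul_cancel₀ _ (by positivity), sub_self]

theorem poisson_bound (h : e.Bounds νU νV) (hK : 0 ≤ K) (hφ : IsCost e φ K) :
    ∃ C, 0 ≤ C ∧ ∀ q ∈ e.rect, ∀ x ∈ quadrant,
      |poisson (νU.prod νV) φ q x| ≤ C * e.lyap 1 x := by
  have hρ : 0 < 1 - e.ρ := by linarith [h.ρ_lt_one]
  refine ⟨K / (1 - e.ρ) + K / (1 - e.ρ) * (1 / (1 - e.ρ)), by positivity,
    fun q hq x hx => ?_⟩
  have a1 := excursion_le h hK hφ hq hx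
  have a2 := excursion_le h zero_le_one (isCost_one h) hq hx
  have m1 := statMean_le h hK hφ hq
  have m2 := statMean_nonneg (φ := φ) (νU.prod νV) q
  have n1 := excursion_nonneg (φ := φ) (νU.prod νV) q x
  have n2 := excursion_nonneg (φ := fun _ => 1) (νU.prod νV) q x
  unfold poisson
  refine (abs_sub _ _).trans ?_
  rw [abs_mul, abs_of_nonneg n1, abs_of_nonneg n2, abs_of_nonneg m2]
  have := mul_le_mul m1 a2 n2 (by positivity)
  linarith

/-- The bound costs one Lyapunov index more than `poisson_bound`, because mismatches are controlled
by `lyap 2`. -/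
theorem poisson_lipschitz (h : e.Bounds νU νV) (hK : 0 ≤ K) (hφ : IsCost e φ K) :
    ∃ C, 0 ≤ C ∧ ∀ q ∈ e.rect, ∀ q' ∈ e.rect, ∀ x ∈ quadrant,
      |poisson (νU.prod νV) φ q x - poisson (νU.prod νV) φ q' x| ≤
        C * dist1 q q' * e.lyap 2 x := by
  have hρ : 0 < 1 - e.ρ := by linarith [h.ρ_lt_one]
  have hp := h.paramConst_pos
  have hl := h.lipConst_pos hK
  have hl1 := h.lipConst_pos zero_le_one
  obtain ⟨C, hC0, hC⟩ := statMean_lipschitz h hK hφ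
  refine ⟨e.lipConst K * e.paramConst + (K / (1 - e.ρ) * (e.lipConst 1 * e.paramConst) +
    C * (1 / (1 - e.ρ))), by positivity, fun q hq q' hq' x hx => ?_⟩
  have a1 := abs_excursion_sub_le h hK hφ hq hq' hx
  have a2 := abs_excursion_sub_le h zero_le_one (isCost_one h) hq hq' hx
  have a3 := excursion_le h zero_le_one (isCost_one h) hq' hx
  have m1 := statMean_le h hK hφ hq
  have m2 := statMean_nonneg (φ := φ) (νU.prod νV) q
  have n2 := excursion_nonneg (φ := fun _ => 1) (νU.prod νV) q' x
  have hd := dist1_nonneg q q'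
  have a4 : excursion (νU.prod νV) (fun _ => 1) q' x ≤ 1 / (1 - e.ρ) * e.lyap 2 x :=
    a3.trans (mul_le_mul_of_nonneg_left (h.lyap_mono_index (by norm_num) hx) (by positivity))
  have id : poisson (νU.prod νV) φ q x - poisson (νU.prod νV) φ q' x =
      (excursion (νU.prod νV) φ q x - excursion (νU.prod νV) φ q' x) -
        (statMean (νU.prod νV) φ q * (excursion (νU.prod νV) (fun _ => 1) q x -
          excursion (νU.prod νV) (fun _ => 1) q' x) +
        (statMean (νU.prod νV) φ q - statMean (νU.prod νV) φ q') *
          excursion (νU.prod νV) (fun _ => 1) q' x) := by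
    unfold poisson; ring
  rw [id]
  refine (abs_sub _ _).trans ((add_le_add le_rfl (abs_add_le _ _)).trans ?_)
  rw [abs_mul, abs_mul, abs_of_nonneg m2, abs_of_nonneg n2]
  have b1 := mul_le_mul m1 a2 (abs_nonneg _) (by positivity)
  have b2 := mul_le_mul (hC q hq q' hq') a4 n2 (by positivity)
  linarith

/-- The excursion functionals satisfy a first-step equation killed at emptying. The stationary mean
is chosen so that their combination vanishes at (0, 0), which is the only state reached by emptying,
so the killing makes no difference and the equation holds for the full kernel. -/
theorem poisson_eq (h : e.Bounds νU νV) (hK : 0 ≤ K) (hφ : IsCost e φ K) {q : ℝ × ℝ}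
    (hq : q ∈ e.rect) {x : State} (hx : x ∈ quadrant) :
    poisson (νU.prod νV) φ q x = φ x - statMean (νU.prod νV) φ q +
      ∫ z, poisson (νU.prod νV) φ q (rateStep q x z) ∂(νU.prod νV) := by
  set ν := νU.prod νV with hν
  have integ : ∀ {ψ : State → ℝ} {K : ℝ}, 0 ≤ K → IsCost e ψ K → Integrable (fun z =>
      if 0 < (rateStep q x z).1 then excursion ν ψ q (rateStep q x z) else 0) ν := by
    intro ψ K hK hψ
    refine integrable_step (F := fun y => if 0 < y.1 then excursion ν ψ q y else 0)
      (C := K / (1 - e.ρ)) h ?_ ?_ hq hx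
    · refine Measurable.ite (measurableSet_lt measurable_const measurable_fst) ?_ measurable_const
      exact (measurable_excursion ν hψ.measurable).comp (measurable_const.prodMk measurable_id :
        Measurable fun y : State => ((q, y) : (ℝ × ℝ) × State))
    · intro y hy
      have hρ : 0 < 1 - e.ρ := by linarith [h.ρ_lt_one]
      have := e.lyap_pos 1 y
      split_ifs
      · rw [abs_of_nonneg (excursion_nonneg _ _ _)]
        exact excursion_le h hK hψ hq hy
      · rw [abs_zero]; positivity
  have e1 : ∀ z, poisson ν φ q (rateStep q x z) =
      (if 0 < (rateStep q x z).1 then excursion ν φ q (rateStep q x z) else 0) -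
        statMean ν φ q * (if 0 < (rateStep q x z).1 then
          excursion ν (fun _ => 1) q (rateStep q x z) else 0) := by
    intro z
    split_ifs with hp
    · rfl
    · rw [rateStep_fst_pos_iff, not_lt] at hp
      rw [rateStep_of_nonpos hp, poisson_zero h hq]
      simp
  simp only [e1]
  rw [integral_sub (integ hK hφ) ((integ zero_le_one (isCost_one h)).const_mul _),
    integral_const_mul, poisson, excursion_eq h hK hφ hq hx,
    excursion_eq h zero_le_one (isCost_one h) hq hx]
  ring

end Poisson

/-! ### Chains with adapted parameters -/

/-- The chain `x` driven by `z`, with parameters `q` and a history `m` that is independent of the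
current input. -/
structure ControlledChain {Ω : Type*} [mΩ : MeasurableSpace Ω] (e : Envelope) (νU νV : Measure ℝ)
    (P : Measure Ω) (m : ℕ → MeasurableSpace Ω) (z q : ℕ → Ω → ℝ × ℝ) (x : ℕ → Ω → State) :
    Prop where
  history_le : ∀ t, m t ≤ mΩ
  measurable_q : ∀ t, Measurable[m t] (q t)
  measurable_x : ∀ t, Measurable[m t] (x t)
  measurable_z : ∀ t, Measurable (z t)
  q_mem : ∀ t ω, q t ω ∈ e.rect
  x_zero : ∀ ω, x 0 ω = (0, 0)
  x_succ : ∀ t ω, x (t + 1) ω = rateStep (q t ω) (x t ω) (z t ω)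
  indep : ∀ t, Indep (m t) (MeasurableSpace.comap (z t) inferInstance) P
  law : ∀ t, P.map (z t) = νU.prod νV

namespace ControlledChain

variable {Ω : Type*} [mΩ : MeasurableSpace Ω] {P : Measure Ω} {m : ℕ → MeasurableSpace Ω}
  {z q : ℕ → Ω → ℝ × ℝ} {x : ℕ → Ω → State}

theorem measurable_state (hc : ControlledChain e νU νV P m z q x) (t : ℕ) :
    Measurable (x t) := (hc.measurable_x t).mono (hc.history_le t) le_rfl

theorem measurable_param (hc : ControlledChain e νU νV P m z q x) (t : ℕ) :
    Measurable (q t) := (hc.measurable_q t).mono (hc.history_le t) le_rfl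

variable [IsProbabilityMeasure νU] [IsProbabilityMeasure νV]

theorem ae_input_nonneg (hc : ControlledChain e νU νV P m z q x) (h : e.Bounds νU νV) :
    ∀ᵐ ω ∂P, ∀ t, 0 ≤ (z t ω).1 ∧ 0 ≤ (z t ω).2 := by
  refine ae_all_iff.2 fun t => ?_
  have := h.ae_nonneg
  rw [← hc.law t] at this
  exact ae_of_ae_map (hc.measurable_z t).aemeasurable this

theorem ae_mem_quadrant (hc : ControlledChain e νU νV P m z q x) (h : e.Bounds νU νV) :
    ∀ᵐ ω ∂P, ∀ t, x t ω ∈ quadrant := by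
  filter_upwards [hc.ae_input_nonneg h] with ω hω t
  induction t with
  | zero => rw [hc.x_zero]; exact zero_mem_quadrant
  | succ t ih =>
    rw [hc.x_succ]
    exact h.rateStep_mem_quadrant (hc.q_mem t ω) ih (hω t).1

/-- The moments satisfy m_{t+1} ≤ 1 + ρ m_t, where 1 accounts for the restart at (0, 0); 1/(1 - ρ)
is the fixed point. The drift is uniform over the rectangle, so the adaptive choice of parameters is
harmless. -/
theorem lintegral_lyap_le (hc : ControlledChain e νU νV P m z q x) [IsProbabilityMeasure P]
    (h : e.Bounds νU νV) (t : ℕ) {k : ℕ} (hk1 : 1 ≤ k) (hk4 : k ≤ 4) :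
    ∫⁻ ω, ENNReal.ofReal (e.lyap k (x t ω)) ∂P ≤ ENNReal.ofReal (1 / (1 - e.ρ)) := by
  have hρ : 0 < 1 - e.ρ := by linarith [h.ρ_lt_one]
  have hρ0 := h.ρ_nonneg
  induction t with
  | zero =>
    simp only [hc.x_zero, e.lyap_zero, lintegral_const, measure_univ, mul_one]
    refine ENNReal.ofReal_le_ofReal ?_
    rw [le_div_iff₀ hρ]; linarith
  | succ t ih =>
    have hm : Measurable fun z : ℝ × ℝ => ENNReal.ofReal (Real.exp (k * e.incr z)) := by
      have := e.measurable_incr; fun_prop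
    calc ∫⁻ ω, ENNReal.ofReal (e.lyap k (x (t + 1) ω)) ∂P
        ≤ ∫⁻ ω, (1 + ENNReal.ofReal (e.lyap k (x t ω)) *
            ENNReal.ofReal (Real.exp (k * e.incr (z t ω)))) ∂P := by
          refine lintegral_mono_ae ?_
          filter_upwards [hc.ae_input_nonneg h] with ω hω
          rw [hc.x_succ]
          by_cases hp : 0 < (x t ω).1 - (z t ω).1 * (q t ω).2 + (z t ω).2 * (q t ω).1
          · refine le_trans ?_ le_add_self
            rw [← ENNReal.ofReal_mul (e.lyap_pos _ _).le]
            exact ENNReal.ofReal_le_ofReal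
              (h.lyap_step_le k (hc.q_mem t ω) (hω t).1 (hω t).2 hp)
          · rw [rateStep_of_nonpos (not_lt.1 hp), e.lyap_zero, ENNReal.ofReal_one]
            exact le_self_add
      _ = 1 + (∫⁻ ω, ENNReal.ofReal (e.lyap k (x t ω)) ∂P) *
            ∫⁻ w, ENNReal.ofReal (Real.exp (k * e.incr w)) ∂(νU.prod νV) := by
          rw [lintegral_add_left measurable_const, lintegral_const, measure_univ, mul_one]
          congr 1
          rw [← hc.law t, lintegral_map hm (hc.measurable_z t)]
          refine lintegral_mul_eq_lintegral_mul_lintegral_of_independent_measurableSpace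
            (hc.history_le t) (hc.measurable_z t).comap_le (hc.indep t) ?_ ?_
          · exact (e.measurable_lyap k).ennreal_ofReal.comp (hc.measurable_x t)
          · exact hm.comp (comap_measurable (z t))
      _ ≤ 1 + ENNReal.ofReal (1 / (1 - e.ρ)) * ENNReal.ofReal e.ρ := by
          gcongr
          exact h.drift k hk1 hk4
      _ = ENNReal.ofReal (1 / (1 - e.ρ)) := by
          rw [← ENNReal.ofReal_one, ← ENNReal.ofReal_mul (by positivity),
            ← ENNReal.ofReal_add zero_le_one (by positivity)]
          congr 1
          field_simp
          ring

theorem integrable_lyap (hc : ControlledChain e νU νV P m z q x) [IsProbabilityMeasure P]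
    (h : e.Bounds νU νV) (t : ℕ) {k : ℕ} (hk1 : 1 ≤ k) (hk4 : k ≤ 4) :
    Integrable (fun ω => e.lyap k (x t ω)) P := by
  refine ⟨((e.measurable_lyap k).comp (hc.measurable_state t)).aestronglyMeasurable, ?_⟩
  rw [hasFiniteIntegral_iff_ofReal (ae_of_all _ fun ω => (e.lyap_pos _ _).le)]
  exact (hc.lintegral_lyap_le h t hk1 hk4).trans_lt ENNReal.ofReal_lt_top

theorem integral_lyap_le (hc : ControlledChain e νU νV P m z q x) [IsProbabilityMeasure P]
    (h : e.Bounds νU νV) (t : ℕ) {k : ℕ} (hk1 : 1 ≤ k) (hk4 : k ≤ 4) :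
    ∫ ω, e.lyap k (x t ω) ∂P ≤ 1 / (1 - e.ρ) := by
  have hρ : 0 < 1 - e.ρ := by linarith [h.ρ_lt_one]
  rw [integral_eq_lintegral_of_nonneg_ae (ae_of_all _ fun ω => (e.lyap_pos _ _).le)
    (hc.integrable_lyap h t hk1 hk4).aestronglyMeasurable]
  exact ENNReal.toReal_le_of_le_ofReal (by positivity) (hc.lintegral_lyap_le h t hk1 hk4)

/-- A measurable function dominated by the Lyapunov function is integrable along the chain. -/
theorem integrable_of_le_lyap (hc : ControlledChain e νU νV P m z q x) [IsProbabilityMeasure P]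
    (h : e.Bounds νU νV) (t : ℕ) {k : ℕ} (hk1 : 1 ≤ k) (hk4 : k ≤ 4) {f : Ω → ℝ}
    (hf : Measurable f) {C : ℝ}
    (hC : ∀ ω, x t ω ∈ quadrant → |f ω| ≤ C * e.lyap k (x t ω)) : Integrable f P := by
  refine ((hc.integrable_lyap h t hk1 hk4).const_mul C).mono' hf.aestronglyMeasurable ?_
  filter_upwards [hc.ae_mem_quadrant h] with ω hω
  exact hC ω (hω t)

theorem abs_integral_le_of_le_lyap (hc : ControlledChain e νU νV P m z q x)
    [IsProbabilityMeasure P] (h : e.Bounds νU νV) (t : ℕ) {k : ℕ} (hk1 : 1 ≤ k) (hk4 : k ≤ 4)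
    {f : Ω → ℝ} {C : ℝ} (hC0 : 0 ≤ C)
    (hC : ∀ ω, x t ω ∈ quadrant → |f ω| ≤ C * e.lyap k (x t ω)) :
    |∫ ω, f ω ∂P| ≤ C * (1 / (1 - e.ρ)) := by
  have h1 : ‖∫ ω, f ω ∂P‖ ≤ ∫ ω, C * e.lyap k (x t ω) ∂P := by
    refine norm_integral_le_of_norm_le ((hc.integrable_lyap h t hk1 hk4).const_mul C) ?_
    filter_upwards [hc.ae_mem_quadrant h] with ω hω
    exact hC ω (hω t)
  refine h1.trans ?_
  rw [integral_const_mul]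
  exact mul_le_mul_of_nonneg_left (hc.integral_lyap_le h t hk1 hk4) hC0

theorem integrable_mul_poisson (hc : ControlledChain e νU νV P m z q x) [IsProbabilityMeasure P]
    (h : e.Bounds νU νV) {φ : State → ℝ} {K : ℝ} (hK : 0 ≤ K) (hφ : IsCost e φ K) (s t : ℕ)
    {ψ : Ω → ℝ} (hψ : Measurable ψ) {B : ℝ} (hB : ∀ ω, |ψ ω| ≤ B) :
    Integrable (fun ω => ψ ω * poisson (νU.prod νV) φ (q s ω) (x t ω)) P := by
  obtain ⟨C, hC0, hC⟩ := poisson_bound h hK hφ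
  have hpm : Measurable fun ω => poisson (νU.prod νV) φ (q s ω) (x t ω) :=
    (measurable_poisson (νU.prod νV) hφ.measurable).comp
      ((hc.measurable_param s).prodMk (hc.measurable_state t))
  refine hc.integrable_of_le_lyap h t (k := 1) (C := B * C) le_rfl (by norm_num)
    (hψ.mul hpm) fun ω hω => ?_
  rw [abs_mul, mul_assoc]
  exact mul_le_mul (hB ω) (hC _ (hc.q_mem s ω) _ hω) (abs_nonneg _)
    ((abs_nonneg _).trans (hB ω))

/-- The Markov property in integrated form: the triple (ψ, q_t, x_t) is independent of the current
input, so their joint law is a product and Fubini applies. No conditional expectation is needed. -/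
theorem integral_step (hc : ControlledChain e νU νV P m z q x) [IsProbabilityMeasure P] (t : ℕ)
    {F : ℝ × ℝ → State → ℝ} (hF : Measurable fun p : (ℝ × ℝ) × State => F p.1 p.2)
    {ψ : Ω → ℝ} (hψ : Measurable[m t] ψ)
    (hi : Integrable (fun ω => ψ ω * F (q t ω) (x (t + 1) ω)) P) :
    ∫ ω, ψ ω * F (q t ω) (x (t + 1) ω) ∂P =
      ∫ ω, ψ ω * ∫ w, F (q t ω) (rateStep (q t ω) (x t ω) w) ∂(νU.prod νV) ∂P := by
  let Y : Ω → ℝ × (ℝ × ℝ) × State := fun ω => (ψ ω, q t ω, x t ω)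
  have hYm : Measurable[m t] Y := hψ.prodMk ((hc.measurable_q t).prodMk (hc.measurable_x t))
  have hYm' : Measurable Y := hYm.mono (hc.history_le t) le_rfl
  have hind : IndepFun Y (z t) P :=
    (IndepFun_iff_Indep _ _ _).2 (indep_of_indep_of_le_left (hc.indep t) hYm.comap_le)
  have hmap := (indepFun_iff_map_prod_eq_prod_map_map hYm'.aemeasurable
    (hc.measurable_z t).aemeasurable).1 hind
  rw [hc.law t] at hmap
  let g : (ℝ × (ℝ × ℝ) × State) × (ℝ × ℝ) → ℝ := fun p =>
    p.1.1 * F p.1.2.1 (rateStep p.1.2.1 p.1.2.2 p.2)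
  have hgm : Measurable g := by
    have h1 : Measurable fun p : (ℝ × (ℝ × ℝ) × State) × (ℝ × ℝ) =>
        rateStep p.1.2.1 p.1.2.2 p.2 :=
      measurable_rateStep.comp ((measurable_fst.snd).prodMk measurable_snd)
    exact (measurable_fst.fst).mul (hF.comp ((measurable_fst.snd.fst).prodMk h1))
  have hYz : Measurable fun ω => (Y ω, z t ω) := hYm'.prodMk (hc.measurable_z t)
  have e2 : (fun ω => ψ ω * F (q t ω) (x (t + 1) ω)) = fun ω => g (Y ω, z t ω) := by
    funext ω
    simp only [g, Y, hc.x_succ]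
  rw [e2] at hi ⊢
  have hgi : Integrable g ((P.map Y).prod (νU.prod νV)) := by
    rw [← hmap]
    exact (integrable_map_measure hgm.aestronglyMeasurable hYz.aemeasurable).2 hi
  rw [← integral_map hYz.aemeasurable (f := g) hgm.aestronglyMeasurable, hmap,
    integral_prod g hgi, integral_map hYm'.aemeasurable]
  · refine integral_congr_ae (ae_of_all _ fun ω => ?_)
    simp only [g, Y]
    rw [integral_const_mul]
  · exact hgm.stronglyMeasurable.integral_prod_right.aestronglyMeasurable

theorem integrable_mul_sub_statMean (hc : ControlledChain e νU νV P m z q x)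
    [IsProbabilityMeasure P] (h : e.Bounds νU νV) {φ : State → ℝ} {K : ℝ} (hK : 0 ≤ K)
    (hφ : IsCost e φ K) (t : ℕ) {ψ : Ω → ℝ} (hψ : Measurable ψ) {B : ℝ} (hB : ∀ ω, |ψ ω| ≤ B) :
    Integrable (fun ω => ψ ω * (φ (x t ω) - statMean (νU.prod νV) φ (q t ω))) P := by
  have hρ : 0 < 1 - e.ρ := by linarith [h.ρ_lt_one]
  have hm : Measurable fun ω => φ (x t ω) - statMean (νU.prod νV) φ (q t ω) :=
    (hφ.measurable.comp (hc.measurable_state t)).sub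
      ((measurable_statMean (νU.prod νV) hφ.measurable).comp (hc.measurable_param t))
  refine hc.integrable_of_le_lyap h t (k := 1) (C := B * (K + K / (1 - e.ρ))) le_rfl
    (by norm_num) (hψ.mul hm) fun ω hω => ?_
  rw [abs_mul, mul_assoc]
  refine mul_le_mul (hB ω) ((abs_sub _ _).trans ?_) (abs_nonneg _)
    ((abs_nonneg _).trans (hB ω))
  have m1 := statMean_le h hK hφ (hc.q_mem t ω)
  have m2 := statMean_nonneg (φ := φ) (νU.prod νV) (q t ω)
  have l1 := h.one_le_lyap 1 hω
  rw [abs_of_nonneg (hφ.nonneg _ hω), abs_of_nonneg m2, add_mul]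
  exact add_le_add (hφ.le _ hω) (m1.trans (le_mul_of_one_le_right (by positivity) l1))

/-- Poisson's equation along the chain. -/
theorem integral_poisson (hc : ControlledChain e νU νV P m z q x) [IsProbabilityMeasure P]
    (h : e.Bounds νU νV) {φ : State → ℝ} {K : ℝ} (hK : 0 ≤ K) (hφ : IsCost e φ K) (t : ℕ)
    {ψ : Ω → ℝ} (hψ : Measurable[m t] ψ) {B : ℝ} (hB : ∀ ω, |ψ ω| ≤ B) :
    ∫ ω, ψ ω * (φ (x t ω) - statMean (νU.prod νV) φ (q t ω)) ∂P =
      ∫ ω, ψ ω * poisson (νU.prod νV) φ (q t ω) (x t ω) ∂P -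
        ∫ ω, ψ ω * poisson (νU.prod νV) φ (q t ω) (x (t + 1) ω) ∂P := by
  have hψm : Measurable ψ := hψ.mono (hc.history_le t) le_rfl
  have hρ : 0 < 1 - e.ρ := by linarith [h.ρ_lt_one]
  have i1 := hc.integrable_mul_poisson h hK hφ t t hψm hB
  have i2 := hc.integrable_mul_poisson h hK hφ t (t + 1) hψm hB
  have i3 := hc.integrable_mul_sub_statMean h hK hφ t hψm hB
  have e3 := hc.integral_step t (measurable_poisson (νU.prod νV) hφ.measurable) hψ i2
  rw [eq_sub_iff_add_eq, ← eq_sub_iff_add_eq', ← integral_sub i1 i3, e3]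
  refine integral_congr_ae ?_
  filter_upwards [hc.ae_mem_quadrant h] with ω hω
  rw [poisson_eq h hK hφ (hc.q_mem t ω) (hω t)]
  ring

end ControlledChain

end Chain

/-! ### Histories of the driving sequences -/

section Driving

variable {Ω : Type*} {U V : ℕ → Ω → ℝ}

/-- The σ-algebra generated by the driving variables of index less than `n`. -/
@[reducible] def history (U V : ℕ → Ω → ℝ) (n : ℕ) : MeasurableSpace Ω :=
  ⨆ i ∈ {i : ℕ ⊕ ℕ | Sum.elim id id i < n}, MeasurableSpace.comap (Sum.elim U V i) inferInstance

theorem history_mono {m n : ℕ} (hmn : m ≤ n) : history U V m ≤ history U V n :=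
  biSup_mono fun _ hi => lt_of_lt_of_le hi hmn

theorem measurable_history_elim {n : ℕ} {i : ℕ ⊕ ℕ} (hi : Sum.elim id id i < n) :
    Measurable[history U V n] (Sum.elim U V i) :=
  (comap_measurable _).mono (le_iSup₂_of_le i hi le_rfl) le_rfl

theorem measurable_history_pair {n j : ℕ} (hj : j < n) :
    Measurable[history U V n] (fun ω => (U j ω, V j ω)) :=
  (measurable_history_elim (i := Sum.inl j) hj).prodMk
    (measurable_history_elim (i := Sum.inr j) hj)

/-! ### The chain with fixed parameters -/

/-- Waiting time and observed busy period under a fixed parameter. -/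
def fixedChain (U V : ℕ → Ω → ℝ) (q : ℝ × ℝ) : ℕ → Ω → State
  | 0, _ => (0, 0)
  | n + 1, ω => rateStep q (fixedChain U V q n ω) (U n ω, V n ω)

theorem measurable_fixedChain (q : ℝ × ℝ) (n : ℕ) :
    Measurable[history U V n] (fixedChain U V q n) := by
  induction n with
  | zero => exact measurable_const
  | succ n ih =>
    have h1 : Measurable[history U V (n + 1)] fun ω =>
        ((q, fixedChain U V q n ω), (U n ω, V n ω)) :=
      (measurable_const.prodMk (ih.mono (history_mono n.le_succ) le_rfl)).prodMk
        (measurable_history_pair n.lt_succ_self)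
    exact measurable_rateStep.comp h1

/-- The waiting time is a maximum of linear functions of the mean service and inter-arrival
times, with the state as a subgradient. -/
theorem fixedChain_subgradient {q : ℝ × ℝ} (h1 : q.1 ≠ 0) (h2 : q.2 ≠ 0) (q' : ℝ × ℝ) (n : ℕ)
    (ω : Ω) : (fixedChain U V q n ω).1 + ((fixedChain U V q n ω).1 + (fixedChain U V q n ω).2) *
      ((q'.1 - q.1) / q.1) - (fixedChain U V q n ω).2 * ((q'.2 - q.2) / q.2) ≤
      (fixedChain U V q' n ω).1 := by
  induction n with
  | zero => simp [fixedChain]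
  | succ n ih =>
    simp only [fixedChain]
    set x := fixedChain U V q n ω
    by_cases hp : 0 < x.1 - U n ω * q.2 + V n ω * q.1
    -- Within a busy period w + y is α times a sum of service inputs and y is β times a sum of
    -- inter-arrival inputs. The left side is therefore the same linear function evaluated at q',
    -- and it grows by exactly the unreflected increment at q'.
    · rw [rateStep_of_pos (z := (U n ω, V n ω)) hp]
      refine le_trans ?_ (le_max_left _ _)
      simp only
      have i1 : V n ω * q.1 * ((q'.1 - q.1) / q.1) = V n ω * (q'.1 - q.1) := by field_simp
      have i2 : U n ω * q.2 * ((q'.2 - q.2) / q.2) = U n ω * (q'.2 - q.2) := by field_simp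
      linarith
    -- After emptying the linear function restarts at zero, below any waiting time.
    · rw [rateStep_of_nonpos (z := (U n ω, V n ω)) (not_lt.1 hp)]
      simp [rateStep]

end Driving

/-! ### Independence of past and present inputs, and ergodic averages at a fixed parameter -/

section History

variable {Ω : Type*} [mΩ : MeasurableSpace Ω] {P : Measure Ω} {U V : ℕ → Ω → ℝ}

theorem DrivingSequences.measurable_elim (hUV : DrivingSequences P U V) (i : ℕ ⊕ ℕ) :
    Measurable (Sum.elim U V i) := by
  cases i with
  | inl i => exact hUV.measurable_U i
  | inr i => exact hUV.measurable_V i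

theorem history_le (hUV : DrivingSequences P U V) (n : ℕ) : history U V n ≤ mΩ :=
  iSup₂_le fun i _ => (hUV.measurable_elim i).comap_le

/-- The indices below n and the indices equal to n are disjoint sets of the joint index type ℕ ⊕ ℕ.
-/
theorem indep_history (hUV : DrivingSequences P U V) (n : ℕ) :
    Indep (history U V n) (MeasurableSpace.comap (fun ω => (U n ω, V n ω)) inferInstance) P := by
  have hdisj : Disjoint {i : ℕ ⊕ ℕ | Sum.elim id id i < n}
      {i : ℕ ⊕ ℕ | Sum.elim id id i = n} :=
    Set.disjoint_left.2 fun i h1 h2 => (ne_of_lt h1) h2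
  have h := indep_iSup_of_disjoint (fun i => (hUV.measurable_elim i).comap_le) hUV.indep hdisj
  refine indep_of_indep_of_le_right h ?_
  refine Measurable.comap_le (Measurable.prodMk ?_ ?_)
  · exact (comap_measurable (U n)).mono
      (le_iSup₂_of_le (f := fun i (_ : i ∈ {i : ℕ ⊕ ℕ | Sum.elim id id i = n}) =>
        MeasurableSpace.comap (Sum.elim U V i) inferInstance) (Sum.inl n) rfl le_rfl) le_rfl
  · exact (comap_measurable (V n)).mono
      (le_iSup₂_of_le (f := fun i (_ : i ∈ {i : ℕ ⊕ ℕ | Sum.elim id id i = n}) =>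
        MeasurableSpace.comap (Sum.elim U V i) inferInstance) (Sum.inr n) rfl le_rfl) le_rfl

theorem map_pair (hUV : DrivingSequences P U V) [IsProbabilityMeasure P] (n : ℕ) :
    P.map (fun ω => (U n ω, V n ω)) = (P.map (U 0)).prod (P.map (V 0)) := by
  have hind : IndepFun (U n) (V n) P :=
    hUV.indep.indepFun (i := Sum.inl n) (j := Sum.inr n) (by simp)
  rw [(indepFun_iff_map_prod_eq_prod_map_map (hUV.measurable_U n).aemeasurable
    (hUV.measurable_V n).aemeasurable).1 hind, (hUV.ident_U n).map_eq, (hUV.ident_V n).map_eq]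

/-- The shift k is 0 for the fixed-parameter queue and 1 for the algorithm, whose time starts at 1.
-/
theorem controlledChain_of_history {e : Envelope} (hUV : DrivingSequences P U V)
    [IsProbabilityMeasure P] (k : ℕ) {q : ℕ → Ω → ℝ × ℝ} {x : ℕ → Ω → State}
    (hq : ∀ t, Measurable[history U V (t + k)] (q t))
    (hx : ∀ t, Measurable[history U V (t + k)] (x t)) (hmem : ∀ t ω, q t ω ∈ e.rect)
    (h0 : ∀ ω, x 0 ω = (0, 0))
    (hs : ∀ t ω, x (t + 1) ω = rateStep (q t ω) (x t ω) (U (t + k) ω, V (t + k) ω)) :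
    ControlledChain e (P.map (U 0)) (P.map (V 0)) P (fun t => history U V (t + k))
      (fun t ω => (U (t + k) ω, V (t + k) ω)) q x where
  history_le _ := history_le hUV _
  measurable_q := hq
  measurable_x := hx
  measurable_z _ := (hUV.measurable_U _).prodMk (hUV.measurable_V _)
  q_mem := hmem
  x_zero := h0
  x_succ := hs
  indep _ := indep_history hUV _
  law _ := map_pair hUV _

variable {e : Envelope}

theorem controlledChain_fixed (hUV : DrivingSequences P U V) [IsProbabilityMeasure P] {q : ℝ × ℝ}
    (hq : q ∈ e.rect) :
    ControlledChain e (P.map (U 0)) (P.map (V 0)) P (fun t => history U V t)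
      (fun t ω => (U t ω, V t ω)) (fun _ _ => q) (fixedChain U V q) :=
  controlledChain_of_history hUV 0 (fun _ => measurable_const)
    (fun t => measurable_fixedChain q t) (fun _ _ => hq) (fun _ => rfl) (fun _ _ => rfl)

/-- The joint law of an inter-arrival and a service time. -/
def drivingLaw (P : Measure Ω) (U V : ℕ → Ω → ℝ) : Measure (ℝ × ℝ) :=
  (P.map (U 0)).prod (P.map (V 0))

/-- Summing Poisson's equation telescopes, and the remaining boundary term is bounded in N. This is
stronger than convergence of averages; the O(1) error is what Little's law uses below. -/
theorem abs_sum_sub_statMean_le (hUV : DrivingSequences P U V) [IsProbabilityMeasure P]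
    (h : e.Bounds (P.map (U 0)) (P.map (V 0))) {φ : State → ℝ} {K : ℝ} (hK : 0 ≤ K)
    (hφ : IsCost e φ K) {q : ℝ × ℝ} (hq : q ∈ e.rect) :
    ∃ C, 0 ≤ C ∧ ∀ N : ℕ, |∑ n ∈ Finset.range N, ∫ ω, φ (fixedChain U V q n ω) ∂P -
      N * statMean (drivingLaw P U V) φ q| ≤ C := by
  have : IsProbabilityMeasure (P.map (U 0)) :=
    Measure.isProbabilityMeasure_map (hUV.measurable_U 0).aemeasurable
  have : IsProbabilityMeasure (P.map (V 0)) :=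
    Measure.isProbabilityMeasure_map (hUV.measurable_V 0).aemeasurable
  have hc := controlledChain_fixed hUV hq
  have hρ : 0 < 1 - e.ρ := by linarith [h.ρ_lt_one]
  obtain ⟨C, hC0, hC⟩ := poisson_bound h hK hφ
  refine ⟨C * (1 / (1 - e.ρ)), by positivity, fun N => ?_⟩
  set ν := (P.map (U 0)).prod (P.map (V 0)) with hν
  have key : ∀ n, ∫ ω, φ (fixedChain U V q n ω) ∂P - statMean ν φ q =
      ∫ ω, poisson ν φ q (fixedChain U V q n ω) ∂P -
        ∫ ω, poisson ν φ q (fixedChain U V q (n + 1) ω) ∂P := by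
    intro n
    have h1 := hc.integral_poisson h hK hφ n (ψ := fun _ => 1) (B := 1) measurable_const
      (fun _ => by simp)
    simp only [one_mul] at h1
    rw [← h1, integral_sub _ (integrable_const _)]
    · simp [hν]
    · refine hc.integrable_of_le_lyap h n (k := 1) le_rfl (by norm_num)
        (hφ.measurable.comp (hc.measurable_state n)) (C := K) fun ω hω => ?_
      rw [abs_of_nonneg (hφ.nonneg _ hω)]
      exact hφ.le _ hω
  have tele : ∑ n ∈ Finset.range N, ∫ ω, φ (fixedChain U V q n ω) ∂P - N * statMean ν φ q =
      - ∫ ω, poisson ν φ q (fixedChain U V q N ω) ∂P := by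
    have h0 : ∫ ω, poisson ν φ q (fixedChain U V q 0 ω) ∂P = 0 := by
      simp [fixedChain, hν, poisson_zero h hq]
    have := Finset.sum_range_sub' (fun n => ∫ ω, poisson ν φ q (fixedChain U V q n ω) ∂P) N
    rw [h0, zero_sub] at this
    rw [← this, Finset.sum_congr rfl fun n _ => (key n).symm, Finset.sum_sub_distrib]
    simp
  change |_ - _ * statMean ν φ q| ≤ _
  rw [tele, abs_neg]
  exact hc.abs_integral_le_of_le_lyap h N le_rfl (by norm_num) hC0
    fun ω hω => hC q hq _ hω

theorem tendsto_average (hUV : DrivingSequences P U V) [IsProbabilityMeasure P]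
    (h : e.Bounds (P.map (U 0)) (P.map (V 0))) {φ : State → ℝ} {K : ℝ} (hK : 0 ≤ K)
    (hφ : IsCost e φ K) {q : ℝ × ℝ} (hq : q ∈ e.rect) :
    Tendsto (fun N : ℕ => (∑ n ∈ Finset.range N, ∫ ω, φ (fixedChain U V q n ω) ∂P) / N) atTop
      (𝓝 (statMean (drivingLaw P U V) φ q)) := by
  obtain ⟨C, hC0, hC⟩ := abs_sum_sub_statMean_le hUV h hK hφ hq
  rw [tendsto_iff_norm_sub_tendsto_zero]
  refine squeeze_zero' (Eventually.of_forall fun N => norm_nonneg _) ?_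
    (tendsto_const_div_atTop_nhds_zero_nat C)
  filter_upwards [eventually_gt_atTop 0] with N hN
  have hN' : (0 : ℝ) < N := by exact_mod_cast hN
  rw [Real.norm_eq_abs, div_sub' hN'.ne', abs_div, abs_of_pos hN']
  exact div_le_div_of_nonneg_right (hC N) hN'.le

end History

/-! ### Differentiability of the stationary mean waiting time -/

section Gradient

variable {Ω : Type*} [mΩ : MeasurableSpace Ω] {P : Measure Ω} {U V : ℕ → Ω → ℝ} {e : Envelope}
  [IsProbabilityMeasure P]

/-- The pathwise inequality `fixedChain_subgradient` survives expectation, averaging over time and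
passage to the limit, so no derivative has to be interchanged with a limit. -/
theorem statMean_subgradient (hUV : DrivingSequences P U V)
    (h : e.Bounds (P.map (U 0)) (P.map (V 0))) {q q' : ℝ × ℝ} (hq : q ∈ e.rect)
    (hq' : q' ∈ e.rect) :
    statMean (drivingLaw P U V) Prod.fst q +
      (statMean (drivingLaw P U V) Prod.fst q + statMean (drivingLaw P U V) Prod.snd q) *
        ((q'.1 - q.1) / q.1) -
      statMean (drivingLaw P U V) Prod.snd q * ((q'.2 - q.2) / q.2) ≤
      statMean (drivingLaw P U V) Prod.fst q' := by
  have : IsProbabilityMeasure (P.map (U 0)) :=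
    Measure.isProbabilityMeasure_map (hUV.measurable_U 0).aemeasurable
  have : IsProbabilityMeasure (P.map (V 0)) :=
    Measure.isProbabilityMeasure_map (hUV.measurable_V 0).aemeasurable
  have hθ := h.θ_pos
  have hσ := h.σ_pos
  have K1 : 0 ≤ 1 / e.θ := by positivity
  have K2 : 0 ≤ 1 / e.σ := by positivity
  have t1 := tendsto_average hUV h K1 (isCost_fst h) hq
  have t2 := tendsto_average hUV h K2 (isCost_snd h) hq
  have t3 := tendsto_average hUV h K1 (isCost_fst h) hq'
  have hq1 : 0 < q.1 := h.αm_pos.trans_le hq.1.1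
  have hq2 : 0 < q.2 := h.β0_pos.trans_le hq.2.1
  refine le_of_tendsto_of_tendsto
    ((t1.add ((t1.add t2).mul_const _)).sub (t2.mul_const _)) t3 ?_
  refine Eventually.of_forall fun N => ?_
  have int1 : ∀ {q : ℝ × ℝ}, q ∈ e.rect → ∀ n,
      Integrable (fun ω => (fixedChain U V q n ω).1) P := by
    intro q hq n
    have hc := controlledChain_fixed (e := e) hUV hq
    refine hc.integrable_of_le_lyap h n (k := 1) le_rfl (by norm_num)
      (hc.measurable_state n).fst (C := 1 / e.θ) fun ω hω => ?_
    rw [abs_of_nonneg hω.1]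
    exact (isCost_fst h).le _ hω
  have int2 : ∀ n, Integrable (fun ω => (fixedChain U V q n ω).2) P := by
    intro n
    have hc := controlledChain_fixed (e := e) hUV hq
    refine hc.integrable_of_le_lyap h n (k := 1) le_rfl (by norm_num)
      (hc.measurable_state n).snd (C := 1 / e.σ) fun ω hω => ?_
    rw [abs_of_nonneg hω.2]
    exact (isCost_snd h).le _ hω
  have hn : ∀ n, ∫ ω, (fixedChain U V q n ω).1 ∂P +
      (∫ ω, (fixedChain U V q n ω).1 ∂P + ∫ ω, (fixedChain U V q n ω).2 ∂P) *
        ((q'.1 - q.1) / q.1) - (∫ ω, (fixedChain U V q n ω).2 ∂P) * ((q'.2 - q.2) / q.2) ≤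
      ∫ ω, (fixedChain U V q' n ω).1 ∂P := by
    intro n
    have i12 : Integrable (fun ω => (fixedChain U V q n ω).1 + (fixedChain U V q n ω).2) P :=
      (int1 hq n).add (int2 n)
    have i13 : Integrable (fun ω => (fixedChain U V q n ω).1 +
        ((fixedChain U V q n ω).1 + (fixedChain U V q n ω).2) * ((q'.1 - q.1) / q.1)) P :=
      (int1 hq n).add (i12.mul_const _)
    rw [← integral_add (int1 hq n) (int2 n), ← integral_mul_const, ← integral_mul_const,
      ← integral_add (int1 hq n) (i12.mul_const _), ← integral_sub i13 ((int2 n).mul_const _)]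
    exact integral_mono (i13.sub ((int2 n).mul_const _))
      (int1 hq' n) fun ω => fixedChain_subgradient hq1.ne' hq2.ne' q' n ω
  have hsum := Finset.sum_le_sum fun n (_ : n ∈ Finset.range N) => hn n
  rw [Finset.sum_sub_distrib, Finset.sum_add_distrib, ← Finset.sum_mul, Finset.sum_add_distrib,
    ← Finset.sum_mul] at hsum
  have hN : (0 : ℝ) ≤ N := by positivity
  refine le_trans (le_of_eq ?_) (div_le_div_of_nonneg_right hsum hN)
  ring

theorem abs_le_norm_prod (v : ℝ × ℝ) : |v.1| ≤ ‖v‖ ∧ |v.2| ≤ ‖v‖ :=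
  ⟨norm_fst_le v, norm_snd_le v⟩

/-- Derivative of the stationary mean waiting time in the mean service and inter-arrival times. -/
theorem hasFDerivWithinAt_statMean (hUV : DrivingSequences P U V)
    (h : e.Bounds (P.map (U 0)) (P.map (V 0))) {q : ℝ × ℝ} (hq : q ∈ e.rect) :
    HasFDerivWithinAt (statMean (drivingLaw P U V) Prod.fst)
      (((statMean (drivingLaw P U V) Prod.fst q + statMean (drivingLaw P U V) Prod.snd q) / q.1) •
        ContinuousLinearMap.fst ℝ ℝ ℝ - (statMean (drivingLaw P U V) Prod.snd q / q.2) •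
        ContinuousLinearMap.snd ℝ ℝ ℝ) e.rect q := by
  have : IsProbabilityMeasure (P.map (U 0)) :=
    Measure.isProbabilityMeasure_map (hUV.measurable_U 0).aemeasurable
  have : IsProbabilityMeasure (P.map (V 0)) :=
    Measure.isProbabilityMeasure_map (hUV.measurable_V 0).aemeasurable
  have hθ := h.θ_pos
  have hσ := h.σ_pos
  have hα := h.αm_pos
  have hβ := h.β0_pos
  have hρ : 0 < 1 - e.ρ := by linarith [h.ρ_lt_one]
  have K1 : 0 ≤ 1 / e.θ := by positivity
  have K2 : 0 ≤ 1 / e.σ := by positivity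
  obtain ⟨C1, hC1, L1⟩ := statMean_lipschitz h K1 (isCost_fst h)
  obtain ⟨C2, hC2, L2⟩ := statMean_lipschitz h K2 (isCost_snd h)
  change ∀ q ∈ e.rect, ∀ q' ∈ e.rect, |statMean (drivingLaw P U V) _ q -
    statMean (drivingLaw P U V) _ q'| ≤ _ at L1
  change ∀ q ∈ e.rect, ∀ q' ∈ e.rect, |statMean (drivingLaw P U V) _ q -
    statMean (drivingLaw P U V) _ q'| ≤ _ at L2
  set w := statMean (drivingLaw P U V) Prod.fst with hw
  set y := statMean (drivingLaw P U V) Prod.snd with hy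
  have hq1 : 0 < q.1 := hα.trans_le hq.1.1
  have hq2 : 0 < q.2 := hβ.trans_le hq.2.1
  have hy0 : 0 ≤ y q := statMean_nonneg _ _
  have hw0 : 0 ≤ w q := statMean_nonneg _ _
  set C : ℝ := ((2 * C1 + 2 * C2) / e.αm + (w q + y q) / (e.αm * q.1)) +
    (2 * C2 / e.β0 + y q / (e.β0 * q.2)) with hC
  have hCnn : 0 ≤ C := by positivity
  -- The remainder is nonnegative by the subgradient inequality at q. By the one at q' it is at most
  -- the change of the subgradient paired with q' - q, which is quadratic since the subgradients are
  -- Lipschitz.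
  have main : ∀ q' ∈ e.rect, ‖w q' - w q - (((w q + y q) / q.1) • ContinuousLinearMap.fst ℝ ℝ ℝ -
      (y q / q.2) • ContinuousLinearMap.snd ℝ ℝ ℝ) (q' - q)‖ ≤ C * ‖q' - q‖ ^ 2 := by
    intro q' hq'
    have hq1' : 0 < q'.1 := hα.trans_le hq'.1.1
    have hq2' : 0 < q'.2 := hβ.trans_le hq'.2.1
    have s1 := statMean_subgradient hUV h hq hq'
    have s2 := statMean_subgradient hUV h hq' hq
    rw [← hw, ← hy] at s1 s2
    obtain ⟨n1, n2⟩ := abs_le_norm_prod (q' - q)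
    simp only [Prod.fst_sub, Prod.snd_sub] at n1 n2
    set r := ‖q' - q‖ with hr
    have hr0 : 0 ≤ r := norm_nonneg _
    have hd : dist1 q' q ≤ 2 * r := by unfold dist1; linarith
    have l1 : |w q' - w q| ≤ 2 * C1 * r := (L1 q' hq' q hq).trans (by nlinarith)
    have l2 : |y q' - y q| ≤ 2 * C2 * r := (L2 q' hq' q hq).trans (by nlinarith)
    have d1 : |(w q' + y q') / q'.1 - (w q + y q) / q.1| ≤
        ((2 * C1 + 2 * C2) / e.αm + (w q + y q) / (e.αm * q.1)) * r := by
      have id : (w q' + y q') / q'.1 - (w q + y q) / q.1 =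
          ((w q' - w q) + (y q' - y q)) / q'.1 +
            (w q + y q) * (-(q'.1 - q.1)) / (q'.1 * q.1) := by field_simp; ring
      rw [id, add_mul _ _ r]
      refine (abs_add_le _ _).trans (add_le_add ?_ ?_)
      · rw [abs_div, abs_of_pos hq1', div_mul_eq_mul_div]
        exact div_le_div₀ (by positivity) ((abs_add_le _ _).trans (by linarith)) hα hq'.1.1
      · rw [abs_div, abs_mul, abs_neg, abs_of_nonneg (add_nonneg hw0 hy0),
          abs_of_pos (mul_pos hq1' hq1), div_mul_eq_mul_div]
        exact div_le_div₀ (by positivity) (mul_le_mul_of_nonneg_left n1 (by positivity))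
          (by positivity) (mul_le_mul_of_nonneg_right hq'.1.1 hq1.le)
    have d2 : |y q' / q'.2 - y q / q.2| ≤ (2 * C2 / e.β0 + y q / (e.β0 * q.2)) * r := by
      have id : y q' / q'.2 - y q / q.2 =
          (y q' - y q) / q'.2 + y q * (-(q'.2 - q.2)) / (q'.2 * q.2) := by field_simp; ring
      rw [id, add_mul _ _ r]
      refine (abs_add_le _ _).trans (add_le_add ?_ ?_)
      · rw [abs_div, abs_of_pos hq2', div_mul_eq_mul_div]
        exact div_le_div₀ (by positivity) l2 hβ hq'.2.1
      · rw [abs_div, abs_mul, abs_neg, abs_of_nonneg hy0,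
          abs_of_pos (mul_pos hq2' hq2), div_mul_eq_mul_div]
        exact div_le_div₀ (by positivity) (mul_le_mul_of_nonneg_left n2 (by positivity))
          (by positivity) (mul_le_mul_of_nonneg_right hq'.2.1 hq2.le)
    have ev : (((w q + y q) / q.1) • ContinuousLinearMap.fst ℝ ℝ ℝ -
      (y q / q.2) • ContinuousLinearMap.snd ℝ ℝ ℝ) (q' - q) =
        (w q + y q) / q.1 * (q'.1 - q.1) - y q / q.2 * (q'.2 - q.2) := by
      simp
    rw [ev, Real.norm_eq_abs]
    have low : 0 ≤ w q' - w q - ((w q + y q) / q.1 * (q'.1 - q.1) -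
        y q / q.2 * (q'.2 - q.2)) := by
      have e1 : (w q + y q) * ((q'.1 - q.1) / q.1) = (w q + y q) / q.1 * (q'.1 - q.1) := by ring
      have e2 : y q * ((q'.2 - q.2) / q.2) = y q / q.2 * (q'.2 - q.2) := by ring
      rw [e1, e2] at s1
      linarith
    rw [abs_of_nonneg low]
    have e1 : (w q' + y q') * ((q.1 - q'.1) / q'.1) =
      -((w q' + y q') / q'.1 * (q'.1 - q.1)) := by ring
    have e2 : y q' * ((q.2 - q'.2) / q'.2) = -(y q' / q'.2 * (q'.2 - q.2)) := by ring
    rw [e1, e2] at s2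
    have b1 : ((w q' + y q') / q'.1 - (w q + y q) / q.1) * (q'.1 - q.1) ≤
        (((2 * C1 + 2 * C2) / e.αm + (w q + y q) / (e.αm * q.1)) * r) * r :=
      (le_abs_self _).trans (by
        rw [abs_mul]; exact mul_le_mul d1 n1 (abs_nonneg _) (by positivity))
    have b2 : -((y q' / q'.2 - y q / q.2) * (q'.2 - q.2)) ≤
        ((2 * C2 / e.β0 + y q / (e.β0 * q.2)) * r) * r :=
      (neg_le_abs _).trans (by
        rw [abs_mul]; exact mul_le_mul d2 n2 (abs_nonneg _) (by positivity))
    have : C * r ^ 2 = (((2 * C1 + 2 * C2) / e.αm + (w q + y q) / (e.αm * q.1)) * r) * r +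
        ((2 * C2 / e.β0 + y q / (e.β0 * q.2)) * r) * r := by rw [hC]; ring
    rw [this]
    linarith
  rw [hasFDerivWithinAt_iff_isLittleO]
  have hO : (fun q' => w q' - w q - (((w q + y q) / q.1) • ContinuousLinearMap.fst ℝ ℝ ℝ -
      (y q / q.2) • ContinuousLinearMap.snd ℝ ℝ ℝ) (q' - q)) =O[𝓝[e.rect] q]
        fun q' => ‖q' - q‖ ^ 2 := by
    refine Asymptotics.IsBigO.of_bound C ?_
    filter_upwards [self_mem_nhdsWithin] with q' hq'
    rw [norm_pow, norm_norm]
    exact main q' hq'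
  exact hO.trans_isLittleO ((Asymptotics.isLittleO_pow_sub_sub q one_lt_two).mono
    nhdsWithin_le_nhds)

end Gradient

/-! ### Little's law -/

section Little

variable {Ω : Type*} [mΩ : MeasurableSpace Ω] {P : Measure Ω}

open Classical in
/-- Expected number of customers present, integrated over `[0, T]`, when customer `n` arrives at
`A n` and stays for the time `S n`. -/
def timeIntegral (P : Measure Ω) (A S : ℕ → Ω → ℝ) (T : ℝ) : ℝ≥0∞ :=
  ∫⁻ t in Set.Icc 0 T, ∫⁻ ω, ∑' n : ℕ, (if A n ω ≤ t ∧ t < A n ω + S n ω then 1 else 0) ∂P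

/-- Tonelli: integrate over time first, so that each customer contributes the length of the part of
the sojourn inside [0, T]. -/
theorem timeIntegral_eq [SFinite P] {A S : ℕ → Ω → ℝ} (hA : ∀ n, Measurable (A n))
    (hS : ∀ n, Measurable (S n)) (T : ℝ) : timeIntegral P A S T =
      ∑' n, ∫⁻ ω, volume (Set.Ico (A n ω) (A n ω + S n ω) ∩ Set.Icc 0 T) ∂P := by
  classical
  have hm : ∀ n, Measurable (fun p : ℝ × Ω =>
      if A n p.2 ≤ p.1 ∧ p.1 < A n p.2 + S n p.2 then (1 : ℝ≥0∞) else 0) := by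
    intro n
    have h1 : Measurable fun p : ℝ × Ω => A n p.2 := (hA n).comp measurable_snd
    have h2 : Measurable fun p : ℝ × Ω => S n p.2 := (hS n).comp measurable_snd
    exact Measurable.ite ((measurableSet_le h1 measurable_fst).inter
      (measurableSet_lt measurable_fst (h1.add h2))) measurable_const measurable_const
  have h1 : ∀ t, ∫⁻ ω, ∑' n : ℕ,
      (if A n ω ≤ t ∧ t < A n ω + S n ω then (1 : ℝ≥0∞) else 0) ∂P =
      ∑' n : ℕ, ∫⁻ ω, (if A n ω ≤ t ∧ t < A n ω + S n ω then (1 : ℝ≥0∞) else 0) ∂P := fun t =>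
    lintegral_tsum fun n => ((hm n).comp measurable_prodMk_left).aemeasurable
  have h0 : timeIntegral P A S T = ∫⁻ t in Set.Icc 0 T, ∑' n : ℕ,
      ∫⁻ ω, (if A n ω ≤ t ∧ t < A n ω + S n ω then (1 : ℝ≥0∞) else 0) ∂P := by
    unfold timeIntegral
    refine lintegral_congr fun t => ?_
    rw [← h1 t]
  rw [h0, lintegral_tsum fun n => (hm n).lintegral_prod_right'.aemeasurable]
  refine tsum_congr fun n => ?_
  rw [lintegral_lintegral_swap (hm n).aemeasurable]
  refine lintegral_congr fun ω => ?_
  have : (fun t : ℝ => if A n ω ≤ t ∧ t < A n ω + S n ω then (1 : ℝ≥0∞) else 0) =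
      (Set.Ico (A n ω) (A n ω + S n ω)).indicator 1 := by
    funext t
    simp [Set.indicator_apply]
  rw [this, lintegral_indicator_one measurableSet_Ico, Measure.restrict_apply measurableSet_Ico]

/-- Moment bounds on arrival times `A` with mean inter-arrival time `β` and on sojourn times `S`
with long-run mean `s`. -/
structure SojournBounds (P : Measure Ω) (A S : ℕ → Ω → ℝ) (β s C : ℝ) : Prop where
  β_pos : 0 < β
  s_nonneg : 0 ≤ s
  C_nonneg : 0 ≤ C
  measurable_A : ∀ n, Measurable (A n)
  measurable_S : ∀ n, Measurable (S n)
  nonneg_A : ∀ n, ∀ᵐ ω ∂P, 0 ≤ A n ω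
  nonneg_S : ∀ n, ∀ᵐ ω ∂P, 0 ≤ S n ω
  integrable_sq : ∀ n, Integrable (fun ω => S n ω ^ 2) P
  sq_le : ∀ n, ∫ ω, S n ω ^ 2 ∂P ≤ C
  mean : ∀ N : ℕ, |∑ n ∈ Finset.range N, ∫ ω, S n ω ∂P - N * s| ≤ C
  integrable_var : ∀ n : ℕ, Integrable (fun ω => (A n ω - n * β) ^ 2) P
  var_le : ∀ n : ℕ, ∫ ω, (A n ω - n * β) ^ 2 ∂P ≤ C * n
  integrable_exp : ∀ r : ℝ, 0 ≤ r → ∀ n : ℕ, Integrable (fun ω => Real.exp (-r * A n ω)) P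
  exp_le : ∀ r : ℝ, 0 ≤ r → ∀ n : ℕ,
    ∫ ω, Real.exp (-r * A n ω) ∂P ≤ Real.exp (n * (-r * β + C * r ^ 2))

namespace SojournBounds

variable {A S : ℕ → Ω → ℝ} {β s C : ℝ}

/-- Contribution of a customer who is expected to arrive after time `T`. -/
theorem term_le_tail (h : SojournBounds P A S β s C) (n : ℕ) (T : ℝ) {r c : ℝ} (hr : 0 ≤ r)
    (hc : -r * β + 2 * C * r ^ 2 ≤ -c) :
    ∫⁻ ω, volume (Set.Ico (A n ω) (A n ω + S n ω) ∩ Set.Icc 0 T) ∂P ≤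
      ENNReal.ofReal ((C + 1) * Real.exp (r * T - n * c)) := by
  have hC := h.C_nonneg
  -- Weight in 2S ≤ κS² + 1/κ. With a Chernoff factor exp(2r(T - A)) ≥ 1 attached to 1/κ on the
  -- event A ≤ T, this κ makes the second expectation at most κ as well.
  set κ := Real.exp (r * T - n * c) with hκ
  have hκ0 : 0 < κ := Real.exp_pos _
  have i1 := h.integrable_sq n
  have i2 := h.integrable_exp (2 * r) (by positivity) n
  have hb : ∀ᵐ ω ∂P, volume (Set.Ico (A n ω) (A n ω + S n ω) ∩ Set.Icc 0 T) ≤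
      ENNReal.ofReal (κ * S n ω ^ 2 +
        κ⁻¹ * Real.exp (2 * r * T) * Real.exp (-(2 * r) * A n ω)) := by
    filter_upwards [h.nonneg_S n] with ω hS
    by_cases hAT : A n ω ≤ T
    · refine (measure_mono Set.inter_subset_left).trans ?_
      rw [Real.volume_Ico, add_sub_cancel_left]
      refine ENNReal.ofReal_le_ofReal ?_
      have e1 : κ⁻¹ * Real.exp (2 * r * T) * Real.exp (-(2 * r) * A n ω) =
          κ⁻¹ * Real.exp (2 * (r * (T - A n ω))) := by
        rw [mul_assoc, ← Real.exp_add]; congr 2; ring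
      have e2 : 1 ≤ Real.exp (2 * (r * (T - A n ω))) :=
        Real.one_le_exp (by have := sub_nonneg.2 hAT; positivity)
      rw [e1]
      have e3 : κ⁻¹ * 1 ≤ κ⁻¹ * Real.exp (2 * (r * (T - A n ω))) :=
        mul_le_mul_of_nonneg_left e2 (by positivity)
      have e4 : 0 ≤ κ * (S n ω - κ⁻¹) ^ 2 := by positivity
      have e5 : κ * (S n ω - κ⁻¹) ^ 2 = κ * S n ω ^ 2 - 2 * S n ω + κ⁻¹ := by
        field_simp; ring
      linarith
    · have : Set.Ico (A n ω) (A n ω + S n ω) ∩ Set.Icc 0 T = ∅ := by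
        ext t
        simp only [Set.mem_inter_iff, Set.mem_Ico, Set.mem_Icc, Set.mem_empty_iff_false,
          iff_false]
        rintro ⟨⟨h1, _⟩, _, h2⟩
        exact hAT (h1.trans h2)
      rw [this, measure_empty]
      exact zero_le
  refine (lintegral_mono_ae hb).trans ?_
  have i3 : Integrable (fun ω => κ * S n ω ^ 2 +
      κ⁻¹ * Real.exp (2 * r * T) * Real.exp (-(2 * r) * A n ω)) P :=
    (i1.const_mul _).add (i2.const_mul _)
  rw [← ofReal_integral_eq_lintegral_ofReal i3 (ae_of_all _ fun ω => by positivity)]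
  refine ENNReal.ofReal_le_ofReal ?_
  rw [integral_add (i1.const_mul _) (i2.const_mul _), integral_const_mul, integral_const_mul]
  have b1 := mul_le_mul_of_nonneg_left (h.sq_le n) hκ0.le
  have b2 : κ⁻¹ * Real.exp (2 * r * T) * ∫ ω, Real.exp (-(2 * r) * A n ω) ∂P ≤ κ := by
    have b3 := h.exp_le (2 * r) (by positivity) n
    have b4 : κ⁻¹ * Real.exp (2 * r * T) * Real.exp (n * (-(2 * r) * β + C * (2 * r) ^ 2)) ≤
        κ := by
      rw [hκ, ← Real.exp_neg, ← Real.exp_add, ← Real.exp_add]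
      refine Real.exp_le_exp.2 ?_
      have := mul_le_mul_of_nonneg_left hc (by positivity : (0 : ℝ) ≤ n)
      nlinarith
    exact (mul_le_mul_of_nonneg_left b3 (by positivity)).trans b4
  linarith

variable [IsProbabilityMeasure P]

theorem integrable_S (h : SojournBounds P A S β s C) (n : ℕ) : Integrable (S n) P :=
  ((memLp_two_iff_integrable_sq (h.measurable_S n).aestronglyMeasurable).2
    (h.integrable_sq n)).integrable one_le_two

theorem term_le_mean (h : SojournBounds P A S β s C) (n : ℕ) (T : ℝ) :
    ∫⁻ ω, volume (Set.Ico (A n ω) (A n ω + S n ω) ∩ Set.Icc 0 T) ∂P ≤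
      ENNReal.ofReal (∫ ω, S n ω ∂P) := by
  rw [ofReal_integral_eq_lintegral_ofReal (h.integrable_S n) (h.nonneg_S n)]
  refine lintegral_mono fun ω => ?_
  refine (measure_mono Set.inter_subset_left).trans ?_
  rw [Real.volume_Ico, add_sub_cancel_left]

/-- Contribution of a customer who is expected to leave before time `T`. -/
theorem le_term (h : SojournBounds P A S β s C) (n : ℕ) {T ε : ℝ} (hT : 0 < T) (hε : 0 < ε)
    (hn : n * β ≤ (1 - ε) * T) :
    ENNReal.ofReal (∫ ω, S n ω ∂P - (ε * C + 2 * C * (n + 1) / (ε ^ 3 * T ^ 2))) ≤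
      ∫⁻ ω, volume (Set.Ico (A n ω) (A n ω + S n ω) ∩ Set.Icc 0 T) ∂P := by
  have hC := h.C_nonneg
  -- Chosen so that `g` is nonpositive for a departure after T. Then A - nβ or S must be of order
  -- εT, so c((A - nβ)² + S²) ≥ 1/ε, while S ≤ εS² + 1/ε.
  set c := 2 / (ε ^ 3 * T ^ 2) with hc
  have hc0 : 0 < c := by positivity
  have i0 := h.integrable_S n
  have i1 := h.integrable_sq n
  have i2 := h.integrable_var n
  have i21 : Integrable (fun ω => (A n ω - n * β) ^ 2 + S n ω ^ 2) P := i2.add i1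
  have i3 : Integrable (fun ω => ε * S n ω ^ 2 +
      c * ((A n ω - n * β) ^ 2 + S n ω ^ 2)) P :=
    (i1.const_mul _).add (i21.const_mul _)
  set g : Ω → ℝ := fun ω => S n ω - (ε * S n ω ^ 2 +
      c * ((A n ω - n * β) ^ 2 + S n ω ^ 2)) with hg
  have ig : Integrable g P := i0.sub i3
  have hint : ∫ ω, S n ω ∂P - (ε * C + 2 * C * (n + 1) / (ε ^ 3 * T ^ 2)) ≤ ∫ ω, g ω ∂P := by
    rw [hg, integral_sub i0 i3, integral_add (i1.const_mul _) (i21.const_mul _),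
      integral_const_mul, integral_const_mul, integral_add i2 i1]
    have a1 := mul_le_mul_of_nonneg_left (h.sq_le n) hε.le
    have a2 := mul_le_mul_of_nonneg_left (add_le_add (h.var_le n) (h.sq_le n)) hc0.le
    have a3 : 2 * C * (n + 1) / (ε ^ 3 * T ^ 2) = c * (C * n + C) := by rw [hc]; ring
    rw [a3]
    linarith
  have hpos : ∫ ω, g ω ∂P ≤ ∫ ω, max (g ω) 0 ∂P :=
    integral_mono ig ig.pos_part fun ω => le_max_left _ _
  refine (ENNReal.ofReal_le_ofReal (hint.trans hpos)).trans ?_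
  rw [ofReal_integral_eq_lintegral_ofReal ig.pos_part (ae_of_all _ fun ω => le_max_right _ _)]
  refine lintegral_mono_ae ?_
  filter_upwards [h.nonneg_S n, h.nonneg_A n] with ω hS hA
  by_cases hD : A n ω + S n ω ≤ T
  · have : Set.Ico (A n ω) (A n ω + S n ω) ∩ Set.Icc 0 T = Set.Ico (A n ω) (A n ω + S n ω) :=
      Set.inter_eq_left.2 fun t ht => ⟨hA.trans ht.1, (ht.2.trans_le hD).le⟩
    rw [this, Real.volume_Ico, add_sub_cancel_left]
    refine ENNReal.ofReal_le_ofReal (max_le ?_ hS)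
    have : 0 ≤ ε * S n ω ^ 2 + c * ((A n ω - n * β) ^ 2 + S n ω ^ 2) := by positivity
    simp only [hg]
    linarith
  · have hle : g ω ≤ 0 := by
      have h1 : ε * T ≤ (A n ω - n * β) + S n ω := by
        have := not_le.1 hD
        nlinarith
      have h2 : (ε * T) ^ 2 ≤ ((A n ω - n * β) + S n ω) ^ 2 :=
        pow_le_pow_left₀ (by positivity) h1 2
      have h3 : (ε * T) ^ 2 ≤ 2 * ((A n ω - n * β) ^ 2 + S n ω ^ 2) := by
        nlinarith [sq_nonneg ((A n ω - n * β) - S n ω)]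
      have h4 : ε⁻¹ ≤ c * ((A n ω - n * β) ^ 2 + S n ω ^ 2) := by
        have : ε⁻¹ = 1 / (ε ^ 3 * T ^ 2) * (ε * T) ^ 2 := by field_simp
        rw [this, hc]
        calc 1 / (ε ^ 3 * T ^ 2) * (ε * T) ^ 2
            ≤ 1 / (ε ^ 3 * T ^ 2) * (2 * ((A n ω - n * β) ^ 2 + S n ω ^ 2)) :=
              mul_le_mul_of_nonneg_left h3 (by positivity)
          _ = _ := by ring
      have h5 : 0 ≤ ε * (S n ω - ε⁻¹) ^ 2 := by positivity
      have h6 : ε * (S n ω - ε⁻¹) ^ 2 = ε * S n ω ^ 2 - 2 * S n ω + ε⁻¹ := by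
        field_simp; ring
      simp only [hg]
      linarith
    rw [max_eq_right hle, ENNReal.ofReal_zero]
    exact zero_le

/-- Customers with index up to about (1 + ε)T/β contribute at most their mean sojourn times; the
later ones contribute a geometric series bounded in T. -/
theorem timeIntegral_le (h : SojournBounds P A S β s C) {ε : ℝ} (hε : 0 < ε) :
    ∃ D, 0 ≤ D ∧ ∀ T, 0 < T →
      timeIntegral P A S T ≤ ENNReal.ofReal ((1 + ε) * T * s / β + D) := by
  have hC := h.C_nonneg
  have hβ := h.β_pos
  have hs := h.s_nonneg
  -- The Chernoff rate r is small enough that -rβ + 2Cr² ≤ -c, and c is such that Nc ≥ rT as soon as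
  -- N ≥ (1 + ε)T/β. Using C + 1 avoids division by zero.
  obtain ⟨r, hr⟩ : ∃ r, r = β * ε / (2 * (C + 1) * (1 + ε)) := ⟨_, rfl⟩
  have hr0 : 0 < r := by rw [hr]; positivity
  obtain ⟨c, hc⟩ : ∃ c, c = r * β / (1 + ε) := ⟨_, rfl⟩
  have hc0 : 0 < c := by rw [hc]; positivity
  have hrc : -r * β + 2 * C * r ^ 2 ≤ -c := by
    have e1 : 2 * (C + 1) * r = β * ε / (1 + ε) := by rw [hr]; field_simp
    have e2 : c = r * β - r * (β * ε / (1 + ε)) := by rw [hc]; field_simp; ring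
    rw [e2, ← e1]
    nlinarith [sq_nonneg r]
  obtain ⟨p, hp⟩ : ∃ p, p = Real.exp (-c) := ⟨_, rfl⟩
  have hp0 : 0 < p := hp ▸ Real.exp_pos _
  have hp1 : p < 1 := hp ▸ Real.exp_lt_one_iff.2 (by linarith)
  have hp2 : 0 < 1 - p := by linarith
  refine ⟨s + C + (C + 1) / (1 - p), by positivity, fun T hT => ?_⟩
  rw [timeIntegral_eq h.measurable_A h.measurable_S]
  set a : ℕ → ℝ≥0∞ := fun n =>
    ∫⁻ ω, volume (Set.Ico (A n ω) (A n ω + S n ω) ∩ Set.Icc 0 T) ∂P with ha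
  obtain ⟨N, hN1, hN2⟩ : ∃ N : ℕ, (1 + ε) * T / β ≤ N ∧ (N : ℝ) < (1 + ε) * T / β + 1 :=
    ⟨_, Nat.le_ceil _, Nat.ceil_lt_add_one (by positivity)⟩
  have hsplit : ∑' n, a n = ∑ n ∈ Finset.range N, a n + ∑' n, a (n + N) :=
    (Summable.sum_add_tsum_nat_add' ENNReal.summable).symm
  have hS0 : ∀ n, 0 ≤ ∫ ω, S n ω ∂P := fun n => integral_nonneg_of_ae (h.nonneg_S n)
  have h1 : ∑ n ∈ Finset.range N, a n ≤ ENNReal.ofReal (N * s + C) := by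
    have h1' : ∑ n ∈ Finset.range N, a n ≤
        ∑ n ∈ Finset.range N, ENNReal.ofReal (∫ ω, S n ω ∂P) :=
      Finset.sum_le_sum fun n _ => h.term_le_mean n T
    refine h1'.trans ?_
    rw [← ENNReal.ofReal_sum_of_nonneg fun n _ => hS0 n]
    refine ENNReal.ofReal_le_ofReal ?_
    linarith [(abs_le.1 (h.mean N)).2]
  have h2 : ∑' n, a (n + N) ≤ ENNReal.ofReal ((C + 1) / (1 - p)) := by
    have hb : ∀ n, a (n + N) ≤ ENNReal.ofReal ((C + 1) * p ^ n) := by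
      intro n
      have hb' : a (n + N) ≤
          ENNReal.ofReal ((C + 1) * Real.exp (r * T - ((n + N : ℕ) : ℝ) * c)) :=
        h.term_le_tail (n + N) T hr0.le hrc
      refine hb'.trans (ENNReal.ofReal_le_ofReal ?_)
      refine mul_le_mul_of_nonneg_left ?_ (by positivity)
      rw [hp, ← Real.exp_nat_mul]
      refine Real.exp_le_exp.2 ?_
      have : r * T ≤ N * c := by
        have := mul_le_mul_of_nonneg_right hN1 hc0.le
        refine le_trans (le_of_eq ?_) this
        rw [hc]; field_simp
      push_cast
      linarith
    refine (ENNReal.tsum_le_tsum hb).trans ?_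
    rw [← ENNReal.ofReal_tsum_of_nonneg (fun n => by positivity)
      ((summable_geometric_of_lt_one hp0.le hp1).mul_left _), tsum_mul_left,
      tsum_geometric_of_lt_one hp0.le hp1]
    exact le_of_eq (by rw [div_eq_mul_inv])
  rw [hsplit]
  refine (add_le_add h1 h2).trans ?_
  rw [← ENNReal.ofReal_add (by positivity) (by positivity)]
  refine ENNReal.ofReal_le_ofReal ?_
  have := mul_le_mul_of_nonneg_right hN2.le hs
  have e1 : ((1 + ε) * T / β + 1) * s = (1 + ε) * T * s / β + s := by ring
  linarith

/-- Only customers with index below about (1 - ε)T/β are counted. The losses from `le_term`, summed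
over O(T) customers, amount to O(εT) plus a constant depending on ε. -/
theorem le_timeIntegral (h : SojournBounds P A S β s C) {ε : ℝ} (hε : 0 < ε) (hε1 : ε < 1) :
    ∃ D, 0 ≤ D ∧ ∀ T, 0 < T →
      ENNReal.ofReal ((1 - ε) * T * s / β - ε * C * T / β - D) ≤ timeIntegral P A S T := by
  have hC := h.C_nonneg
  have hβ := h.β_pos
  have hs := h.s_nonneg
  refine ⟨s + C + 2 * C / (ε ^ 3 * β ^ 2), by positivity, fun T hT => ?_⟩
  rw [timeIntegral_eq h.measurable_A h.measurable_S]
  have hε' : 0 < 1 - ε := by linarith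
  set a : ℕ → ℝ≥0∞ := fun n =>
    ∫⁻ ω, volume (Set.Ico (A n ω) (A n ω + S n ω) ∩ Set.Icc 0 T) ∂P with ha
  obtain ⟨N, hN1, hN2⟩ : ∃ N : ℕ, (N : ℝ) ≤ (1 - ε) * T / β ∧ (1 - ε) * T / β < N + 1 :=
    ⟨_, Nat.floor_le (by positivity), Nat.lt_floor_add_one _⟩
  refine le_trans ?_ (ENNReal.sum_le_tsum (Finset.range N))
  set d : ℝ := ε * C + 2 * C * N / (ε ^ 3 * T ^ 2) with hd
  have hterm : ∀ n ∈ Finset.range N, ENNReal.ofReal (∫ ω, S n ω ∂P - d) ≤ a n := by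
    intro n hn
    have hnN : (n : ℝ) + 1 ≤ N := by exact_mod_cast Finset.mem_range.1 hn
    refine le_trans (ENNReal.ofReal_le_ofReal ?_) (h.le_term n hT hε ?_)
    · have : 2 * C * ((n : ℝ) + 1) / (ε ^ 3 * T ^ 2) ≤ 2 * C * N / (ε ^ 3 * T ^ 2) := by gcongr
      rw [hd]; linarith
    · have := mul_le_mul_of_nonneg_right hN1 hβ.le
      rw [div_mul_cancel₀ _ hβ.ne'] at this
      nlinarith
  refine le_trans ?_ (Finset.sum_le_sum hterm)
  have hsum : ENNReal.ofReal (∑ n ∈ Finset.range N, (∫ ω, S n ω ∂P - d)) ≤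
      ∑ n ∈ Finset.range N, ENNReal.ofReal (∫ ω, S n ω ∂P - d) := by
    have : ∀ m : ℕ, ENNReal.ofReal (∑ n ∈ Finset.range m, (∫ ω, S n ω ∂P - d)) ≤
        ∑ n ∈ Finset.range m, ENNReal.ofReal (∫ ω, S n ω ∂P - d) := by
      intro m
      induction m with
      | zero => simp
      | succ m ih =>
        rw [Finset.sum_range_succ, Finset.sum_range_succ]
        exact ENNReal.ofReal_add_le.trans (add_le_add ih le_rfl)
    exact this N
  refine le_trans (ENNReal.ofReal_le_ofReal ?_) hsum
  rw [Finset.sum_sub_distrib, Finset.sum_const, Finset.card_range, nsmul_eq_mul]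
  have b1 := (abs_le.1 (h.mean N)).1
  have hNT : (N : ℝ) ≤ T / β := by
    refine hN1.trans (div_le_div_of_nonneg_right ?_ hβ.le); nlinarith
  have b2 : N * d ≤ ε * C * T / β + 2 * C / (ε ^ 3 * β ^ 2) := by
    have c1 : ε * C * N ≤ ε * C * (T / β) := mul_le_mul_of_nonneg_left hNT (by positivity)
    have c2 : 2 * C / (ε ^ 3 * T ^ 2) * (N : ℝ) ^ 2 ≤ 2 * C / (ε ^ 3 * T ^ 2) * (T / β) ^ 2 :=
      mul_le_mul_of_nonneg_left (pow_le_pow_left₀ (by positivity) hNT 2) (by positivity)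
    have c3 : 2 * C / (ε ^ 3 * T ^ 2) * (T / β) ^ 2 = 2 * C / (ε ^ 3 * β ^ 2) := by
      field_simp
    have c4 : N * d = ε * C * N + 2 * C / (ε ^ 3 * T ^ 2) * (N : ℝ) ^ 2 := by rw [hd]; ring
    rw [c4]
    have c5 : ε * C * (T / β) = ε * C * T / β := by ring
    linarith
  have b3 := mul_le_mul_of_nonneg_right hN2.le hs
  have b4 : (1 - ε) * T / β * s = (1 - ε) * T * s / β := by ring
  linarith

/-- Little's law for time averages. -/
theorem tendsto_average (h : SojournBounds P A S β s C) :
    Tendsto (fun T => (timeIntegral P A S T).toReal / T) atTop (𝓝 (s / β)) := by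
  have hC := h.C_nonneg
  have hβ := h.β_pos
  have hs := h.s_nonneg
  rw [Metric.tendsto_atTop]
  intro δ hδ
  set K := (s + C) / β with hK
  have hK0 : 0 ≤ K := by positivity
  obtain ⟨ε, hε, hε1, hεK⟩ : ∃ ε, 0 < ε ∧ ε < 1 ∧ ε * K < δ / 2 := by
    refine ⟨min (1 / 2) (δ / (4 * (K + 1))), by positivity, ?_, ?_⟩
    · exact (min_le_left _ _).trans_lt (by norm_num)
    · have h1 : min (1 / 2) (δ / (4 * (K + 1))) * K ≤ δ / (4 * (K + 1)) * K :=
        mul_le_mul_of_nonneg_right (min_le_right _ _) hK0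
      have h2 : δ / (4 * (K + 1)) * K ≤ δ / 4 := by
        rw [div_mul_eq_mul_div, div_le_div_iff₀ (by positivity) (by norm_num)]
        nlinarith
      linarith
  obtain ⟨D1, hD1, h1⟩ := h.timeIntegral_le hε
  obtain ⟨D2, hD2, h2⟩ := h.le_timeIntegral hε hε1
  set D := D1 + D2 with hD
  refine ⟨(2 * D + 1) / δ + 1, fun T hT => ?_⟩
  have hT0 : 0 < T := lt_of_lt_of_le (by positivity) hT
  have hDT : D < δ / 2 * T := by
    have : (2 * D + 1) / δ < T := by linarith
    rw [div_lt_iff₀ hδ] at this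
    linarith
  have u1 : (timeIntegral P A S T).toReal ≤ (1 + ε) * T * s / β + D1 :=
    ENNReal.toReal_le_of_le_ofReal (by positivity) (h1 T hT0)
  have u2 : (1 - ε) * T * s / β - ε * C * T / β - D2 ≤ (timeIntegral P A S T).toReal :=
    (ENNReal.ofReal_le_iff_le_toReal
      (ne_top_of_le_ne_top ENNReal.ofReal_ne_top (h1 T hT0))).1 (h2 T hT0)
  rw [Real.dist_eq, abs_lt]
  have eK : ε * K * T = ε * T * s / β + ε * C * T / β := by rw [hK]; ring
  have e1 : (1 + ε) * T * s / β = s / β * T + ε * T * s / β := by ring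
  have e2 : (1 - ε) * T * s / β = s / β * T - ε * T * s / β := by ring
  have e3 : 0 ≤ ε * C * T / β := by positivity
  have e4 : 0 ≤ ε * T * s / β := by positivity
  have hKT := mul_lt_mul_of_pos_right hεK hT0
  constructor
  · rw [lt_sub_iff_add_lt, lt_div_iff₀ hT0]
    have : (-δ + s / β) * T = -(δ * T) + s / β * T := by ring
    rw [this]
    linarith
  · rw [sub_lt_iff_lt_add, div_lt_iff₀ hT0]
    have : (δ + s / β) * T = δ * T + s / β * T := by ring
    rw [this]
    linarith

end SojournBounds

end Little

/-! ### Exponential moments and existence of a Lyapunov function -/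

section ExpMoments

variable {ν : Measure ℝ} {ε : ℝ}

theorem zero_mem_interior_integrableExpSet (h0 : ∀ᵐ v ∂ν, 0 ≤ v) (hε : 0 < ε)
    (h : Integrable (fun v => Real.exp (ε * v)) ν) :
    (0 : ℝ) ∈ interior (integrableExpSet id ν) := by
  refine mem_interior.2 ⟨Set.Iio ε, fun t ht => ?_, isOpen_Iio, hε⟩
  refine h.mono' (by fun_prop) ?_
  filter_upwards [h0] with v hv
  rw [Real.norm_eq_abs, abs_of_pos (Real.exp_pos _)]
  exact Real.exp_le_exp.2 (mul_le_mul_of_nonneg_right (le_of_lt ht) hv)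

theorem integrable_exp_of_le (h0 : ∀ᵐ v ∂ν, 0 ≤ v)
    (h : Integrable (fun v => Real.exp (ε * v)) ν) {t : ℝ} (ht : t ≤ ε) :
    Integrable (fun v => Real.exp (t * v)) ν := by
  refine h.mono' (by fun_prop) ?_
  filter_upwards [h0] with v hv
  rw [Real.norm_eq_abs, abs_of_pos (Real.exp_pos _)]
  exact Real.exp_le_exp.2 (mul_le_mul_of_nonneg_right ht hv)

end ExpMoments

section Existence

variable {νU νV : Measure ℝ} [IsProbabilityMeasure νU] [IsProbabilityMeasure νV] {ε : ℝ}

/-- A random walk with negative drift and exponential moments has exponential moments less than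
one. -/
theorem eventually_mgf_mul_lt_one (hU0 : ∀ᵐ u ∂νU, 0 ≤ u) (hV0 : ∀ᵐ v ∂νV, 0 ≤ v) (hε : 0 < ε)
    (hU : Integrable (fun u => Real.exp (ε * u)) νU)
    (hV : Integrable (fun v => Real.exp (ε * v)) νV) (mU : ∫ u, u ∂νU = 1) (mV : ∫ v, v ∂νV = 1)
    {a c : ℝ} (hac : a < c) :
    ∀ᶠ t in 𝓝[>] (0 : ℝ), mgf id νV (a * t) * mgf id νU (-c * t) < 1 := by
  have dU := hasDerivAt_mgf (zero_mem_interior_integrableExpSet hU0 hε hU)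
  have dV := hasDerivAt_mgf (zero_mem_interior_integrableExpSet hV0 hε hV)
  simp only [id_eq, zero_mul, Real.exp_zero, mul_one, mU, mV] at dU dV
  have la : HasDerivAt (fun t : ℝ => a * t) a 0 := by simpa using (hasDerivAt_id (0 : ℝ)).const_mul a
  have lc : HasDerivAt (fun t : ℝ => -c * t) (-c) 0 := by
    simpa using (hasDerivAt_id (0 : ℝ)).const_mul (-c)
  -- Both means are 1, so the product of the two moment generating functions has derivative a - c <
  -- 0 at the origin, where its value is 1.
  have dV' : HasDerivAt (fun t => mgf id νV (a * t)) (1 * a) 0 :=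
    HasDerivAt.comp (h₂ := mgf id νV) 0 (by simpa using dV) la
  have dU' : HasDerivAt (fun t => mgf id νU (-c * t)) (1 * -c) 0 :=
    HasDerivAt.comp (h₂ := mgf id νU) 0 (by simpa using dU) lc
  have d := dV'.mul dU'
  simp only [mul_zero, mgf_zero, one_mul, mul_one] at d
  have hs := (hasDerivAt_iff_tendsto_slope.1 d).mono_left
    (nhdsWithin_mono 0 fun t (ht : t ∈ Set.Ioi (0 : ℝ)) => ne_of_gt ht)
  have hneg : a + -c < 0 := by linarith
  filter_upwards [hs.eventually (gt_mem_nhds hneg), self_mem_nhdsWithin] with t ht ht0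
  rw [slope_def_field] at ht
  have ht0' : (0 : ℝ) < t := ht0
  simp only [Pi.mul_apply, mul_zero, mgf_zero, sub_zero, mul_one] at ht
  have := (div_lt_iff₀ ht0').1 ht
  linarith

/-- The gap β0 - α0 leaves room to give y a small weight σ = θs while keeping the drift negative.
All remaining requirements are upper bounds on θ. -/
theorem exists_envelope (hU0 : ∀ᵐ u ∂νU, 0 ≤ u) (hV0 : ∀ᵐ v ∂νV, 0 ≤ v) (hε : 0 < ε)
    (hU : Integrable (fun u => Real.exp (ε * u)) νU)
    (hV : Integrable (fun v => Real.exp (ε * v)) νV) (mU : ∫ u, u ∂νU = 1) (mV : ∫ v, v ∂νV = 1)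
    {b : ℝ≥0} (hb : νV ≤ b • (volume : Measure ℝ)) {αm α0 β0 β1 : ℝ} (h1 : 0 < αm)
    (h2 : αm ≤ α0) (h3 : α0 < β0) (h4 : β0 ≤ β1) :
    ∃ e : Envelope, e.Bounds νU νV ∧ e.αm = αm ∧ e.α0 = α0 ∧ e.β0 = β0 ∧ e.β1 = β1 := by
  have hα0 : 0 < α0 := h1.trans_le h2
  have hβ0 : 0 < β0 := hα0.trans h3
  have hβ1 : 0 < β1 := hβ0.trans_le h4
  -- Half of the stability gap is spent on the weight of y; the coefficient of u becomes θc with c =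
  -- (α0 + β0)/2 > α0.
  obtain ⟨s, hs⟩ : ∃ s, s = (β0 - α0) / (2 * β1) := ⟨_, rfl⟩
  have hs0 : 0 < s := by rw [hs]; exact div_pos (by linarith) (by positivity)
  have hsβ : s * β1 = (β0 - α0) / 2 := by rw [hs]; field_simp
  obtain ⟨c, hc⟩ : ∃ c, c = β0 - s * β1 := ⟨_, rfl⟩
  have hc' : α0 < c := by rw [hc, hsβ]; linarith
  have hc0 : 0 < c := hα0.trans hc'
  obtain ⟨t0, ht0, hlt⟩ := (eventually_mgf_mul_lt_one hU0 hV0 hε hU hV mU mV hc').exists_mem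
  obtain ⟨t1, ht1, hsub⟩ := mem_nhdsGT_iff_exists_Ioo_subset.1 ht0
  have ht1' : 0 < t1 := ht1
  obtain ⟨rt, hrt⟩ : ∃ rt, rt = α0 * (β1 / αm) + s * β1 := ⟨_, rfl⟩
  have hrt0 : 0 < rt := by rw [hrt]; positivity
  -- The three bounds serve, in order, the drift for exponents kθ with k ≤ 4, the moment `E` (half
  -- of ε is kept for the factor 1 + u), and integrability in the service input.
  obtain ⟨θ, hθ, hθ1, hθ2, hθ3⟩ : ∃ θ, 0 < θ ∧ 4 * θ < t1 ∧ rt * θ ≤ ε / 2 ∧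
      4 * (α0 * θ) ≤ ε := by
    refine ⟨min (t1 / 8) (min (ε / 2 / rt) (ε / (4 * α0))), by positivity, ?_, ?_, ?_⟩
    · linarith [min_le_left (t1 / 8) (min (ε / 2 / rt) (ε / (4 * α0)))]
    · have := (min_le_right (t1 / 8) (min (ε / 2 / rt) (ε / (4 * α0)))).trans (min_le_left _ _)
      rw [le_div_iff₀ hrt0] at this
      linarith
    · have := (min_le_right (t1 / 8) (min (ε / 2 / rt) (ε / (4 * α0)))).trans (min_le_right _ _)
      rw [le_div_iff₀ (by positivity)] at this
      linarith
  obtain ⟨g, hg⟩ : ∃ g : ℕ → ℝ, g = fun k : ℕ =>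
    mgf id νV (α0 * (k * θ)) * mgf id νU (-c * (k * θ)) := ⟨_, rfl⟩
  have hg1 : ∀ k : ℕ, 1 ≤ k → k ≤ 4 → g k < 1 := by
    intro k hk1 hk4
    have a1 : (1 : ℝ) ≤ k := by exact_mod_cast hk1
    have a4 : (k : ℝ) ≤ 4 := by exact_mod_cast hk4
    rw [hg]
    exact hlt _ (hsub ⟨by positivity, by nlinarith⟩)
  have hg0 : ∀ k, 0 ≤ g k := fun k => by rw [hg]; exact mul_nonneg mgf_nonneg mgf_nonneg
  obtain ⟨ρ, hρ⟩ : ∃ ρ, ρ = max (max (g 1) (g 2)) (max (g 3) (g 4)) := ⟨_, rfl⟩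
  have hgρ : ∀ k : ℕ, 1 ≤ k → k ≤ 4 → g k ≤ ρ := by
    intro k hk1 hk4
    rw [hρ]
    interval_cases k <;> simp
  have hexpU : ∀ k : ℕ, Integrable (fun u => Real.exp (-c * (k * θ) * u)) νU := fun k =>
    integrable_exp_of_le hU0 hU (by
      have : 0 ≤ c * (k * θ) := by positivity
      linarith)
  have hexpV : ∀ k : ℕ, k ≤ 4 → Integrable (fun v => Real.exp (α0 * (k * θ) * v)) νV :=
    fun k hk => integrable_exp_of_le hV0 hV (by
      have : (k : ℝ) ≤ 4 := by exact_mod_cast hk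
      have : (k : ℝ) * (α0 * θ) ≤ 4 * (α0 * θ) := mul_le_mul_of_nonneg_right this (by positivity)
      linarith)
  have hincr : ∀ k : ℕ, ∀ z : ℝ × ℝ, Real.exp (k * (θ * α0 * z.2 - (θ * β0 - θ * s * β1) * z.1)) =
      Real.exp (-c * (k * θ) * z.1) * Real.exp (α0 * (k * θ) * z.2) := by
    intro k z
    rw [← Real.exp_add, hc]
    congr 1
    ring
  have hprod : ∀ k : ℕ, k ≤ 4 → Integrable (fun z : ℝ × ℝ =>
      Real.exp (k * (θ * α0 * z.2 - (θ * β0 - θ * s * β1) * z.1))) (νU.prod νV) := by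
    intro k hk
    simp only [hincr]
    exact (hexpU k).mul_prod (hexpV k hk)
  have hdrift : ∀ k : ℕ, 1 ≤ k → k ≤ 4 → ∫⁻ z : ℝ × ℝ, ENNReal.ofReal
      (Real.exp (k * (θ * α0 * z.2 - (θ * β0 - θ * s * β1) * z.1))) ∂(νU.prod νV) ≤
      ENNReal.ofReal ρ := by
    intro k hk1 hk4
    rw [← ofReal_integral_eq_lintegral_ofReal (hprod k hk4)
      (ae_of_all _ fun z => (Real.exp_pos _).le)]
    refine ENNReal.ofReal_le_ofReal (le_trans (le_of_eq ?_) (hgρ k hk1 hk4))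
    simp only [hincr]
    rw [integral_prod_mul (fun u : ℝ => Real.exp (-c * (k * θ) * u))
      (fun v : ℝ => Real.exp (α0 * (k * θ) * v)), hg, mul_comm]
    rfl
  have i0U := zero_mem_interior_integrableExpSet hU0 hε hU
  have i0V := zero_mem_interior_integrableExpSet hV0 hε hV
  have sqU : Integrable (fun u : ℝ => u ^ 2) νU :=
    integrable_pow_of_mem_interior_integrableExpSet i0U 2
  have sqV : Integrable (fun u : ℝ => u ^ 2) νV :=
    integrable_pow_of_mem_interior_integrableExpSet i0V 2
  have hDfin : ∫⁻ z : ℝ × ℝ, ENNReal.ofReal ((z.1 + z.2) *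
      Real.exp (2 * (θ * α0 * z.2 - (θ * β0 - θ * s * β1) * z.1))) ∂(νU.prod νV) ≠ ⊤ := by
    -- AM-GM separates the linear factor from exp(2·incr), whose square is the integrable
    -- exponential with k = 4.
    have hdom : Integrable (fun z : ℝ × ℝ => 2 * z.1 ^ 2 + 2 * z.2 ^ 2 +
        Real.exp ((4 : ℕ) * (θ * α0 * z.2 - (θ * β0 - θ * s * β1) * z.1))) (νU.prod νV) :=
      (((sqU.comp_fst νV).const_mul 2).add ((sqV.comp_snd νU).const_mul 2)).add
        (hprod 4 le_rfl)
    refine ne_top_of_le_ne_top hdom.lintegral_lt_top.ne (lintegral_mono fun z =>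
      ENNReal.ofReal_le_ofReal ?_)
    have e4 : Real.exp ((4 : ℕ) * (θ * α0 * z.2 - (θ * β0 - θ * s * β1) * z.1)) =
        Real.exp (2 * (θ * α0 * z.2 - (θ * β0 - θ * s * β1) * z.1)) ^ 2 := by
      rw [← Real.exp_nat_mul]; congr 1; push_cast; ring
    rw [e4]
    generalize Real.exp (2 * (θ * α0 * z.2 - (θ * β0 - θ * s * β1) * z.1)) = E
    nlinarith [sq_nonneg (z.1 + z.2 - E), sq_nonneg (z.1 - z.2), sq_nonneg (z.1 + z.2),
      sq_nonneg E]
  have hEfin : ∫⁻ u : ℝ, ENNReal.ofReal ((1 + u) *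
      Real.exp ((θ * α0 * (β1 / αm) + θ * s * β1) * u)) ∂νU ≠ ⊤ := by
    refine ne_top_of_le_ne_top (hU.const_mul (2 / ε + 1)).lintegral_lt_top.ne
      (lintegral_mono_ae ?_)
    filter_upwards [hU0] with u hu
    refine ENNReal.ofReal_le_ofReal ?_
    have x1 : (θ * α0 * (β1 / αm) + θ * s * β1) * u ≤ ε / 2 * u := by
      refine mul_le_mul_of_nonneg_right ?_ hu
      rw [hrt] at hθ2
      linarith
    have x2 : 1 + u ≤ (2 / ε + 1) * Real.exp (ε / 2 * u) := by
      have y1 := Real.add_one_le_exp (ε / 2 * u)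
      have y2 : (2 / ε + 1) * (ε / 2 * u + 1) ≤ (2 / ε + 1) * Real.exp (ε / 2 * u) :=
        mul_le_mul_of_nonneg_left y1 (by positivity)
      have y3 : (2 / ε + 1) * (ε / 2 * u + 1) = u + 2 / ε + ε / 2 * u + 1 := by
        field_simp; ring
      have y4 : 0 ≤ 2 / ε + ε / 2 * u := by positivity
      linarith
    have x3 : Real.exp (ε * u) = Real.exp (ε / 2 * u) * Real.exp (ε / 2 * u) := by
      rw [← Real.exp_add]; congr 1; ring
    rw [x3, ← mul_assoc]
    exact mul_le_mul x2 (Real.exp_le_exp.2 x1) (Real.exp_pos _).le (by positivity)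
  refine ⟨⟨αm, α0, β0, β1, θ, θ * s, ρ,
    (∫⁻ z : ℝ × ℝ, ENNReal.ofReal ((z.1 + z.2) *
      Real.exp (2 * (θ * α0 * z.2 - (θ * β0 - θ * s * β1) * z.1))) ∂(νU.prod νV)).toReal,
    (∫⁻ u : ℝ, ENNReal.ofReal ((1 + u) *
      Real.exp ((θ * α0 * (β1 / αm) + θ * s * β1) * u)) ∂νU).toReal, b⟩, ?_, rfl, rfl, rfl, rfl⟩
  exact
    { αm_pos := h1
      αm_le := h2
      β0_pos := hβ0
      β0_le := h4
      θ_pos := hθ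
      σ_pos := mul_pos hθ hs0
      ρ_nonneg := (hg0 1).trans (hgρ 1 le_rfl (by norm_num))
      ρ_lt_one := by
        rw [hρ]
        exact max_lt (max_lt (hg1 1 (by norm_num) (by norm_num)) (hg1 2 (by norm_num)
          (by norm_num))) (max_lt (hg1 3 (by norm_num) (by norm_num)) (hg1 4 (by norm_num)
          (by norm_num)))
      D_nonneg := ENNReal.toReal_nonneg
      E_nonneg := ENNReal.toReal_nonneg
      nonneg_U := hU0
      nonneg_V := hV0
      drift := hdrift
      drift_mul := (ENNReal.ofReal_toReal hDfin).ge
      window := (ENNReal.ofReal_toReal hEfin).ge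
      density := hb }

end Existence

/-! ### Little's law for the queue with fixed parameters -/

/-- Inversion of the quadratic lower bound for exp x, since (1 - x + x²/2)(1 + x + x²/2) = 1 + x⁴/4.
-/
theorem exp_neg_le_quadratic {x : ℝ} (hx : 0 ≤ x) : Real.exp (-x) ≤ 1 - x + x ^ 2 / 2 := by
  have h1 := Real.quadratic_le_exp_of_nonneg hx
  have h2 : 0 < 1 - x + x ^ 2 / 2 := by nlinarith [sq_nonneg (x - 1)]
  rw [Real.exp_neg, inv_le_iff_one_le_mul₀ (Real.exp_pos _)]
  have h3 := mul_le_mul_of_nonneg_left h1 h2.le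
  nlinarith [sq_nonneg (x ^ 2)]

section Queue

variable {Ω : Type*} [mΩ : MeasurableSpace Ω] {P : Measure Ω} [IsProbabilityMeasure P]
  {U V : ℕ → Ω → ℝ} {e : Envelope}

/-- Sojourn is waiting plus service. Second moments come from `lyap 2`, long-run means from the
telescoped Poisson equation, the variance of arrival times from independence, and their Laplace
transform from `exp_neg_le_quadratic` applied to each factor. -/
theorem sojournBounds_queue (hUV : DrivingSequences P U V)
    (h : e.Bounds (P.map (U 0)) (P.map (V 0))) (hU2 : MemLp (U 0) 2 P) (hV2 : MemLp (V 0) 2 P)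
    {q : ℝ × ℝ} (hq : q ∈ e.rect) :
    ∃ C, SojournBounds P (fun n ω => ∑ k ∈ Finset.range n, U k ω * q.2)
      (fun n ω => (fixedChain U V q n ω).1 + V n ω * q.1) q.2
      (statMean (drivingLaw P U V) Prod.fst q + q.1) C := by
  have : IsProbabilityMeasure (P.map (U 0)) :=
    Measure.isProbabilityMeasure_map (hUV.measurable_U 0).aemeasurable
  have : IsProbabilityMeasure (P.map (V 0)) :=
    Measure.isProbabilityMeasure_map (hUV.measurable_V 0).aemeasurable
  have hc := controlledChain_fixed (e := e) hUV hq
  have hα : 0 < q.1 := h.αm_pos.trans_le hq.1.1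
  have hβ : 0 < q.2 := h.β0_pos.trans_le hq.2.1
  have hθ := h.θ_pos
  have hρ : 0 < 1 - e.ρ := by linarith [h.ρ_lt_one]
  have hUn : ∀ n, MemLp (U n) 2 P := fun n => ((hUV.ident_U n).memLp_iff).2 hU2
  have hVn : ∀ n, MemLp (V n) 2 P := fun n => ((hUV.ident_V n).memLp_iff).2 hV2
  have hmU : ∀ n, ∫ ω, U n ω ∂P = 1 := fun n =>
    (hUV.ident_U n).integral_eq.trans hUV.mean_U
  have hmV : ∀ n, ∫ ω, V n ω ∂P = 1 := fun n =>
    (hUV.ident_V n).integral_eq.trans hUV.mean_V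
  have hV2n : ∀ n, ∫ ω, V n ω ^ 2 ∂P = ∫ ω, V 0 ω ^ 2 ∂P := fun n =>
    ((hUV.ident_V n).comp (measurable_id.pow_const 2)).integral_eq
  have iW : ∀ n, Integrable (fun ω => (fixedChain U V q n ω).1) P := by
    intro n
    refine hc.integrable_of_le_lyap h n (k := 1) le_rfl (by norm_num)
      (hc.measurable_state n).fst (C := 1 / e.θ) fun ω hω => ?_
    rw [abs_of_nonneg hω.1]
    exact (isCost_fst h).le _ hω
  have bW2 : ∀ n, ∀ ω, fixedChain U V q n ω ∈ quadrant →
      |(fixedChain U V q n ω).1 ^ 2| ≤ (1 / e.θ) ^ 2 * e.lyap 2 (fixedChain U V q n ω) := by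
    intro n ω hω
    have h1 := (isCost_fst h).le _ hω
    have h2 : e.lyap 2 (fixedChain U V q n ω) = e.lyap 1 (fixedChain U V q n ω) ^ 2 := by
      rw [Envelope.lyap, Envelope.lyap, ← Real.exp_nat_mul]; push_cast; ring_nf
    rw [abs_of_nonneg (sq_nonneg _), h2, ← mul_pow]
    exact pow_le_pow_left₀ hω.1 h1 2
  have iW2 : ∀ n, Integrable (fun ω => (fixedChain U V q n ω).1 ^ 2) P := fun n =>
    hc.integrable_of_le_lyap h n (by norm_num) (by norm_num)
      ((hc.measurable_state n).fst.pow_const 2) (bW2 n)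
  have lW2 : ∀ n, ∫ ω, (fixedChain U V q n ω).1 ^ 2 ∂P ≤ (1 / e.θ) ^ 2 * (1 / (1 - e.ρ)) :=
    fun n => (le_abs_self _).trans
      (hc.abs_integral_le_of_le_lyap h n (by norm_num) (by norm_num) (by positivity) (bW2 n))
  have mS : ∀ n, Measurable fun ω => (fixedChain U V q n ω).1 + V n ω * q.1 := fun n =>
    (hc.measurable_state n).fst.add ((hUV.measurable_V n).mul_const _)
  have mA : ∀ n, Measurable fun ω => ∑ k ∈ Finset.range n, U k ω * q.2 := fun n =>
    Finset.measurable_fun_sum _ fun k _ => (hUV.measurable_U k).mul_const _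
  have iS2 : ∀ n, Integrable (fun ω => 2 * (fixedChain U V q n ω).1 ^ 2 +
      2 * q.1 ^ 2 * V n ω ^ 2) P := fun n =>
    ((iW2 n).const_mul 2).add ((hVn n).integrable_sq.const_mul _)
  have bS : ∀ n ω, ((fixedChain U V q n ω).1 + V n ω * q.1) ^ 2 ≤
      2 * (fixedChain U V q n ω).1 ^ 2 + 2 * q.1 ^ 2 * V n ω ^ 2 := by
    intro n ω
    nlinarith [sq_nonneg ((fixedChain U V q n ω).1 - V n ω * q.1)]
  have iSS : ∀ n, Integrable (fun ω => ((fixedChain U V q n ω).1 + V n ω * q.1) ^ 2) P :=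
    fun n => (iS2 n).mono' ((mS n).pow_const 2).aestronglyMeasurable
      (ae_of_all _ fun ω => by
        rw [Real.norm_eq_abs, abs_of_nonneg (sq_nonneg _)]; exact bS n ω)
  obtain ⟨C1, hC1, hmean⟩ := abs_sum_sub_statMean_le hUV h (by positivity) (isCost_fst h) hq
  set v := Var[U 0; P] with hv
  have hv0 : 0 ≤ v := variance_nonneg _ _
  set m2 := ∫ ω, U 0 ω ^ 2 ∂P with hm2
  have hm20 : 0 ≤ m2 := integral_nonneg fun ω => sq_nonneg _
  have hV20 : 0 ≤ ∫ ω, V 0 ω ^ 2 ∂P := integral_nonneg fun ω => sq_nonneg _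
  -- A sum of nonnegative constants, one for each bound, so that every bound holds with the common
  -- C.
  set C := C1 + (2 * ((1 / e.θ) ^ 2 * (1 / (1 - e.ρ))) + 2 * q.1 ^ 2 * ∫ ω, V 0 ω ^ 2 ∂P) +
    q.2 ^ 2 * v + q.2 ^ 2 * m2 with hC
  have p1 : 0 ≤ 2 * ((1 / e.θ) ^ 2 * (1 / (1 - e.ρ))) + 2 * q.1 ^ 2 * ∫ ω, V 0 ω ^ 2 ∂P := by
    positivity
  have p2 : 0 ≤ q.2 ^ 2 * v := by positivity
  have p3 : 0 ≤ q.2 ^ 2 * m2 := by positivity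
  have hindU : iIndepFun U P := iIndepFun.precomp (g := Sum.inl) Sum.inl_injective hUV.indep
  have hAeq : ∀ n : ℕ, (fun ω => (∑ k ∈ Finset.range n, U k ω * q.2 - n * q.2) ^ 2) =
      fun ω => q.2 ^ 2 * ((∑ k ∈ Finset.range n, U k) ω - n) ^ 2 := by
    intro n
    funext ω
    rw [Finset.sum_apply, ← Finset.sum_mul]
    ring
  have hsumLp : ∀ n : ℕ, MemLp (∑ k ∈ Finset.range n, U k) 2 P := fun n =>
    memLp_finsetSum' _ fun k _ => hUn k
  have hsumMean : ∀ n : ℕ, ∫ ω, (∑ k ∈ Finset.range n, U k) ω ∂P = n := by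
    intro n
    simp only [Finset.sum_apply]
    rw [integral_finsetSum _ fun k _ => (hUn k).integrable one_le_two]
    simp [hmU]
  have hnU : ∀ᵐ ω ∂P, ∀ n, 0 ≤ U n ω := ae_all_iff.2 hUV.nonneg_U
  have hexpint : ∀ t : ℝ, t ≤ 0 → ∀ k, Integrable (fun ω => Real.exp (t * U k ω)) P := by
    intro t ht k
    refine (integrable_const (1 : ℝ)).mono' ((hUV.measurable_U k).const_mul t).exp.aestronglyMeasurable ?_
    filter_upwards [hnU] with ω hω
    rw [Real.norm_eq_abs, abs_of_pos (Real.exp_pos _)]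
    exact Real.exp_le_one_iff.2 (mul_nonpos_of_nonpos_of_nonneg ht (hω k))
  have hexpeq : ∀ r : ℝ, ∀ n : ℕ, (fun ω => Real.exp (-r * ∑ k ∈ Finset.range n, U k ω * q.2)) =
      fun ω => Real.exp ((-r * q.2) * (∑ k ∈ Finset.range n, U k) ω) := by
    intro r n
    funext ω
    rw [Finset.sum_apply, ← Finset.sum_mul]
    congr 1
    ring
  refine ⟨C, hβ, add_nonneg (statMean_nonneg _ _) hα.le, by linarith, mA, mS, ?_, ?_, iSS, ?_, ?_,
    ?_, ?_, ?_, ?_⟩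
  · intro n
    filter_upwards [hnU] with ω hω
    exact Finset.sum_nonneg fun k _ => mul_nonneg (hω k) hβ.le
  · intro n
    filter_upwards [hUV.nonneg_V n, hc.ae_mem_quadrant h] with ω hω hx
    have := (hx n).1
    positivity
  · intro n
    have b1 := integral_mono (iSS n) (iS2 n) (bS n)
    rw [integral_add ((iW2 n).const_mul 2) ((hVn n).integrable_sq.const_mul _),
      integral_const_mul, integral_const_mul, hV2n] at b1
    have := lW2 n
    linarith
  · intro N
    have e1 : ∀ n, ∫ ω, ((fixedChain U V q n ω).1 + V n ω * q.1) ∂P =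
        ∫ ω, (fixedChain U V q n ω).1 ∂P + q.1 := by
      intro n
      rw [integral_add (iW n) (((hVn n).integrable one_le_two).mul_const _), integral_mul_const,
        hmV, one_mul]
    simp only [e1]
    rw [Finset.sum_add_distrib, Finset.sum_const, Finset.card_range, nsmul_eq_mul, mul_add,
      add_sub_add_right_eq_sub]
    exact (hmean N).trans (by linarith)
  · intro n
    rw [hAeq]
    exact (((hsumLp n).sub (memLp_const (n : ℝ))).integrable_sq).const_mul _
  · intro n
    rw [hAeq, integral_const_mul]
    have e1 : Var[∑ k ∈ Finset.range n, U k; P] = n * v := by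
      rw [IndepFun.variance_sum (fun k _ => hUn k)
        (fun i _ j _ hij => hindU.indepFun hij)]
      simp [hv, (hUV.ident_U _).variance_eq]
    rw [variance_eq_integral (hsumLp n).aestronglyMeasurable.aemeasurable, hsumMean] at e1
    rw [e1]
    have : q.2 ^ 2 * (n * v) = q.2 ^ 2 * v * n := by ring
    rw [this]
    exact mul_le_mul_of_nonneg_right (by linarith) (by positivity)
  · intro r hr n
    rw [hexpeq]
    exact hindU.integrable_exp_mul_sum hUV.measurable_U
      fun k _ => hexpint _ (by have : 0 ≤ r * q.2 := by positivity
                               linarith) k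
  · intro r hr n
    rw [hexpeq]
    have e1 := hindU.mgf_sum hUV.measurable_U (Finset.range n) (t := -r * q.2)
    change mgf _ _ _ ≤ _
    rw [e1]
    have e2 : ∀ k, mgf (U k) P (-r * q.2) ≤ Real.exp (-r * q.2 + C * r ^ 2) := by
      intro k
      rw [mgf_congr_of_identDistrib (U k) (U 0) (hUV.ident_U k)]
      have iU := hU2.integrable one_le_two
      have iU2 := hU2.integrable_sq
      have i12 : Integrable (fun ω => 1 - r * q.2 * U 0 ω) P :=
        (integrable_const 1).sub (iU.const_mul _)
      have b1 : mgf (U 0) P (-r * q.2) ≤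
          ∫ ω, (1 - r * q.2 * U 0 ω + (r * q.2) ^ 2 / 2 * U 0 ω ^ 2) ∂P := by
        have hrq : 0 ≤ r * q.2 := by positivity
        refine integral_mono_ae (hexpint _ (by linarith) 0)
          (i12.add (iU2.const_mul _)) ?_
        filter_upwards [hnU] with ω hω
        have := exp_neg_le_quadratic (mul_nonneg hrq (hω 0))
        have e3 : -r * q.2 * U 0 ω = -(r * q.2 * U 0 ω) := by ring
        rw [e3]
        refine this.trans (le_of_eq (by ring))
      rw [integral_add i12 (iU2.const_mul _),
        integral_sub (integrable_const 1) (iU.const_mul _), integral_const_mul,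
        integral_const_mul, hUV.mean_U] at b1
      simp only [integral_const, probReal_univ, smul_eq_mul, mul_one] at b1
      have b2 := Real.add_one_le_exp (-r * q.2 + C * r ^ 2)
      have b3 : (r * q.2) ^ 2 / 2 * m2 ≤ C * r ^ 2 := by
        have : q.2 ^ 2 * m2 * r ^ 2 ≤ C * r ^ 2 :=
          mul_le_mul_of_nonneg_right (by linarith) (sq_nonneg r)
        have : 0 ≤ q.2 ^ 2 * m2 * r ^ 2 := by positivity
        nlinarith
      linarith
    refine (Finset.prod_le_prod (fun k _ => mgf_nonneg) fun k _ => e2 k).trans ?_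
    rw [Finset.prod_const, Finset.card_range, ← Real.exp_nat_mul]

end Queue

/-! ### The feasible box -/

namespace Problem

variable {M : Problem} {θ ϑ : Param}

/-- Mean service and inter-arrival times under the parameter `ϑ`. -/
def means (M : Problem) (ϑ : Param) : ℝ × ℝ := (1 / ϑ 0, 1 / M.lam (ϑ 1))

/-- Coordinate projections are open maps. In particular an interior minimizer forces both intervals
to be nondegenerate. -/
theorem mem_Ioo_of_mem_interior (hθ : θ ∈ interior M.box) :
    θ 0 ∈ Set.Ioo M.μlo M.μhi ∧ θ 1 ∈ Set.Ioo M.plo M.phi := by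
  have hopen : ∀ i : Fin 2, IsOpenMap (EuclideanSpace.proj i : Param →L[ℝ] ℝ) := fun i =>
    (EuclideanSpace.proj i : Param →L[ℝ] ℝ).isOpenMap
      fun r => ⟨EuclideanSpace.single i r, by simp⟩
  rw [← interior_Icc, ← interior_Icc]
  refine ⟨interior_mono ?_ ((hopen 0).image_interior_subset _ ⟨θ, hθ, rfl⟩),
    interior_mono ?_ ((hopen 1).image_interior_subset _ ⟨θ, hθ, rfl⟩)⟩
  · rintro _ ⟨x, hx, rfl⟩
    exact hx.1
  · rintro _ ⟨x, hx, rfl⟩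
    exact hx.2

theorem convex_box : Convex ℝ M.box := by
  intro x hx y hy a b ha hb hab
  exact ⟨convex_Icc _ _ hx.1 hy.1 ha hb hab, convex_Icc _ _ hx.2 hy.2 ha hb hab⟩

end Problem

/-! ### The gradient of the objective -/

theorem waiting_eq_fixedChain {Ω : Type*} (M : Problem) (U V : ℕ → Ω → ℝ) (ϑ : Param) (n : ℕ) (ω : Ω) :
    waiting M U V ϑ n ω = (fixedChain U V (M.means ϑ) n ω).1 := by
  induction n with
  | zero => rfl
  | succ n ih => simp [waiting, fixedChain, rateStep, ih, Problem.means, div_eq_mul_inv]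

section Objective

variable {Ω : Type*} [mΩ : MeasurableSpace Ω] {P : Measure Ω} [IsProbabilityMeasure P]
  {U V : ℕ → Ω → ℝ} {e : Envelope} {M : Problem} {ϑ : Param}

theorem steadyQueueLength_eq (hUV : DrivingSequences P U V)
    (h : e.Bounds (P.map (U 0)) (P.map (V 0))) (hU2 : MemLp (U 0) 2 P) (hV2 : MemLp (V 0) 2 P)
    (hq : M.means ϑ ∈ e.rect) :
    steadyQueueLength M P U V ϑ =
      M.lam (ϑ 1) * (statMean (drivingLaw P U V) Prod.fst (M.means ϑ) + 1 / ϑ 0) := by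
  obtain ⟨C, hC⟩ := sojournBounds_queue hUV h hU2 hV2 hq
  have h1 : avgQueueLength M P U V ϑ = fun T => (timeIntegral P
      (fun n ω => ∑ k ∈ Finset.range n, U k ω * (M.means ϑ).2)
      (fun n ω => (fixedChain U V (M.means ϑ) n ω).1 + V n ω * (M.means ϑ).1) T).toReal / T := by
    funext T
    simp only [avgQueueLength, timeIntegral, queueLength, departure, arrival,
      waiting_eq_fixedChain, Problem.means, div_eq_mul_inv, one_mul, add_assoc]
  rw [steadyQueueLength, h1, hC.tendsto_average.limUnder_eq]
  simp [Problem.means, div_eq_mul_inv, mul_comm]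

/-- Additivity is read off from the time averages by uniqueness of limits. -/
theorem statMean_add (hUV : DrivingSequences P U V)
    (h : e.Bounds (P.map (U 0)) (P.map (V 0))) {φ φ' : State → ℝ} {K K' : ℝ} (hK : 0 ≤ K)
    (hK' : 0 ≤ K') (hφ : IsCost e φ K) (hφ' : IsCost e φ' K')
    (hs : IsCost e (fun x => φ x + φ' x) (K + K')) {q : ℝ × ℝ} (hq : q ∈ e.rect) :
    statMean (drivingLaw P U V) (fun x => φ x + φ' x) q =
      statMean (drivingLaw P U V) φ q + statMean (drivingLaw P U V) φ' q := by
  have : IsProbabilityMeasure (P.map (U 0)) :=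
    Measure.isProbabilityMeasure_map (hUV.measurable_U 0).aemeasurable
  have : IsProbabilityMeasure (P.map (V 0)) :=
    Measure.isProbabilityMeasure_map (hUV.measurable_V 0).aemeasurable
  have hc := controlledChain_fixed (e := e) hUV hq
  have hi : ∀ {φ : State → ℝ} {K : ℝ}, IsCost e φ K → ∀ n,
      Integrable (fun ω => φ (fixedChain U V q n ω)) P := by
    intro φ K hφ n
    refine hc.integrable_of_le_lyap h n (k := 1) le_rfl (by norm_num)
      (hφ.measurable.comp (hc.measurable_state n)) (C := K) fun ω hω => ?_
    rw [abs_of_nonneg (hφ.nonneg _ hω)]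
    exact hφ.le _ hω
  refine tendsto_nhds_unique (tendsto_average hUV h (add_nonneg hK hK') hs hq)
    (((tendsto_average hUV h hK hφ hq).add (tendsto_average hUV h hK' hφ' hq)).congr fun N => ?_)
  simp only [integral_add (hi hφ _) (hi hφ' _), Finset.sum_add_distrib, add_div]

theorem objective_eq (hUV : DrivingSequences P U V)
    (h : e.Bounds (P.map (U 0)) (P.map (V 0))) (hU2 : MemLp (U 0) 2 P) (hV2 : MemLp (V 0) 2 P)
    (hmem : ∀ ϑ ∈ M.box, M.means ϑ ∈ e.rect) (hϑ : ϑ ∈ M.box) :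
    objective M P U V ϑ = M.h0 * (M.lam (ϑ 1) *
      (statMean (drivingLaw P U V) Prod.fst (M.means ϑ) + 1 / ϑ 0)) + M.cost (ϑ 0) -
      ϑ 1 * M.lam (ϑ 1) := by
  rw [objective, steadyQueueLength_eq hUV h hU2 hV2 (hmem ϑ hϑ)]

/-- Chain rule for h₀λ(w̄ + 1/μ) + c - pλ. The derivative of w̄ brings in ȳ, and the factors from α
= 1/μ and β = 1/λ combine so that both coordinates contain the same quantity w̄ + ȳ + 1/μ. -/
theorem gradObjective_eq (hUV : DrivingSequences P U V) (hS : UniformStability M)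
    (h : e.Bounds (P.map (U 0)) (P.map (V 0))) (hU2 : MemLp (U 0) 2 P) (hV2 : MemLp (V 0) 2 P)
    (hmem : ∀ ϑ ∈ M.box, M.means ϑ ∈ e.rect) (hint : (interior M.box).Nonempty)
    (hϑ : ϑ ∈ M.box) :
    gradObjective M P U V ϑ = gradEst M ϑ (statMean (drivingLaw P U V) Prod.fst (M.means ϑ),
      statMean (drivingLaw P U V) Prod.snd (M.means ϑ)) := by
  have hq := hmem ϑ hϑ
  have hα : 0 < 1 / ϑ 0 := h.αm_pos.trans_le hq.1.1
  have hμ : 0 < ϑ 0 := one_div_pos.1 hα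
  have hl : 0 < M.lam (ϑ 1) := hS.lam_pos _ hϑ.2
  obtain ⟨w, hw⟩ : ∃ w, w = statMean (drivingLaw P U V) Prod.fst (M.means ϑ) := ⟨_, rfl⟩
  obtain ⟨y, hy⟩ : ∃ y, y = statMean (drivingLaw P U V) Prod.snd (M.means ϑ) := ⟨_, rfl⟩
  have p0 : HasFDerivWithinAt (fun ϑ : Param => ϑ 0) (EuclideanSpace.proj 0 : Param →L[ℝ] ℝ)
      M.box ϑ := (EuclideanSpace.proj 0 : Param →L[ℝ] ℝ).hasFDerivWithinAt
  have p1 : HasFDerivWithinAt (fun ϑ : Param => ϑ 1) (EuclideanSpace.proj 1 : Param →L[ℝ] ℝ)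
      M.box ϑ := (EuclideanSpace.proj 1 : Param →L[ℝ] ℝ).hasFDerivWithinAt
  have dlam : HasDerivWithinAt M.lam (M.lam' (ϑ 1)) (Set.Icc M.plo M.phi) (ϑ 1) :=
    (hS.lam_smooth.differentiableOn one_ne_zero _ hϑ.2).hasDerivWithinAt
  have dcost : HasDerivWithinAt M.cost (M.cost' (ϑ 0)) (Set.Icc M.μlo M.μhi) (ϑ 0) :=
    (hS.cost_smooth.differentiableOn one_ne_zero _ hϑ.1).hasDerivWithinAt
  have d1 : HasFDerivWithinAt (fun ϑ : Param => 1 / ϑ 0)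
      ((-(ϑ 0 ^ 2)⁻¹) • (EuclideanSpace.proj 0 : Param →L[ℝ] ℝ)) M.box ϑ := by
    simp only [one_div]
    exact (hasDerivAt_inv hμ.ne').comp_hasFDerivWithinAt ϑ p0
  have d2 : HasFDerivWithinAt (fun ϑ : Param => M.lam (ϑ 1))
      (M.lam' (ϑ 1) • (EuclideanSpace.proj 1 : Param →L[ℝ] ℝ)) M.box ϑ :=
    dlam.comp_hasFDerivWithinAt ϑ p1 fun x hx => hx.2
  have d3 : HasFDerivWithinAt (fun ϑ : Param => 1 / M.lam (ϑ 1))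
      ((-(M.lam (ϑ 1) ^ 2)⁻¹) • (M.lam' (ϑ 1) • (EuclideanSpace.proj 1 : Param →L[ℝ] ℝ)))
      M.box ϑ := by
    simp only [one_div]
    exact (hasDerivAt_inv hl.ne').comp_hasFDerivWithinAt ϑ d2
  have d4 : HasFDerivWithinAt (fun ϑ : Param => M.cost (ϑ 0))
      (M.cost' (ϑ 0) • (EuclideanSpace.proj 0 : Param →L[ℝ] ℝ)) M.box ϑ :=
    dcost.comp_hasFDerivWithinAt ϑ p0 fun x hx => hx.1
  have d5 := (hasFDerivWithinAt_statMean hUV h hq).comp ϑ (f := M.means)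
    (d1.prodMk d3) hmem
  have d6 := (((d2.mul (d5.add d1)).const_mul M.h0).add d4).sub (p1.mul d2)
  have d7 := d6.congr (fun x hx => objective_eq hUV h hU2 hV2 hmem hx)
    (objective_eq hUV h hU2 hV2 hmem hϑ)
  -- A convex set with nonempty interior determines derivatives up to its boundary, so the computed
  -- derivative is the one chosen by `gradientWithin`.
  have hud : UniqueDiffWithinAt ℝ M.box ϑ :=
    uniqueDiffWithinAt_convex Problem.convex_box hint (subset_closure hϑ)
  rw [gradObjective, gradientWithin, d7.fderivWithin hud, LinearIsometryEquiv.symm_apply_eq]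
  ext v
  rw [InnerProductSpace.toDual_apply_apply, ← hw, ← hy]
  have hw' : statMean (drivingLaw P U V) Prod.fst ((ϑ 0)⁻¹, (M.lam (ϑ 1))⁻¹) = w := by
    rw [hw, Problem.means, one_div, one_div]
  simp [gradEst, Problem.means, PiLp.inner_apply, Fin.sum_univ_two, hw']
  field_simp
  ring

end Objective

/-! ### Bounded Lipschitz functions of the parameter -/

/-- `f` is bounded and Lipschitz on `s`. -/
def BoundedLipschitzOn (s : Set Param) (f : Param → ℝ) : Prop :=
  ∃ B L, 0 ≤ B ∧ 0 ≤ L ∧ (∀ x ∈ s, |f x| ≤ B) ∧ ∀ x ∈ s, ∀ y ∈ s, |f x - f y| ≤ L * ‖x - y‖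

namespace BoundedLipschitzOn

variable {s : Set Param} {f g : Param → ℝ}

theorem const (c : ℝ) : BoundedLipschitzOn s fun _ => c :=
  ⟨|c|, 0, abs_nonneg c, le_rfl, fun _ _ => le_rfl, fun _ _ _ _ => by simp⟩

theorem add (hf : BoundedLipschitzOn s f) (hg : BoundedLipschitzOn s g) :
    BoundedLipschitzOn s fun x => f x + g x := by
  obtain ⟨B, L, hB, hL, h1, h2⟩ := hf
  obtain ⟨B', L', hB', hL', h1', h2'⟩ := hg
  refine ⟨B + B', L + L', by positivity, by positivity, fun x hx =>
    (abs_add_le _ _).trans (add_le_add (h1 x hx) (h1' x hx)), fun x hx y hy => ?_⟩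
  rw [add_sub_add_comm, add_mul]
  exact (abs_add_le _ _).trans (add_le_add (h2 x hx y hy) (h2' x hx y hy))

theorem mul (hf : BoundedLipschitzOn s f) (hg : BoundedLipschitzOn s g) :
    BoundedLipschitzOn s fun x => f x * g x := by
  obtain ⟨B, L, hB, hL, h1, h2⟩ := hf
  obtain ⟨B', L', hB', hL', h1', h2'⟩ := hg
  refine ⟨B * B', B * L' + L * B', by positivity, by positivity, fun x hx => ?_,
    fun x hx y hy => ?_⟩
  · rw [abs_mul]
    exact mul_le_mul (h1 x hx) (h1' x hx) (abs_nonneg _) hB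
  · have e : f x * g x - f y * g y = f x * (g x - g y) + (f x - f y) * g y := by ring
    have a1 := mul_le_mul (h1 x hx) (h2' x hx y hy) (abs_nonneg _) hB
    have a2 := mul_le_mul (h2 x hx y hy) (h1' y hy) (abs_nonneg _) (by positivity)
    rw [e]
    refine (abs_add_le _ _).trans ?_
    rw [abs_mul, abs_mul]
    linarith

theorem one_div (hf : BoundedLipschitzOn s f) {c : ℝ} (hc : 0 < c) (hcf : ∀ x ∈ s, c ≤ f x) :
    BoundedLipschitzOn s fun x => 1 / f x := by
  obtain ⟨B, L, hB, hL, h1, h2⟩ := hf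
  refine ⟨1 / c, L / (c * c), by positivity, by positivity, fun x hx => ?_, fun x hx y hy => ?_⟩
  · rw [abs_of_pos (one_div_pos.2 (hc.trans_le (hcf x hx)))]
    exact one_div_le_one_div_of_le hc (hcf x hx)
  · have p1 := hc.trans_le (hcf x hx)
    have p2 := hc.trans_le (hcf y hy)
    have e : 1 / f x - 1 / f y = (f y - f x) / (f x * f y) := by field_simp
    rw [e, abs_div, abs_of_pos (mul_pos p1 p2), abs_sub_comm, div_mul_eq_mul_div]
    exact div_le_div₀ (by positivity) (h2 x hx y hy) (by positivity)
      (mul_le_mul (hcf x hx) (hcf y hy) hc.le p1.le)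

theorem continuousOn (hf : BoundedLipschitzOn s f) : ContinuousOn f s := by
  obtain ⟨B, L, hB, hL, h1, h2⟩ := hf
  refine (LipschitzOnWith.of_dist_le_mul (K := ⟨L, hL⟩) fun x hx y hy => ?_).continuousOn
  rw [Real.dist_eq, dist_eq_norm]
  exact h2 x hx y hy

/-- A function of one coordinate. -/
theorem comp_apply {i : Fin 2} {I : Set ℝ} (hs : ∀ x ∈ s, x i ∈ I) {φ : ℝ → ℝ} {B L : ℝ}
    (hB : 0 ≤ B) (hL : 0 ≤ L) (h1 : ∀ r ∈ I, |φ r| ≤ B)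
    (h2 : ∀ r ∈ I, ∀ r' ∈ I, |φ r - φ r'| ≤ L * |r - r'|) :
    BoundedLipschitzOn s fun x => φ (x i) := by
  refine ⟨B, L, hB, hL, fun x hx => h1 _ (hs x hx), fun x hx y hy =>
    (h2 _ (hs x hx) _ (hs y hy)).trans (mul_le_mul_of_nonneg_left ?_ hL)⟩
  simpa using PiLp.norm_apply_le (x - y) i

end BoundedLipschitzOn

/-- Demand and cost are arbitrary functions outside their intervals, so measurability along the
iterates has to be obtained on the box only. -/
theorem _root_.ContinuousOn.measurable_comp_of_mem {Ω α β : Type*} {m : MeasurableSpace Ω}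
    [TopologicalSpace α] [MeasurableSpace α] [BorelSpace α] [TopologicalSpace β]
    [MeasurableSpace β] [BorelSpace β] {f : α → β} {s : Set α} (hf : ContinuousOn f s)
    {X : Ω → α} (hX : Measurable X) (hmem : ∀ ω, X ω ∈ s) : Measurable fun ω => f (X ω) :=
  (continuousOn_iff_continuous_domRestrict.1 hf).measurable.comp (hX.subtype_mk (h := hmem))

theorem measurable_vec2 {Ω : Type*} {m : MeasurableSpace Ω} {f g : Ω → ℝ} (hf : Measurable f)
    (hg : Measurable g) : Measurable fun ω => (!₂[f ω, g ω] : Param) := by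
  refine (WithLp.measurable_toLp 2 (Fin 2 → ℝ)).comp (measurable_pi_iff.2 fun i => ?_)
  fin_cases i
  · exact hf
  · exact hg

namespace Problem

variable {M : Problem} {ϑ θ : Param}

theorem measurable_proj : Measurable M.proj := by
  refine measurable_vec2 ?_ ?_ <;> fun_prop

theorem norm_proj_sub_le (z : Param) (hθ : θ ∈ M.box) : ‖M.proj z - θ‖ ≤ ‖z - θ‖ := by
  have key : ∀ a b x y : ℝ, a ≤ y → y ≤ b → ‖max a (min b x) - y‖ ^ 2 ≤ ‖x - y‖ ^ 2 := by
    intro a b x y hay hyb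
    refine pow_le_pow_left₀ (norm_nonneg _) ?_ 2
    have h1 : |min b x - min b y| ≤ |x - y| := by
      simpa using abs_min_sub_min_le_max b x b y
    have h2 : |max a (min b x) - max a (min b y)| ≤ |min b x - min b y| := by
      simpa using abs_max_sub_max_le_max a (min b x) a (min b y)
    rw [min_eq_right hyb, max_eq_right hay] at h2
    rw [min_eq_right hyb] at h1
    exact h2.trans h1
  rw [EuclideanSpace.norm_eq, EuclideanSpace.norm_eq]
  apply Real.sqrt_le_sqrt
  simp only [Fin.sum_univ_two]
  exact add_le_add (key _ _ _ _ hθ.1.1 hθ.1.2) (key _ _ _ _ hθ.2.1 hθ.2.2)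

/-- Direction in which the noise of the state perturbs the stochastic gradient. -/
def noiseDir (M : Problem) (ϑ : Param) : Param :=
  !₂[-(M.h0 * (M.lam (ϑ 1) * (1 / ϑ 0))), M.h0 * M.lam' (ϑ 1)]

/-- The estimator is affine in w + y. Taking x' to be the stationary means splits it into the true
gradient and a scalar noise times a direction. -/
theorem gradEst_eq_add (ϑ : Param) (x x' : State) : gradEst M ϑ x =
    gradEst M ϑ x' + ((x.1 + x.2) - (x'.1 + x'.2)) • M.noiseDir ϑ := by
  ext i
  fin_cases i
  · simp [gradEst, noiseDir]; ring
  · simp [gradEst, noiseDir]; ring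

/-- Weight of the noise in the mean-square error. -/
def noiseWeight (M : Problem) (θ ϑ : Param) : ℝ := inner ℝ (ϑ - θ) (M.noiseDir ϑ)

theorem continuousOn_cost' (hS : UniformStability M) (hμ' : M.μlo < M.μhi) :
    ContinuousOn (fun ϑ : Param => M.cost' (ϑ 0)) M.box :=
  (hS.cost_smooth.continuousOn_derivWithin (uniqueDiffOn_Icc hμ') le_rfl).comp
    (by fun_prop) fun _ hx => hx.1

/-! ### Regularity of the estimator on the box -/

section Regularity

variable (hS : UniformStability M) (hμ : 0 < M.μlo) (hμ' : M.μlo < M.μhi) (hp : M.plo < M.phi)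

theorem boundedLipschitzOn_apply (i : Fin 2) : BoundedLipschitzOn M.box fun ϑ => ϑ i := by
  have key : ∀ a b : ℝ, ∀ r ∈ Set.Icc a b, |r| ≤ |a| + |b| := by
    intro a b r hr
    rw [abs_le]
    have h1 := neg_abs_le a
    have h2 := le_abs_self b
    exact ⟨by linarith [hr.1, abs_nonneg b], by linarith [hr.2, abs_nonneg a]⟩
  fin_cases i
  · exact BoundedLipschitzOn.comp_apply (I := Set.Icc M.μlo M.μhi) (φ := id) (L := 1)
      (fun x hx => hx.1) (by positivity) zero_le_one (key _ _) (by simp)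
  · exact BoundedLipschitzOn.comp_apply (I := Set.Icc M.plo M.phi) (φ := id) (L := 1)
      (fun x hx => hx.2) (by positivity) zero_le_one (key _ _) (by simp)

include hS hp

theorem boundedLipschitzOn_lam' : BoundedLipschitzOn M.box fun ϑ => M.lam' (ϑ 1) := by
  obtain ⟨L, hL⟩ := hS.lam'_lipschitz
  obtain ⟨B, hB⟩ := isCompact_Icc.exists_bound_of_continuousOn hL.continuousOn
  refine BoundedLipschitzOn.comp_apply (fun x hx => hx.2)
    ((norm_nonneg _).trans (hB _ (Set.left_mem_Icc.2 hp.le))) L.2 hB fun r hr r' hr' => ?_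
  simpa [Real.dist_eq] using hL.dist_le_mul r hr r' hr'

theorem boundedLipschitzOn_lam : BoundedLipschitzOn M.box fun ϑ => M.lam (ϑ 1) := by
  obtain ⟨L, hL⟩ := hS.lam'_lipschitz
  obtain ⟨B, hB⟩ := isCompact_Icc.exists_bound_of_continuousOn hS.lam_smooth.continuousOn
  obtain ⟨B', hB'⟩ := isCompact_Icc.exists_bound_of_continuousOn hL.continuousOn
  refine BoundedLipschitzOn.comp_apply (fun x hx => hx.2)
    ((norm_nonneg _).trans (hB _ (Set.left_mem_Icc.2 hp.le)))
    ((norm_nonneg _).trans (hB' _ (Set.left_mem_Icc.2 hp.le))) hB fun r hr r' hr' => ?_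
  exact (convex_Icc _ _).norm_image_sub_le_of_norm_derivWithin_le
    (hS.lam_smooth.differentiableOn one_ne_zero) hB' hr' hr

include hμ

theorem boundedLipschitzOn_means : BoundedLipschitzOn M.box (fun ϑ => (M.means ϑ).1) ∧
    BoundedLipschitzOn M.box (fun ϑ => (M.means ϑ).2) :=
  ⟨(boundedLipschitzOn_apply 0).one_div hμ fun _ hx => hx.1.1,
    (boundedLipschitzOn_lam hS hp).one_div (hS.lam_pos _ (Set.right_mem_Icc.2 hp.le))
      fun _ hx => hS.lam_anti hx.2 (Set.right_mem_Icc.2 hp.le) hx.2.2⟩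

theorem exists_dist1_means_le : ∃ L, 0 ≤ L ∧ ∀ ϑ ∈ M.box, ∀ ϑ' ∈ M.box,
    dist1 (M.means ϑ) (M.means ϑ') ≤ L * ‖ϑ - ϑ'‖ := by
  obtain ⟨⟨B, L, -, hL, -, h2⟩, B', L', -, hL', -, h2'⟩ := boundedLipschitzOn_means hS hμ hp
  refine ⟨L + L', by positivity, fun x hx y hy => ?_⟩
  rw [add_mul]
  exact add_le_add (h2 x hx y hy) (h2' x hx y hy)

theorem boundedLipschitzOn_noiseDir (i : Fin 2) :
    BoundedLipschitzOn M.box fun ϑ => M.noiseDir ϑ i := by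
  fin_cases i
  · have := ((BoundedLipschitzOn.const (-M.h0)).mul ((boundedLipschitzOn_lam hS hp).mul
      (boundedLipschitzOn_means hS hμ hp).1))
    simpa [noiseDir, means] using this
  · simpa [noiseDir] using (BoundedLipschitzOn.const M.h0).mul (boundedLipschitzOn_lam' hS hp)

theorem boundedLipschitzOn_noiseWeight (θ : Param) :
    BoundedLipschitzOn M.box (M.noiseWeight θ) := by
  have h : ∀ i : Fin 2, BoundedLipschitzOn M.box fun ϑ => M.noiseDir ϑ i * (ϑ i + -θ i) :=
    fun i => (boundedLipschitzOn_noiseDir hS hμ hp i).mul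
      ((boundedLipschitzOn_apply i).add (BoundedLipschitzOn.const _))
  have h2 := (h 0).add (h 1)
  have e : M.noiseWeight θ =
      fun ϑ => M.noiseDir ϑ 0 * (ϑ 0 + -θ 0) + M.noiseDir ϑ 1 * (ϑ 1 + -θ 1) := by
    funext ϑ
    simp [noiseWeight, PiLp.inner_apply, Fin.sum_univ_two, sub_eq_add_neg]
  rw [e]
  exact h2

include hμ'

/-- The cost derivative is only continuous. Continuity is enough here: Lipschitz bounds are needed
just for the noise direction, which does not involve the cost. -/
theorem continuousOn_gradEst_zero (i : Fin 2) :
    ContinuousOn (fun ϑ => gradEst M ϑ (0, 0) i) M.box := by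
  have c1 := (boundedLipschitzOn_means hS hμ hp).1.continuousOn
  have c2 := (boundedLipschitzOn_lam hS hp).continuousOn
  have c3 := (boundedLipschitzOn_lam' hS hp).continuousOn
  have c4 := continuousOn_cost' hS hμ'
  have c5 := (boundedLipschitzOn_apply (M := M) 1).continuousOn
  fin_cases i
  · have := c4.sub (((continuousOn_const (c := M.h0)).mul (c2.mul c1)).mul c1)
    refine this.congr fun x _ => ?_
    simp [gradEst, means, div_eq_mul_inv]
  · have := (c2.neg.sub (c5.mul c3)).add (((continuousOn_const (c := M.h0)).mul c3).mul c1)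
    refine this.congr fun x _ => ?_
    simp [gradEst, means]

theorem measurable_gradEst {Ω : Type*} {m : MeasurableSpace Ω} {ϑ : Ω → Param} {x : Ω → State}
    (hϑ : Measurable ϑ) (hmem : ∀ ω, ϑ ω ∈ M.box) (hx : Measurable x) :
    Measurable fun ω => gradEst M (ϑ ω) (x ω) := by
  have h1 : ∀ i, Measurable fun ω => gradEst M (ϑ ω) (0, 0) i := fun i =>
    (continuousOn_gradEst_zero hS hμ hμ' hp i).measurable_comp_of_mem hϑ hmem
  have h2 : ∀ i, Measurable fun ω => M.noiseDir (ϑ ω) i := fun i =>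
    (boundedLipschitzOn_noiseDir hS hμ hp i).continuousOn.measurable_comp_of_mem hϑ hmem
  have h3 : Measurable fun ω => (x ω).1 + (x ω).2 := hx.fst.add hx.snd
  have e : (fun ω => gradEst M (ϑ ω) (x ω)) = fun ω =>
      (!₂[gradEst M (ϑ ω) (0, 0) 0 + ((x ω).1 + (x ω).2) * M.noiseDir (ϑ ω) 0,
        gradEst M (ϑ ω) (0, 0) 1 + ((x ω).1 + (x ω).2) * M.noiseDir (ϑ ω) 1] : Param) := by
    funext ω
    rw [gradEst_eq_add (ϑ ω) (x ω) (0, 0)]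
    ext i
    fin_cases i <;> simp
  rw [e]
  exact measurable_vec2 ((h1 0).add (h3.mul (h2 0))) ((h1 1).add (h3.mul (h2 1)))

theorem exists_norm_gradEst_le {νU νV : Measure ℝ} {e : Envelope} (h : e.Bounds νU νV) :
    ∃ C, 0 ≤ C ∧ ∀ ϑ ∈ M.box, ∀ x ∈ quadrant, ‖gradEst M ϑ x‖ ≤ C * e.lyap 1 x := by
  have hnorm : ∀ v : Param, ‖v‖ ≤ |v 0| + |v 1| := by
    intro v
    rw [EuclideanSpace.norm_eq]
    refine Real.sqrt_le_iff.2 ⟨by positivity, ?_⟩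
    simp only [Fin.sum_univ_two, Real.norm_eq_abs]
    nlinarith [abs_nonneg (v 0), abs_nonneg (v 1)]
  have hcpt : IsCompact M.box := by
    have e1 : M.box = (EuclideanSpace.equiv (Fin 2) ℝ).toHomeomorph ⁻¹'
        (Set.pi Set.univ ![Set.Icc M.μlo M.μhi, Set.Icc M.plo M.phi]) := by
      ext x
      simp [box]
    rw [e1]
    refine (Homeomorph.isCompact_preimage _).2 (isCompact_univ_pi fun i => ?_)
    fin_cases i <;> exact isCompact_Icc
  obtain ⟨A0, hA0⟩ := hcpt.exists_bound_of_continuousOn (continuousOn_gradEst_zero hS hμ hμ' hp 0)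
  obtain ⟨A1, hA1⟩ := hcpt.exists_bound_of_continuousOn (continuousOn_gradEst_zero hS hμ hμ' hp 1)
  obtain ⟨B0, -, hB0, -, hb0, -⟩ := boundedLipschitzOn_noiseDir hS hμ hp 0
  obtain ⟨B1, -, hB1, -, hb1, -⟩ := boundedLipschitzOn_noiseDir hS hμ hp 1
  have hθ := h.θ_pos
  have hσ := h.σ_pos
  refine ⟨|A0| + |A1| + (1 / e.θ + 1 / e.σ) * (B0 + B1), by positivity, fun ϑ hϑ x hx => ?_⟩
  have l1 := h.one_le_lyap 1 hx
  have a0 : |gradEst M ϑ (0, 0) 0| ≤ |A0| := (hA0 ϑ hϑ).trans (le_abs_self _)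
  have a1 : |gradEst M ϑ (0, 0) 1| ≤ |A1| := (hA1 ϑ hϑ).trans (le_abs_self _)
  have n0 := hnorm (gradEst M ϑ (0, 0))
  have n1 := hnorm (M.noiseDir ϑ)
  have m0 := hb0 ϑ hϑ
  have m1 := hb1 ϑ hϑ
  have w1 := (isCost_fst h).le x hx
  have w2 := (isCost_snd h).le x hx
  have hs : 0 ≤ x.1 + x.2 := add_nonneg hx.1 hx.2
  rw [gradEst_eq_add ϑ x (0, 0)]
  refine (norm_add_le _ _).trans ?_
  rw [norm_smul, Real.norm_eq_abs, add_zero, sub_zero, abs_of_nonneg hs]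
  have s1 : (x.1 + x.2) * ‖M.noiseDir ϑ‖ ≤
      ((1 / e.θ + 1 / e.σ) * e.lyap 1 x) * (B0 + B1) :=
    mul_le_mul (by linarith) (by linarith) (norm_nonneg _) (by have := e.lyap_pos 1 x; positivity)
  have s2 : (|A0| + |A1|) * 1 ≤ (|A0| + |A1|) * e.lyap 1 x :=
    mul_le_mul_of_nonneg_left l1 (by positivity)
  linarith

end Regularity

end Problem

/-! ### The iterates as a controlled chain -/

theorem stateStep_eq_rateStep (M : Problem) (ϑ : Param) (x : State) (u v : ℝ) :
    stateStep M ϑ x u v = rateStep (M.means ϑ) x (u, v) := by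
  simp [stateStep, rateStep, Problem.means, div_eq_mul_inv]

theorem isCost_add {νU νV : Measure ℝ} {e : Envelope} (h : e.Bounds νU νV) :
    IsCost e (fun x => x.1 + x.2) (1 / e.θ + 1 / e.σ) where
  measurable := measurable_fst.add measurable_snd
  nonneg x hx := add_nonneg hx.1 hx.2
  le x hx := by
    rw [add_mul]
    exact add_le_add ((isCost_fst h).le x hx) ((isCost_snd h).le x hx)
  lip x _ y _ := by
    unfold dist1
    linarith [le_abs_self (x.2 - y.2), le_abs_self (x.1 - y.1)]

section Iterates

variable {Ω : Type*} {M : Problem} {U V : ℕ → Ω → ℝ} {η : ℕ → ℝ} {ϑ₁ : Param}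

theorem samcmc_mem_box (hμ : M.μlo ≤ M.μhi) (hp : M.plo ≤ M.phi) (hϑ₁ : ϑ₁ ∈ M.box) (t : ℕ)
    (ω : Ω) : (samcmc M U V η ϑ₁ t ω).1 ∈ M.box := by
  match t with
  | 0 => exact hϑ₁
  | 1 => exact hϑ₁
  | t + 2 => exact M.proj_mem hμ hp _

/-- The iterate at time n + 1 uses only inputs of index at most n, so the inputs of index n + 1,
which drive the next state, are independent of it. -/
theorem measurable_samcmc (hS : UniformStability M) (hμ : 0 < M.μlo) (hμ' : M.μlo < M.μhi)
    (hp : M.plo < M.phi) (hϑ₁ : ϑ₁ ∈ M.box) (n : ℕ) :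
    Measurable[history U V (n + 1)] (fun ω => (samcmc M U V η ϑ₁ (n + 1) ω).1) ∧
    Measurable[history U V (n + 1)] (fun ω => (samcmc M U V η ϑ₁ (n + 1) ω).2) ∧
    Measurable[history U V (n + 1)] (fun ω => M.means (samcmc M U V η ϑ₁ (n + 1) ω).1) := by
  have hmeans : ∀ {m : MeasurableSpace Ω} {ϑ : Ω → Param}, Measurable ϑ →
      (∀ ω, ϑ ω ∈ M.box) → Measurable fun ω => M.means (ϑ ω) := fun hϑ hmem =>
    ((Problem.boundedLipschitzOn_means hS hμ hp).1.continuousOn.measurable_comp_of_mem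
      hϑ hmem).prodMk ((Problem.boundedLipschitzOn_means hS hμ
        hp).2.continuousOn.measurable_comp_of_mem hϑ hmem)
  induction n with
  | zero => exact ⟨measurable_const, measurable_const, hmeans measurable_const (fun _ => hϑ₁)⟩
  | succ n ih =>
    have hle := history_mono (U := U) (V := V) (n + 1).le_succ
    have i1 := ih.1.mono hle le_rfl
    have i2 := ih.2.1.mono hle le_rfl
    have i3 := ih.2.2.mono hle le_rfl
    have hmem : ∀ t (ω : Ω), (samcmc M U V η ϑ₁ t ω).1 ∈ M.box :=
      fun t ω => samcmc_mem_box hμ'.le hp.le hϑ₁ t ω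
    have g := Problem.measurable_gradEst hS hμ hμ' hp i1 (hmem (n + 1)) i2
    have h1 : Measurable[history U V (n + 1 + 1)]
        (fun ω => (samcmc M U V η ϑ₁ (n + 1 + 1) ω).1) := by
      have c : Measurable fun p : Param × Param => M.proj (p.1 - η (n + 1) • p.2) :=
        Problem.measurable_proj.comp (by fun_prop)
      exact c.comp (i1.prodMk g)
    refine ⟨h1, ?_, hmeans h1 (hmem _)⟩
    have h2 : Measurable[history U V (n + 1 + 1)] fun ω =>
        ((M.means (samcmc M U V η ϑ₁ (n + 1) ω).1, (samcmc M U V η ϑ₁ (n + 1) ω).2),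
          (U (n + 1) ω, V (n + 1) ω)) :=
      (i3.prodMk i2).prodMk (measurable_history_pair (n + 1).lt_succ_self)
    have h3 := measurable_rateStep.comp h2
    have e1 : (fun ω => (samcmc M U V η ϑ₁ (n + 1 + 1) ω).2) = fun ω =>
        rateStep (M.means (samcmc M U V η ϑ₁ (n + 1) ω).1) (samcmc M U V η ϑ₁ (n + 1) ω).2
          (U (n + 1) ω, V (n + 1) ω) := by
      funext ω
      exact stateStep_eq_rateStep _ _ _ _ _
    rw [e1]
    exact h3

end Iterates

theorem integral_le_of_forall_le {Ω : Type*} [MeasurableSpace Ω] {P : Measure Ω}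
    {A' A T H : Ω → ℝ} (hA' : Integrable A' P) (hA : Integrable A P)
    (hT : Integrable T P) (hH : Integrable H P) {a b c : ℝ}
    (hle : ∀ ω, A' ω ≤ a * A ω - b * T ω + c * H ω) :
    ∫ ω, A' ω ∂P ≤ a * ∫ ω, A ω ∂P - b * ∫ ω, T ω ∂P + c * ∫ ω, H ω ∂P := by
  have h1 : Integrable (fun ω => a * A ω - b * T ω) P := (hA.const_mul a).sub (hT.const_mul b)
  have h2 : Integrable (fun ω => a * A ω - b * T ω + c * H ω) P := h1.add (hH.const_mul c)
  have h3 := integral_mono hA' h2 hle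
  rwa [integral_add h1 (hH.const_mul c), integral_sub (hA.const_mul a) (hT.const_mul b),
    integral_const_mul, integral_const_mul, integral_const_mul] at h3

section Recursion

variable {Ω : Type*} [mΩ : MeasurableSpace Ω] {P : Measure Ω} [IsProbabilityMeasure P]
  {U V : ℕ → Ω → ℝ} {e : Envelope} {M : Problem} {θ : Param}

theorem controlledChain_samcmc (hUV : DrivingSequences P U V) (hS : UniformStability M)
    (hmem : ∀ ϑ ∈ M.box, M.means ϑ ∈ e.rect) (hμ : 0 < M.μlo) (hμ' : M.μlo < M.μhi)
    (hp : M.plo < M.phi) (η : ℕ → ℝ) {ϑ₁ : Param} (hϑ₁ : ϑ₁ ∈ M.box) :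
    ControlledChain e (P.map (U 0)) (P.map (V 0)) P (fun t => history U V (t + 1))
      (fun t ω => (U (t + 1) ω, V (t + 1) ω))
      (fun t ω => M.means (samcmc M U V η ϑ₁ (t + 1) ω).1)
      (fun t ω => (samcmc M U V η ϑ₁ (t + 1) ω).2) :=
  controlledChain_of_history hUV 1 (fun _ => (measurable_samcmc hS hμ hμ' hp hϑ₁ _).2.2)
    (fun _ => (measurable_samcmc hS hμ hμ' hp hϑ₁ _).2.1)
    (fun _ _ => hmem _ (samcmc_mem_box hμ'.le hp.le hϑ₁ _ _)) (fun _ => rfl)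
    (fun _ _ => stateStep_eq_rateStep _ _ _ _ _)

/-! ### Recursion for the mean-square error -/

/-- The noise term of the error recursion, expressed through the solution of the Poisson
equation. -/
def noisePotential (M : Problem) (ν : Measure (ℝ × ℝ)) (θ ϑ : Param) (x : State) : ℝ :=
  M.noiseWeight θ ϑ * poisson ν (fun x => x.1 + x.2) (M.means ϑ) x

/-- Product rule: the weight is bounded and Lipschitz, and the Poisson solution is bounded by `lyap
1` and Lipschitz with factor `lyap 2`. -/
theorem exists_noisePotential_lipschitz {νU νV : Measure ℝ} [IsProbabilityMeasure νU]
    [IsProbabilityMeasure νV] (h : e.Bounds νU νV) (hS : UniformStability M)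
    (hmem : ∀ ϑ ∈ M.box, M.means ϑ ∈ e.rect) (hμ : 0 < M.μlo) (hp : M.plo < M.phi) (θ : Param) :
    ∃ C, 0 ≤ C ∧ ∀ ϑ ∈ M.box, ∀ ϑ' ∈ M.box, ∀ x ∈ quadrant,
      |noisePotential M (νU.prod νV) θ ϑ x - noisePotential M (νU.prod νV) θ ϑ' x| ≤
        C * ‖ϑ - ϑ'‖ * e.lyap 2 x := by
  have hθ := h.θ_pos
  have hσ := h.σ_pos
  have hK : 0 ≤ 1 / e.θ + 1 / e.σ := by positivity
  obtain ⟨B, L, hB, hL, b1, b2⟩ := Problem.boundedLipschitzOn_noiseWeight hS hμ hp θ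
  obtain ⟨L', hL', b3⟩ := Problem.exists_dist1_means_le hS hμ hp
  obtain ⟨C1, hC1, p1⟩ := poisson_bound h hK (isCost_add h)
  obtain ⟨C2, hC2, p2⟩ := poisson_lipschitz h hK (isCost_add h)
  refine ⟨L * C1 + B * (C2 * L'), by positivity, fun ϑ hϑ ϑ' hϑ' x hx => ?_⟩
  have n0 := norm_nonneg (ϑ - ϑ')
  have l2 := e.lyap_pos 2 x
  have q1 := (p1 _ (hmem ϑ hϑ) x hx).trans
    (mul_le_mul_of_nonneg_left (h.lyap_mono_index one_le_two hx) hC1)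
  have q2 := (p2 _ (hmem ϑ hϑ) _ (hmem ϑ' hϑ') x hx).trans
    (mul_le_mul_of_nonneg_right (mul_le_mul_of_nonneg_left (b3 ϑ hϑ ϑ' hϑ') hC2) l2.le)
  have r1 := mul_le_mul (b2 ϑ hϑ ϑ' hϑ') q1 (abs_nonneg _) (by positivity)
  have r2 := mul_le_mul (b1 ϑ' hϑ') q2 (abs_nonneg _) hB
  rw [← abs_mul] at r1 r2
  have e1 : noisePotential M (νU.prod νV) θ ϑ x - noisePotential M (νU.prod νV) θ ϑ' x =
      (M.noiseWeight θ ϑ - M.noiseWeight θ ϑ') *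
        poisson (νU.prod νV) (fun x => x.1 + x.2) (M.means ϑ) x +
      M.noiseWeight θ ϑ' * (poisson (νU.prod νV) (fun x => x.1 + x.2) (M.means ϑ) x -
        poisson (νU.prod νV) (fun x => x.1 + x.2) (M.means ϑ') x) := by
    unfold noisePotential
    ring
  rw [e1]
  refine (abs_add_le _ _).trans ((add_le_add r1 r2).trans (le_of_eq ?_))
  ring

/-- One step of the projected iteration, on each path. -/
theorem norm_proj_step_sq_le {K₀ η : ℝ} (hη : 0 ≤ η) (hθ : θ ∈ M.box) {ϑ g : Param} {x x' : State}
    (hg : g = gradEst M ϑ x') (hmono : K₀ * ‖ϑ - θ‖ ^ 2 ≤ inner ℝ (ϑ - θ) g) :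
    ‖M.proj (ϑ - η • gradEst M ϑ x) - θ‖ ^ 2 ≤ (1 - 2 * K₀ * η) * ‖ϑ - θ‖ ^ 2 -
      2 * η * (M.noiseWeight θ ϑ * ((x.1 + x.2) - (x'.1 + x'.2))) +
      η ^ 2 * ‖gradEst M ϑ x‖ ^ 2 := by
  have h1 := pow_le_pow_left₀ (norm_nonneg _)
    (M.norm_proj_sub_le (ϑ - η • gradEst M ϑ x) hθ) 2
  have e1 : ϑ - η • gradEst M ϑ x - θ = (ϑ - θ) - η • gradEst M ϑ x := by abel
  have e2 : inner ℝ (ϑ - θ) (gradEst M ϑ x) =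
      inner ℝ (ϑ - θ) g + ((x.1 + x.2) - (x'.1 + x'.2)) * M.noiseWeight θ ϑ := by
    rw [Problem.gradEst_eq_add ϑ x x', ← hg, inner_add_right, inner_smul_right]
    rfl
  rw [e1, norm_sub_sq_real (ϑ - θ), inner_smul_right, norm_smul, Real.norm_eq_abs, abs_of_nonneg hη,
    e2] at h1
  have h2 := mul_le_mul_of_nonneg_left hmono hη
  nlinarith

theorem Envelope.lyap_eq_pow (e : Envelope) (k : ℕ) (x : State) :
    e.lyap k x = e.lyap 1 x ^ k := by
  rw [Envelope.lyap, Envelope.lyap, ← Real.exp_nat_mul]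
  push_cast
  ring_nf

/-- Decouples the size of the parameter step, governed by the old state, from the Lipschitz factor
at the new state. It is the reason why third exponential moments are used. -/
theorem mul_lyap_le (e : Envelope) (x y : State) :
    e.lyap 1 x * e.lyap 2 y ≤ e.lyap 3 x + e.lyap 3 y := by
  rw [e.lyap_eq_pow 2 y, e.lyap_eq_pow 3 x, e.lyap_eq_pow 3 y]
  have ha := e.lyap_pos 1 x
  have hb := e.lyap_pos 1 y
  generalize e.lyap 1 x = a at *
  generalize e.lyap 1 y = b at *
  rcases le_total a b with hab | hab
  · have : a * b ^ 2 ≤ b * b ^ 2 := mul_le_mul_of_nonneg_right hab (by positivity)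
    have : 0 < a ^ 3 := by positivity
    nlinarith
  · have : a * b ^ 2 ≤ a * a ^ 2 :=
      mul_le_mul_of_nonneg_left (pow_le_pow_left₀ hb.le hab 2) (by positivity)
    have : 0 < b ^ 3 := by positivity
    nlinarith

/-- With G_t = E[potential(ϑ_t, x_t)], Poisson's equation writes the noise term as G_t -
E[potential(ϑ_t, x_{t+1})]. Replacing ϑ_t by ϑ_{t+1} in the last expectation costs O(η_t), because
the parameter moves by at most η_t‖H‖. The constants precede the step sizes and the starting point,
so they are uniform in both. -/
theorem exists_msErr_recursion (hUV : DrivingSequences P U V) (hS : UniformStability M)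
    (h : e.Bounds (P.map (U 0)) (P.map (V 0))) (hU2 : MemLp (U 0) 2 P) (hV2 : MemLp (V 0) 2 P)
    (hmem : ∀ ϑ ∈ M.box, M.means ϑ ∈ e.rect) (hμ : 0 < M.μlo) {CΘ K₀ K₁ : ℝ}
    (hC : ConvexSmooth M P U V θ CΘ K₀ K₁) :
    ∃ C B, 0 ≤ C ∧ 0 ≤ B ∧ ∀ η : ℕ → ℝ, (∀ t, 1 ≤ t → 0 ≤ η t) → ∀ ϑ₁ ∈ M.box,
      ∃ G : ℕ → ℝ, G 1 = 0 ∧ (∀ t, 1 ≤ t → |G t| ≤ B) ∧ ∀ t, 1 ≤ t →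
        msErr M P U V η ϑ₁ θ (t + 1) ≤ (1 - 2 * K₀ * η t) * msErr M P U V η ϑ₁ θ t +
          2 * η t * (G (t + 1) - G t) + C * η t ^ 2 := by
  have : IsProbabilityMeasure (P.map (U 0)) :=
    Measure.isProbabilityMeasure_map (hUV.measurable_U 0).aemeasurable
  have : IsProbabilityMeasure (P.map (V 0)) :=
    Measure.isProbabilityMeasure_map (hUV.measurable_V 0).aemeasurable
  obtain ⟨⟨m1, m2⟩, m3, m4⟩ := Problem.mem_Ioo_of_mem_interior hC.inner_point
  have hμ' : M.μlo < M.μhi := m1.trans m2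
  have hp : M.plo < M.phi := m3.trans m4
  have hθbox : θ ∈ M.box := interior_subset hC.inner_point
  have hθ := h.θ_pos
  have hσ := h.σ_pos
  have hρ : 0 < 1 - e.ρ := by linarith [h.ρ_lt_one]
  obtain ⟨K, hKe⟩ : ∃ K, K = 1 / e.θ + 1 / e.σ := ⟨_, rfl⟩
  have hK : 0 ≤ K := by rw [hKe]; positivity
  have hφ : IsCost e (fun x => x.1 + x.2) K := hKe ▸ isCost_add h
  obtain ⟨Bψ, Lψ, hBψ, -, bψ, -⟩ := Problem.boundedLipschitzOn_noiseWeight hS hμ hp θ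
  obtain ⟨CH, hCH, bH⟩ := Problem.exists_norm_gradEst_le hS hμ hμ' hp h
  obtain ⟨CN, hCN, bN⟩ := exists_noisePotential_lipschitz h hS hmem hμ hp θ
  obtain ⟨Cp, hCp, bp⟩ := poisson_bound h hK hφ
  -- The factor 4 is the prefactor 2η times the two Lyapunov moments in `hlast`; the last summand
  -- bounds E‖H‖².
  refine ⟨4 * (CN * CH * (1 / (1 - e.ρ))) + CH ^ 2 * (1 / (1 - e.ρ)), Bψ * Cp * (1 / (1 - e.ρ)),
    by positivity, by positivity, fun η hη ϑ₁ hϑ₁ => ?_⟩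
  have hc := controlledChain_samcmc (e := e) hUV hS hmem hμ hμ' hp η hϑ₁
  have hbox : ∀ t ω, (samcmc M U V η ϑ₁ t ω).1 ∈ M.box :=
    fun t ω => samcmc_mem_box hμ'.le hp.le hϑ₁ t ω
  have hmϑ : ∀ n, Measurable[history U V (n + 1)] fun ω => (samcmc M U V η ϑ₁ (n + 1) ω).1 :=
    fun n => (measurable_samcmc hS hμ hμ' hp hϑ₁ n).1
  have hmϑ' : ∀ n, Measurable fun ω => (samcmc M U V η ϑ₁ (n + 1) ω).1 :=
    fun n => (hmϑ n).mono (history_le hUV _) le_rfl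
  have hmψ : ∀ n, Measurable[history U V (n + 1)]
      fun ω => M.noiseWeight θ (samcmc M U V η ϑ₁ (n + 1) ω).1 := fun n =>
    (Problem.boundedLipschitzOn_noiseWeight hS hμ hp θ).continuousOn.measurable_comp_of_mem
      (hmϑ n) (hbox _)
  have hmψ' : ∀ n, Measurable fun ω => M.noiseWeight θ (samcmc M U V η ϑ₁ (n + 1) ω).1 :=
    fun n => (hmψ n).mono (history_le hUV _) le_rfl
  have hbψ : ∀ n ω, |M.noiseWeight θ (samcmc M U V η ϑ₁ (n + 1) ω).1| ≤ Bψ :=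
    fun n ω => bψ _ (hbox _ ω)
  obtain ⟨ν, hν⟩ : ∃ ν, ν = (P.map (U 0)).prod (P.map (V 0)) := ⟨_, rfl⟩
  refine ⟨fun t => ∫ ω, noisePotential M ν θ (samcmc M U V η ϑ₁ t ω).1
    (samcmc M U V η ϑ₁ t ω).2 ∂P, ?_, ?_, ?_⟩
  -- The algorithm starts from the empty state, where the Poisson solution vanishes.
  · have : ∀ ω : Ω, noisePotential M ν θ (samcmc M U V η ϑ₁ 1 ω).1
        (samcmc M U V η ϑ₁ 1 ω).2 = 0 := by
      intro ω
      have e0 := poisson_zero (φ := fun x : State => x.1 + x.2) h (hmem _ (hbox 1 ω))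
      rw [← hν] at e0
      rw [noisePotential]
      refine mul_eq_zero_of_right _ e0
    simp [this]
  · intro t ht
    obtain ⟨n, rfl⟩ := Nat.exists_eq_add_of_le' ht
    refine hc.abs_integral_le_of_le_lyap h n (k := 1) le_rfl (by norm_num) (by positivity)
      fun ω hω => ?_
    rw [noisePotential, abs_mul, mul_assoc, hν]
    exact mul_le_mul (hbψ n ω) (bp _ (hmem _ (hbox _ ω)) _ hω) (abs_nonneg _) hBψ
  · intro t ht
    obtain ⟨n, rfl⟩ := Nat.exists_eq_add_of_le' ht
    have hη0 := hη (n + 1) ht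
    have hmean : ∀ q ∈ e.rect, statMean ν (fun x => x.1 + x.2) q =
        statMean (drivingLaw P U V) Prod.fst q + statMean (drivingLaw P U V) Prod.snd q := by
      intro q hq
      rw [hν]
      exact statMean_add hUV h (by positivity) (by positivity) (isCost_fst h) (isCost_snd h)
        (isCost_add h) hq
    have hint : (interior M.box).Nonempty := ⟨θ, hC.inner_point⟩
    have iA : ∀ n, Integrable (fun ω => ‖(samcmc M U V η ϑ₁ (n + 1) ω).1 - θ‖ ^ 2) P := by
      intro n
      refine Integrable.of_bound (((hmϑ' n).sub_const θ).norm.pow_const 2).aestronglyMeasurable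
        ((CΘ + CΘ) ^ 2) (ae_of_all _ fun ω => ?_)
      rw [norm_pow, norm_norm]
      exact pow_le_pow_left₀ (norm_nonneg _) ((norm_sub_le _ _).trans
        (add_le_add (hC.bounded _ (hbox _ ω)) (hC.bounded _ hθbox))) 2
    have iT : Integrable (fun ω => M.noiseWeight θ (samcmc M U V η ϑ₁ (n + 1) ω).1 *
        (((samcmc M U V η ϑ₁ (n + 1) ω).2.1 + (samcmc M U V η ϑ₁ (n + 1) ω).2.2) -
          statMean ν (fun x => x.1 + x.2) (M.means (samcmc M U V η ϑ₁ (n + 1) ω).1))) P := by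
      rw [hν]
      exact hc.integrable_mul_sub_statMean h hK hφ n (hmψ' n) (hbψ n)
    have iH : Integrable (fun ω => ‖gradEst M (samcmc M U V η ϑ₁ (n + 1) ω).1
        (samcmc M U V η ϑ₁ (n + 1) ω).2‖ ^ 2) P ∧
        ∫ ω, ‖gradEst M (samcmc M U V η ϑ₁ (n + 1) ω).1
          (samcmc M U V η ϑ₁ (n + 1) ω).2‖ ^ 2 ∂P ≤ CH ^ 2 * (1 / (1 - e.ρ)) := by
      have hb : ∀ ω, (samcmc M U V η ϑ₁ (n + 1) ω).2 ∈ quadrant →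
          |‖gradEst M (samcmc M U V η ϑ₁ (n + 1) ω).1 (samcmc M U V η ϑ₁ (n + 1) ω).2‖ ^ 2| ≤
            CH ^ 2 * e.lyap 2 (samcmc M U V η ϑ₁ (n + 1) ω).2 := by
        intro ω hω
        rw [abs_of_nonneg (sq_nonneg _), e.lyap_eq_pow 2, ← mul_pow]
        exact pow_le_pow_left₀ (norm_nonneg _) (bH _ (hbox _ ω) _ hω) 2
      refine ⟨hc.integrable_of_le_lyap h n (by norm_num) (by norm_num)
        ((Problem.measurable_gradEst hS hμ hμ' hp (hmϑ' n) (hbox _)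
          (hc.measurable_state n)).norm.pow_const 2) hb, ?_⟩
      exact (le_abs_self _).trans (hc.abs_integral_le_of_le_lyap h n (by norm_num) (by norm_num)
        (by positivity) hb)
    have step : ∀ ω, ‖(samcmc M U V η ϑ₁ (n + 1 + 1) ω).1 - θ‖ ^ 2 ≤
        (1 - 2 * K₀ * η (n + 1)) * ‖(samcmc M U V η ϑ₁ (n + 1) ω).1 - θ‖ ^ 2 -
        2 * η (n + 1) * (M.noiseWeight θ (samcmc M U V η ϑ₁ (n + 1) ω).1 *
          (((samcmc M U V η ϑ₁ (n + 1) ω).2.1 + (samcmc M U V η ϑ₁ (n + 1) ω).2.2) -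
          statMean ν (fun x => x.1 + x.2) (M.means (samcmc M U V η ϑ₁ (n + 1) ω).1))) +
        η (n + 1) ^ 2 * ‖gradEst M (samcmc M U V η ϑ₁ (n + 1) ω).1
          (samcmc M U V η ϑ₁ (n + 1) ω).2‖ ^ 2 := by
      intro ω
      have hb := hbox (n + 1) ω
      rw [hmean _ (hmem _ hb)]
      exact norm_proj_step_sq_le hη0 hθbox
        (gradObjective_eq hUV hS h hU2 hV2 hmem hint hb) (hC.monotone _ hb)
    have main := integral_le_of_forall_le (iA (n + 1)) (iA n) iT iH.1 step
    have hpois := hc.integral_poisson h hK hφ n (hmψ n) (hbψ n)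
    rw [← hν] at hpois
    have j1 := hc.integrable_mul_poisson h hK hφ n (n + 1) (hmψ' n) (hbψ n)
    have j2 := hc.integrable_mul_poisson h hK hφ (n + 1) (n + 1) (hmψ' (n + 1)) (hbψ (n + 1))
    rw [← hν] at j1 j2
    have hlast : |∫ ω, (noisePotential M ν θ (samcmc M U V η ϑ₁ (n + 1 + 1) ω).1
          (samcmc M U V η ϑ₁ (n + 1 + 1) ω).2 -
        noisePotential M ν θ (samcmc M U V η ϑ₁ (n + 1) ω).1
          (samcmc M U V η ϑ₁ (n + 1 + 1) ω).2) ∂P| ≤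
        CN * CH * η (n + 1) * (1 / (1 - e.ρ) + 1 / (1 - e.ρ)) := by
      have il1 := hc.integrable_lyap h n (k := 3) (by norm_num) (by norm_num)
      have il2 := hc.integrable_lyap h (n + 1) (k := 3) (by norm_num) (by norm_num)
      have hb : ∀ᵐ ω ∂P, ‖noisePotential M ν θ (samcmc M U V η ϑ₁ (n + 1 + 1) ω).1
          (samcmc M U V η ϑ₁ (n + 1 + 1) ω).2 -
        noisePotential M ν θ (samcmc M U V η ϑ₁ (n + 1) ω).1
          (samcmc M U V η ϑ₁ (n + 1 + 1) ω).2‖ ≤ CN * CH * η (n + 1) *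
            (e.lyap 3 (samcmc M U V η ϑ₁ (n + 1) ω).2 +
              e.lyap 3 (samcmc M U V η ϑ₁ (n + 1 + 1) ω).2) := by
        filter_upwards [hc.ae_mem_quadrant h] with ω hω
        have b1 := bN _ (hbox (n + 1 + 1) ω) _ (hbox (n + 1) ω) _ (hω (n + 1))
        rw [← hν] at b1
        have b2 : ‖(samcmc M U V η ϑ₁ (n + 1 + 1) ω).1 - (samcmc M U V η ϑ₁ (n + 1) ω).1‖ ≤
            η (n + 1) * (CH * e.lyap 1 (samcmc M U V η ϑ₁ (n + 1) ω).2) := by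
          refine (M.norm_proj_sub_le _ (hbox (n + 1) ω)).trans ?_
          rw [sub_sub_cancel_left, norm_neg, norm_smul, Real.norm_eq_abs, abs_of_nonneg hη0]
          exact mul_le_mul_of_nonneg_left (bH _ (hbox _ ω) _ (hω n)) hη0
        rw [Real.norm_eq_abs]
        refine b1.trans ((mul_le_mul_of_nonneg_right (mul_le_mul_of_nonneg_left b2 hCN)
          (e.lyap_pos _ _).le).trans ?_)
        have b3 := mul_le_mul_of_nonneg_left (mul_lyap_le e (samcmc M U V η ϑ₁ (n + 1) ω).2
          (samcmc M U V η ϑ₁ (n + 1 + 1) ω).2) (by positivity : 0 ≤ CN * CH * η (n + 1))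
        refine le_trans (le_of_eq ?_) b3
        ring
      refine (norm_integral_le_of_norm_le ((il1.add il2).const_mul _) hb).trans ?_
      rw [integral_const_mul, integral_add' il1 il2]
      exact mul_le_mul_of_nonneg_left (add_le_add
        (hc.integral_lyap_le h n (by norm_num) (by norm_num))
        (hc.integral_lyap_le h (n + 1) (by norm_num) (by norm_num))) (by positivity)
    have hsub := integral_sub j2 j1
    have hG' := neg_le_of_abs_le hlast
    simp only [noisePotential] at hG' ⊢
    rw [hsub] at hG'
    rw [hpois] at main
    have t1 := mul_le_mul_of_nonneg_left hG' (by positivity : 0 ≤ 2 * η (n + 1))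
    have t2 := mul_le_mul_of_nonneg_left iH.2 (sq_nonneg (η (n + 1)))
    simp only [msErr]
    linarith

end Recursion

/-! ### Solving the recursion -/

/-- One step of the recursion for `Δ_t - 2 η_{t-1} G_t`, with a transient part `a`. -/
theorem recursion_step {K C B G₀ η' η Δ Δ' G G' a : ℝ} (hK : 0 < K) (hK1 : K ≤ 1) (hC : 0 ≤ C)
    (hη : 0 < η) (hle : η ≤ η') (hslow : 1 / η - 1 / η' ≤ K / 2) (hη' : η' * K ≤ 2)
    (hsmall : 2 * K * η ≤ 1) (hG : |G| ≤ G₀) (ha : 0 ≤ a) (hB : C + 10 * G₀ ≤ B * K)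
    (hrec : Δ' ≤ (1 - 2 * K * η) * Δ + 2 * η * (G' - G) + C * η ^ 2)
    (hΔ : Δ - 2 * η' * G ≤ a + B * η') : Δ' - 2 * η * G' ≤ (1 - K * η) * a + B * η := by
  have hη'0 : 0 < η' := hη.trans_le hle
  have hG0 : 0 ≤ G₀ := (abs_nonneg _).trans hG
  have hB0 : 0 ≤ B := by
    by_contra hneg
    have := mul_neg_of_neg_of_pos (not_le.1 hneg) hK
    linarith
  -- Slow variation of 1/η rewritten for η. With η'K ≤ 2 it yields η' ≤ 2η, and then η' - η ≤ Kη².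
  have hdiff : η' - η ≤ η * η' * (K / 2) := by
    have h1 := mul_le_mul_of_nonneg_left hslow (mul_pos hη hη'0).le
    have h2 : η * η' * (1 / η - 1 / η') = η' - η := by field_simp
    linarith
  have htwo : η' ≤ 2 * η := by nlinarith
  have hprod : η * η' ≤ 2 * η ^ 2 := by nlinarith
  have hdiff' : η' - η ≤ K * η ^ 2 := by nlinarith
  have hg1 : 2 * (G * (η' - η)) ≤ 2 * (G₀ * (K * η ^ 2)) := by
    have h1 : G * (η' - η) ≤ G₀ * (η' - η) :=
      mul_le_mul_of_nonneg_right ((le_abs_self _).trans hG) (by linarith)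
    have h2 := mul_le_mul_of_nonneg_left hdiff' hG0
    linarith
  have hg2 : -(4 * K * (η * η') * G) ≤ 4 * K * (2 * η ^ 2) * G₀ := by
    have h1 : -G ≤ G₀ := (neg_le_abs _).trans hG
    have h2 : 4 * K * (η * η') * (-G) ≤ 4 * K * (η * η') * G₀ :=
      mul_le_mul_of_nonneg_left h1 (by positivity)
    have h3 : 4 * K * (η * η') * G₀ ≤ 4 * K * (2 * η ^ 2) * G₀ :=
      mul_le_mul_of_nonneg_right (mul_le_mul_of_nonneg_left hprod (by positivity)) hG0
    linarith
  have hg3 : K * η ^ 2 * G₀ ≤ 1 * η ^ 2 * G₀ := by gcongr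
  have hmain := mul_le_mul_of_nonneg_left hΔ (by linarith : 0 ≤ 1 - 2 * K * η)
  have ha' : 0 ≤ K * η * a := by positivity
  have hb1 : B * (η' - η) ≤ B * (K * η ^ 2) := mul_le_mul_of_nonneg_left hdiff' hB0
  have hb2 : B * (2 * K * η * η) ≤ B * (2 * K * η * η') := by gcongr
  -- Of the contraction -2KBηη', one part KBη² pays for B(η' - η). The remaining KBη² absorbs Cη²
  -- and the G-terms, which are at most 2G₀η² + 8G₀η²; hence the constant 10.
  have hb3 := mul_le_mul_of_nonneg_right hB (sq_nonneg η)
  nlinarith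

/-- Induction on Δ_{t+1} - 2η_t G_{t+1}; the correction is put back at the end, at the price 2G₀η_t.
-/
theorem recursion_bound {K C B G₀ : ℝ} {η Δ G : ℕ → ℝ} (hK : 0 < K) (hK1 : K ≤ 1) (hC : 0 ≤ C)
    (hη : ∀ t, 1 ≤ t → 0 < η t) (hanti : ∀ s t, 1 ≤ s → s ≤ t → η t ≤ η s)
    (hslow : ∀ t, 2 ≤ t → 1 / η t - 1 / η (t - 1) ≤ K / 2) (hsmall : ∀ t, 1 ≤ t → 2 * η t ≤ 1)
    (hG1 : G 1 = 0) (hG : ∀ t, 1 ≤ t → |G t| ≤ G₀) (hΔ : 0 ≤ Δ 1) (hB : C + 10 * G₀ ≤ B * K)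
    (hrec : ∀ t, 1 ≤ t →
      Δ (t + 1) ≤ (1 - 2 * K * η t) * Δ t + 2 * η t * (G (t + 1) - G t) + C * η t ^ 2)
    {t : ℕ} (ht : 1 ≤ t) :
    Δ (t + 1) ≤ (∏ s ∈ Finset.Icc 2 t, (1 - K * η s)) * Δ 1 + η t * (B + 2 * G₀) := by
  have hG0 : 0 ≤ G₀ := (abs_nonneg _).trans (hG 1 le_rfl)
  have hsm : ∀ t, 1 ≤ t → 2 * K * η t ≤ 1 := fun t ht => by
    nlinarith [hsmall t ht, hη t ht]
  have key : ∀ t, 1 ≤ t → 0 ≤ ∏ s ∈ Finset.Icc 2 t, (1 - K * η s) ∧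
      Δ (t + 1) - 2 * η t * G (t + 1) ≤
        (∏ s ∈ Finset.Icc 2 t, (1 - K * η s)) * Δ 1 + B * η t := by
    intro t ht
    induction t, ht using Nat.le_induction with
    -- The contraction of the first step is discarded, which is why the product starts at 2. The
    -- boundary term disappears because G 1 = 0.
    | base =>
      refine ⟨by simp, ?_⟩
      have h1 := hrec 1 le_rfl
      have h2 := hη 1 le_rfl
      have h3 := hsmall 1 le_rfl
      have hCB : C ≤ B := by
        by_contra hneg
        have : B * K < C := by
          rcases le_total 0 B with h0 | h0 <;> nlinarith
        linarith
      have h4 : 0 ≤ K * η 1 * Δ 1 := by positivity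
      have h5 : C * η 1 ^ 2 ≤ B * η 1 := by
        have : η 1 ^ 2 ≤ η 1 := by nlinarith
        exact mul_le_mul hCB this (sq_nonneg _) (hC.trans hCB)
      rw [hG1] at h1
      simp only [Finset.Icc_eq_empty (by norm_num : ¬ 2 ≤ 1), Finset.prod_empty]
      linarith
    | succ t ht ih =>
      have ht' : 1 ≤ t + 1 := by omega
      have hfac : ∏ s ∈ Finset.Icc 2 (t + 1), (1 - K * η s) =
          (1 - K * η (t + 1)) * ∏ s ∈ Finset.Icc 2 t, (1 - K * η s) := by
        rw [Finset.prod_Icc_succ_top (by omega), mul_comm]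
      have hpos : 0 ≤ 1 - K * η (t + 1) := by
        have := hsm (t + 1) ht'
        have := mul_pos hK (hη (t + 1) ht')
        linarith
      rw [hfac]
      refine ⟨mul_nonneg hpos ih.1, ?_⟩
      rw [mul_assoc (1 - K * η (t + 1))]
      have hs := hslow (t + 1) (by omega)
      rw [Nat.add_sub_cancel] at hs
      refine recursion_step hK hK1 hC (hη _ ht') (hanti t (t + 1) ht (by omega)) hs ?_
        (hsm _ ht') (hG _ ht') (mul_nonneg ih.1 hΔ) hB (hrec _ ht') ih.2
      have := hsm t ht
      linarith
  have h1 := (key t ht).2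
  have h2 : 2 * η t * G (t + 1) ≤ 2 * η t * G₀ :=
    mul_le_mul_of_nonneg_left ((le_abs_self _).trans (hG _ (by omega)))
      (by have := hη t ht; positivity)
  linarith

/-- For η_t = γ/t the increment of 1/η is 1/γ ≤ K/2, so `recursion_step` applies once η is small.
Early times, where γ/t may be large, are covered by the a priori bound D. -/
theorem recursion_bound_harmonic {K C G₀ D γ : ℝ} (hK : 0 < K) (hK1 : K ≤ 1) (hC : 0 ≤ C)
    (hG₀ : 0 ≤ G₀) (hD : 0 ≤ D) (hγ : 2 / K ≤ γ) :
    ∃ C', 0 < C' ∧ ∀ Δ G : ℕ → ℝ, (∀ t, Δ t ≤ D) → (∀ t, 1 ≤ t → |G t| ≤ G₀) →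
      (∀ t, 1 ≤ t → Δ (t + 1) ≤ (1 - 2 * K * (γ / t)) * Δ t +
        2 * (γ / t) * (G (t + 1) - G t) + C * (γ / t) ^ 2) →
      ∀ t, 1 ≤ t → Δ t ≤ C' / t := by
  have hγ0 : 0 < γ := lt_of_lt_of_le (by positivity) hγ
  obtain ⟨t₀, ht₀⟩ := exists_nat_ge (2 * K * γ + 1)
  have ht₀1 : (1 : ℝ) ≤ t₀ := le_trans (by linarith [mul_pos hK hγ0]) ht₀
  have ht₀' : 1 ≤ t₀ := by exact_mod_cast ht₀1
  -- The first summand meets the requirement of `recursion_step`; the second is large enough to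
  -- start the induction at t₀ with no transient part.
  obtain ⟨B, hBdef⟩ : ∃ B, B = (C + 10 * G₀) / K + (D + 2 * (γ / t₀) * G₀) * t₀ / γ := ⟨_, rfl⟩
  have hB1 : C + 10 * G₀ ≤ B * K := by
    rw [hBdef, add_mul, div_mul_cancel₀ _ hK.ne']
    have : 0 ≤ (D + 2 * (γ / t₀) * G₀) * t₀ / γ * K := by positivity
    linarith
  have hB2 : D + 2 * (γ / t₀) * G₀ ≤ B * (γ / t₀) := by
    have e1 : B * (γ / t₀) = (C + 10 * G₀) / K * (γ / t₀) + (D + 2 * (γ / t₀) * G₀) := by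
      rw [hBdef]
      field_simp
    have : 0 ≤ (C + 10 * G₀) / K * (γ / t₀) := by positivity
    linarith
  have hB0 : 0 ≤ B := by rw [hBdef]; positivity
  refine ⟨2 * γ * (B + 2 * G₀) + D * t₀ + 1, by positivity, fun Δ G hΔ hG hrec t ht => ?_⟩
  have htpos : (0 : ℝ) < t := by exact_mod_cast ht
  rw [le_div_iff₀ htpos]
  rcases le_or_gt t t₀ with hle | hlt
  · have h1 : Δ t * t ≤ D * t := mul_le_mul_of_nonneg_right (hΔ t) htpos.le
    have h2 : D * t ≤ D * t₀ := mul_le_mul_of_nonneg_left (by exact_mod_cast hle) hD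
    have h3 : 0 ≤ 2 * γ * (B + 2 * G₀) := by positivity
    linarith
  · have key : ∀ t, t₀ ≤ t → Δ (t + 1) - 2 * (γ / t) * G (t + 1) ≤ 0 + B * (γ / t) := by
      intro t ht
      induction t, ht using Nat.le_induction with
      | base =>
        have h1 : -(2 * (γ / t₀) * G (t₀ + 1)) ≤ 2 * (γ / t₀) * G₀ := by
          rw [← mul_neg]
          exact mul_le_mul_of_nonneg_left ((neg_le_abs _).trans (hG _ (by omega)))
            (by positivity)
        linarith [hΔ (t₀ + 1)]
      | succ t ht ih =>
        have hr : (t₀ : ℝ) ≤ t := by exact_mod_cast ht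
        have htp : (0 : ℝ) < t := by linarith
        have hr' := hrec (t + 1) (by omega)
        push_cast at hr' ⊢
        have e1 : γ / t * K ≤ 2 := by
          rw [div_mul_eq_mul_div, div_le_iff₀ htp]
          nlinarith [mul_pos hK hγ0]
        have e2 : 2 * K * (γ / (t + 1)) ≤ 1 := by
          rw [← mul_div_assoc, div_le_one (by positivity)]
          linarith
        have e3 : 1 / (γ / ((t : ℝ) + 1)) - 1 / (γ / t) ≤ K / 2 := by
          have : 1 / (γ / ((t : ℝ) + 1)) - 1 / (γ / t) = 1 / γ := by field_simp; ring
          rw [this]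
          calc 1 / γ ≤ 1 / (2 / K) := one_div_le_one_div_of_le (by positivity) hγ
            _ = K / 2 := by rw [one_div_div]
        have := recursion_step hK hK1 hC (by positivity : 0 < γ / ((t : ℝ) + 1))
          (div_le_div_of_nonneg_left hγ0.le htp (by linarith)) e3 e1 e2 (hG (t + 1) (by omega))
          le_rfl hB1 hr' ih
        simpa using this
    obtain ⟨s, rfl⟩ : ∃ s, t = s + 1 := ⟨t - 1, by omega⟩
    have hs : t₀ ≤ s := by omega
    have hsr : (1 : ℝ) ≤ s := ht₀1.trans (by exact_mod_cast hs)
    have h1 := key s hs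
    have h2 : 2 * (γ / s) * G (s + 1) ≤ 2 * (γ / s) * G₀ :=
      mul_le_mul_of_nonneg_left ((le_abs_self _).trans (hG _ (by omega))) (by positivity)
    have h3 : Δ (s + 1) ≤ γ / s * (B + 2 * G₀) := by linarith
    have h4 := mul_le_mul_of_nonneg_right h3 (by positivity : (0 : ℝ) ≤ (s : ℝ) + 1)
    have h5 : γ / s * (B + 2 * G₀) * ((s : ℝ) + 1) ≤ 2 * γ * (B + 2 * G₀) := by
      have : γ / s * ((s : ℝ) + 1) ≤ 2 * γ := by
        rw [div_mul_eq_mul_div, div_le_iff₀ (by linarith)]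
        nlinarith
      have := mul_le_mul_of_nonneg_right this (by positivity : 0 ≤ B + 2 * G₀)
      linarith
    push_cast
    have : 0 ≤ D * t₀ := by positivity
    linarith

/-! ### Transfer of the assumptions -/

theorem msErr_nonneg {Ω : Type*} [MeasurableSpace Ω] {P : Measure Ω} {U V : ℕ → Ω → ℝ}
    {M : Problem} (η : ℕ → ℝ) (ϑ₁ θ : Param) (t : ℕ) : 0 ≤ msErr M P U V η ϑ₁ θ t :=
  integral_nonneg fun _ => sq_nonneg _

section Transfer

variable {Ω : Type*} [mΩ : MeasurableSpace Ω] {P : Measure Ω} [IsProbabilityMeasure P]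
  {U V : ℕ → Ω → ℝ} {M : Problem}

/-- Monotonicity of the demand maps the box into [1/μhi, 1/μlo] × [1/λ(plo), 1/λ(phi)], and λ(plo) <
μlo is exactly the strict gap α0 < β0. -/
theorem exists_bounds (hUV : DrivingSequences P U V) (hS : UniformStability M)
    (hT : LightTails M P U V) (hμ : M.μlo < M.μhi) (hp : M.plo < M.phi) :
    0 < M.μlo ∧ MemLp (U 0) 2 P ∧ MemLp (V 0) 2 P ∧
      ∃ e : Envelope, e.Bounds (P.map (U 0)) (P.map (V 0)) ∧
        ∀ ϑ ∈ M.box, M.means ϑ ∈ e.rect := by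
  have : IsProbabilityMeasure (P.map (U 0)) :=
    Measure.isProbabilityMeasure_map (hUV.measurable_U 0).aemeasurable
  have : IsProbabilityMeasure (P.map (V 0)) :=
    Measure.isProbabilityMeasure_map (hUV.measurable_V 0).aemeasurable
  have aU := (hUV.measurable_U 0).aemeasurable (μ := P)
  have aV := (hUV.measurable_V 0).aemeasurable (μ := P)
  have hl1 : 0 < M.lam M.plo := hS.lam_pos _ (Set.left_mem_Icc.2 hp.le)
  have hl2 : 0 < M.lam M.phi := hS.lam_pos _ (Set.right_mem_Icc.2 hp.le)
  have hμ0 : 0 < M.μlo := hl1.trans hS.stable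
  obtain ⟨ε, hε, hV, hU, -⟩ := hT
  obtain ⟨b, hb⟩ := hUV.bounded_density
  have nU : ∀ᵐ u ∂(P.map (U 0)), 0 ≤ u :=
    (ae_map_iff aU measurableSet_Ici).2 (hUV.nonneg_U 0)
  have nV : ∀ᵐ u ∂(P.map (V 0)), 0 ≤ u :=
    (ae_map_iff aV measurableSet_Ici).2 (hUV.nonneg_V 0)
  have me : Measurable fun u : ℝ => Real.exp (ε * u) := by fun_prop
  have eU : Integrable (fun u => Real.exp (ε * u)) (P.map (U 0)) :=
    (integrable_map_measure me.aestronglyMeasurable aU).2 hU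
  have eV : Integrable (fun u => Real.exp (ε * u)) (P.map (V 0)) :=
    (integrable_map_measure me.aestronglyMeasurable aV).2 hV
  have hLp : ∀ {X : Ω → ℝ}, AEMeasurable X P → (∀ᵐ u ∂(P.map X), 0 ≤ u) →
      Integrable (fun u => Real.exp (ε * u)) (P.map X) → MemLp X 2 P := by
    intro X hX h0 hexp
    have h1 := memLp_of_mem_interior_integrableExpSet
      (zero_mem_interior_integrableExpSet h0 hε hexp) 2
    exact (memLp_map_measure_iff aestronglyMeasurable_id hX).1 h1
  obtain ⟨e, he, e1, e2, e3, e4⟩ := exists_envelope nU nV hε eU eV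
    ((integral_map aU aestronglyMeasurable_id).trans hUV.mean_U)
    ((integral_map aV aestronglyMeasurable_id).trans hUV.mean_V) hb
    (one_div_pos.2 (hμ0.trans hμ)) (one_div_le_one_div_of_le hμ0 hμ.le)
    (one_div_lt_one_div_of_lt hl1 hS.stable)
    (one_div_le_one_div_of_le hl2 (hS.lam_anti (Set.left_mem_Icc.2 hp.le)
      (Set.right_mem_Icc.2 hp.le) hp.le))
  refine ⟨hμ0, hLp aU nU eU, hLp aV nV eV, e, he, fun ϑ hϑ => ?_⟩
  rw [Envelope.rect, e1, e2, e3, e4]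
  refine ⟨⟨one_div_le_one_div_of_le (hμ0.trans_le hϑ.1.1) hϑ.1.2,
    one_div_le_one_div_of_le hμ0 hϑ.1.1⟩, one_div_le_one_div_of_le (hS.lam_pos _ hϑ.2)
      (hS.lam_anti (Set.left_mem_Icc.2 hp.le) hϑ.2 hϑ.2.1), one_div_le_one_div_of_le hl2
      (hS.lam_anti hϑ.2 (Set.right_mem_Icc.2 hp.le) hϑ.2.2)⟩

theorem msErr_le {θ : Param} {R : ℝ} (hR : ∀ ϑ ∈ M.box, ‖ϑ‖ ≤ R) (hθ : θ ∈ M.box)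
    (hμ : M.μlo ≤ M.μhi) (hp : M.plo ≤ M.phi) (η : ℕ → ℝ) {ϑ₁ : Param} (hϑ₁ : ϑ₁ ∈ M.box)
    (t : ℕ) : msErr M P U V η ϑ₁ θ t ≤ (R + R) ^ 2 := by
  refine (le_abs_self _).trans ?_
  have h := norm_integral_le_of_norm_le_const (μ := P) (C := (R + R) ^ 2)
    (f := fun ω => ‖(samcmc M U V η ϑ₁ t ω).1 - θ‖ ^ 2) (ae_of_all _ fun ω => ?_)
  · rwa [probReal_univ, mul_one] at h
  · rw [norm_pow, norm_norm]
    exact pow_le_pow_left₀ (norm_nonneg _) ((norm_sub_le _ _).trans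
      (add_le_add (hR _ (samcmc_mem_box hμ hp hϑ₁ t ω)) (hR _ hθ))) 2

end Transfer

end GIGI1

end

theorem theorem1 {Ω : Type*} [MeasurableSpace Ω] (P : Measure Ω) [IsProbabilityMeasure P]
    (U V : ℕ → Ω → ℝ) (M : Problem) (θ : Param) (CΘ K₀ K₁ : ℝ)
    (hUV : DrivingSequences P U V)
    (hStable : UniformStability M)
    (hTails : LightTails M P U V)
    (hConvex : ConvexSmooth M P U V θ CΘ K₀ K₁) :
    (∃ Δbar Cstar : ℝ, 0 < Δbar ∧ 0 < Cstar ∧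
      ∀ (ϰ κ : ℝ) (η : ℕ → ℝ), StepSizes K₀ ϰ κ η →
        ∀ ϑ₁ ∈ M.box, ∀ t : ℕ, 1 ≤ t →
          msErr M P U V η ϑ₁ θ (t + 1) ≤
            (∏ s ∈ Finset.Icc 2 t, (1 - K₀ * η s)) * msErr M P U V η ϑ₁ θ 1
              + η t * ((1 + 8 * κ) * Δbar + 18 * κ * Cstar)) ∧
    (∀ γ : ℝ, 2 / K₀ ≤ γ → ∃ C : ℝ, 0 < C ∧
      ∀ ϑ₁ ∈ M.box, ∀ t : ℕ, 1 ≤ t →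
        msErr M P U V (fun s => γ / s) ϑ₁ θ t ≤ C / t) := by
  obtain ⟨⟨m1, m2⟩, m3, m4⟩ := Problem.mem_Ioo_of_mem_interior hConvex.inner_point
  obtain ⟨hμ, hU2, hV2, e, he, hmem⟩ := exists_bounds hUV hStable hTails (m1.trans m2) (m3.trans m4)
  obtain ⟨C, B, hC, hB, hrec⟩ := exists_msErr_recursion hUV hStable he hU2 hV2 hmem hμ hConvex
  have hK := hConvex.K₀_pos
  -- The bound holds without the κ-terms, which are nonnegative and only enlarge the right-hand
  -- side. The summand 1 ensures positivity.
  refine ⟨⟨(C + 10 * B) / K₀ + 2 * B + 1, 1, by positivity, one_pos,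
    fun ϰ κ η hη ϑ₁ hϑ₁ t ht => ?_⟩, fun γ hγ => ?_⟩
  · obtain ⟨G, hG1, hG, hG'⟩ := hrec η (fun t ht => (hη.pos t ht).le) ϑ₁ hϑ₁
    have h1 := recursion_bound hK hConvex.K₀_le_one hC hη.pos hη.decreasing
      (fun t ht => (le_abs_self _).trans ((hη.slow t ht).trans hη.ϰ_le))
      -- The second entry of the minimum gives η < K₀/(ϰ + 3K₀) < 1/3, hence 2η ≤ 1.
      (fun t ht => by
        have h2 := (lt_min_iff.1 (hη.small t ht)).2
        have h3 := hη.ϰ_pos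
        rw [lt_div_iff₀ (by positivity)] at h2
        nlinarith [mul_pos (hη.pos t ht) h3, hη.pos t ht])
      hG1 hG (msErr_nonneg _ _ _ _) (div_mul_cancel₀ _ hK.ne').ge hG' ht
    refine h1.trans (add_le_add_right (mul_le_mul_of_nonneg_left ?_ (hη.pos t ht).le) _)
    have hκ := hη.κ_pos
    have : 0 ≤ 8 * κ * ((C + 10 * B) / K₀ + 2 * B + 1) := by positivity
    linarith
  · obtain ⟨C', hC', hb⟩ := recursion_bound_harmonic hK hConvex.K₀_le_one hC hB
      (sq_nonneg (CΘ + CΘ)) hγ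
    refine ⟨C', hC', fun ϑ₁ hϑ₁ t ht => ?_⟩
    have hγ0 : 0 < γ := lt_of_lt_of_le (by positivity) hγ
    obtain ⟨G, -, hG, hG'⟩ := hrec (fun s => γ / s) (fun t _ => by positivity) ϑ₁ hϑ₁
    exact hb _ G (msErr_le hConvex.bounded (interior_subset hConvex.inner_point)
      (m1.trans m2).le (m3.trans m4).le _ hϑ₁) hG hG' t ht
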